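/- **Setting.** Let $N\ge 1$, $h>0$ (e.g. $h=1/N$), let $\mathcal X_0,\dots,\mathcal X_N\subset\mathbb R$ be compact and $\Omega=\prod_{i=0}^N\mathcal X_i$, with coordinates $X_0,\dots,X_N$. For $1\le i\le N$ let $m_i$ (written $dx_i$) be a finite Borel measure on $\mathcal X_i$ that is not concentrated at a single point (e.g. Lebesgue measure on an interval, or counting measure on a grid). Let $\rho_0$ be a probability measure on $\mathcal X_0$, and $\rho_1$ a probability measure on $\mathcal X_N$ with a continuous and strictly positive density with respect to $m_N$. Let $F:\mathbb R\to\mathbb R$ be convex with $F(b)/|b|\to\infty$ as $|b|\to\infty$, and $F^*(l)=\sup_b(lb-F(b))$. For $0\le i<N$ let $$k_i(x,y)=w_i(x)\,g_{x+h\bar b_i(x),\,h\bar a_i(x)}(y),$$ where $g_{\mu,v}$ is the density of $\mathcal N(\mu,v)$ and $\bar b_i,\bar a_i,w_i$ are continuous on $\mathcal X_i$ with $\bar a_i,w_i>0$ ($w_i=1$: Gaussian restricted to $\mathcal X_{i+1}$; $w_i$ the inverse of its mass: renormalised Gaussian). The reference measure is $\overline{\mathbb P}=\rho_0(dx_0)\prod_{i<N}k_i(x_i,x_{i+1})\,m_{i+1}(dx_{i+1})$.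 Put $\lambda_0=\rho_0$ and $\lambda_i=m_i$ for $i\ge1$. For a probability measure $\mathbb P$ on $\Omega$ let $\mathbb P_i$, $\mathbb P_{i,i+1}$ be the laws of $X_i$, $(X_i,X_{i+1})$, let $\mathbb P_{i\to i+1}$ be the conditional law of $X_{i+1}$ given $X_i$, and $b_i(x)=\frac1h\int(y-x)\,\mathbb P_{i\to i+1}(x,dy)$. **Primal problem.** Minimise over all probability measures $\mathbb P$ on $\Omega$ $$h\sum_{i=0}^{N-1}\mathbb E_{\mathbb P_i}[F(b_i)]+\mathcal D(\mathbb P_0,\rho_0)+\mathcal D(\mathbb P_N,\rho_1)+h\,\mathcal H(\mathbb P|\overline{\mathbb P}),$$ where $\mathcal D(\mu,\rho)=0$ if $\mu=\rho$ and $+\infty$ otherwise, and $\mathcal H(\mathbb P|\overline{\mathbb P})=\mathbb E_{\mathbb P}[\log\frac{d\mathbb P}{d\overline{\mathbb P}}]+\overline{\mathbb P}(\Omega)-1$ if $\mathbb P\ll\overline{\mathbb P}$ (and the integral is finite), $+\infty$ otherwise. **Dual problem.** Over the vectors $\Phi=(\phi_{0,0},(\phi_{1,i})_{0\le i<N},\phi_{0,N})$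 of continuous functions on $\mathcal X_0$, $(\mathcal X_i)_{0\le i<N}$, $\mathcal X_N$, maximise $$\mathbb E_{\rho_0}\big[\phi_{0,0}-hF^*(-\tfrac1h\phi_{1,0})\big]+\mathbb E_{\rho_1}[\phi_{0,N}]-h\,\mathbb E_{\overline{\mathbb P}}\big[e^{\Delta\Phi/h}-1\big],$$ $$\Delta\Phi=\phi_{0,0}(x_0)+\sum_{i=1}^{N-1}hF^*(-\tfrac1h\phi_{1,i}(x_i))+\sum_{i=0}^{N-1}\tfrac1h(x_{i+1}-x_i)\phi_{1,i}(x_i)+\phi_{0,N}(x_N).$$ **Claim.** (i) The primal problem has exactly one solution $\mathbb P^h$, and $\mathbb P^h$ is Markovian. The dual problem has a solution, the two values are equal, and for every dual solution $\Phi$ $$\mathbb P^h=\exp\big(\tfrac1h\Delta\Phi\big)\,\overline{\mathbb P}.$$ (ii) Let $p_i$ and $p_{i,i+1}$ be the densities of $\mathbb P^h_i$ and $\mathbb P^h_{i,i+1}$ with respect to $\lambda_i$ and $\lambda_i\otimes\lambda_{i+1}$. Then $\mathbb P^h_{i\to i+1}(x,\cdot)$ has density $p_{i,i+1}(x,\cdot)/p_i(x)$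 with respect to $\lambda_{i+1}$ for $\mathbb P^h_i$-a.e. $x$, and $\mathbb P^h$ has density $\prod_{i<N}p_{i,i+1}(x_i,x_{i+1})/p_i(x_i)$ with respect to $\bigotimes_i\lambda_i$. For every dual solution $\Phi$ and all $0\le i<N$, $$\mathbb P^h_{i,i+1}(dx,dy)=\mathcal U_i(x)\,e^{\frac1{h^2}(y-x)\phi_{1,i}(x)}\,k_i(x,y)\,\mathcal D_{i+1}(y)\;\lambda_i(dx)\lambda_{i+1}(dy),$$ where $\mathcal U_0=e^{\phi_{0,0}/h}$, $\mathcal D_N=e^{\phi_{0,N}/h}$ and $$\mathcal U_{i+1}(y)=e^{F^*(-\frac1h\phi_{1,i+1}(y))}\int\mathcal U_i(x)\,e^{\frac1{h^2}(y-x)\phi_{1,i}(x)}k_i(x,y)\,\lambda_i(dx)\qquad(0\le i\le N-2),$$ $$\mathcal D_i(x)=e^{F^*(-\frac1h\phi_{1,i}(x))}\int k_i(x,y)\,e^{\frac1{h^2}(y-x)\phi_{1,i}(x)}\,\mathcal D_{i+1}(y)\,\lambda_{i+1}(dy)\qquad(1\le i\le N-1).$$ In terms of the two-time marginals of $\overline{\mathbb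 P}$, this says that $\mathbb P^h_{i,i+1}$ has density $\frac{\mathcal U_i(x)}{\overline{\mathcal U}_i(x)}e^{\frac1{h^2}(y-x)\phi_{1,i}(x)}\frac{\mathcal D_{i+1}(y)}{\overline{\mathcal D}_{i+1}(y)}$ with respect to $\overline{\mathbb P}_{i,i+1}$, where $\overline{\mathcal U},\overline{\mathcal D}$ solve the same recursions with all potentials and $F^*$ replaced by $0$ (so $\overline{\mathcal D}=1$, and $\overline{\mathcal U}_i$ is the density of $\overline{\mathbb P}_i$, when the $k_i$ are transition probability densities). -/

import Mathlib

open MeasureTheory ProbabilityTheory Set Filter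
open scoped NNReal ENNReal

noncomputable section

namespace EntropicSMOT

/-- Discrete paths `(x₀, …, x_N)`. -/
abbrev Path (N : ℕ) := Fin (N + 1) → ℝ

/-- The product `Ω = X₀ × ⋯ × X_N`. -/
def pathSpace (N : ℕ) (X : ℕ → Set ℝ) : Set (Path N) :=
  {ω | ∀ i : Fin (N + 1), ω i ∈ X i}

/-- The Legendre–Fenchel transform `F*(l) = sup_b (l b - F b)`. It is only used for superlinear
`F`, for which the supremum is finite for every `l`. -/
def conj (F : ℝ → ℝ) (l : ℝ) : ℝ := ⨆ b : ℝ, (l * b - F b)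

/-- The reference measures on the time slices: `ρ₀` at time `0`, and `m i` (playing the role
of `dxᵢ`) at the times `i ≥ 1`. -/
def slice (ρ₀ : Measure ℝ) (m : ℕ → Measure ℝ) (i : ℕ) : Measure ℝ :=
  if i = 0 then ρ₀ else m i

/-- The transition density of the reference chain from time `i` to time `i + 1`: the density of
`𝒩(x + h b̄ᵢ(x), h āᵢ(x))`, multiplied by a weight `wᵢ(x)`. The weight `1` is the plain restriction
of the Gaussian to the compact slice, the weight `(mass of the slice)⁻¹` the renormalised one. -/
def refDensity (h : ℝ) (bbar : ℕ → ℝ → ℝ) (abar : ℕ → ℝ → ℝ≥0) (w : ℕ → ℝ → ℝ)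
    (i : ℕ) (x y : ℝ) : ℝ :=
  w i x * gaussianPDFReal (x + h * bbar i x) (h.toNNReal * abar i x) y

/-- The reference path measure `lam₀(dx₀) ∏ kᵢ(xᵢ, xᵢ₊₁) lamᵢ₊₁(dxᵢ₊₁)`. -/
def refMeasure (N : ℕ) (lam : ℕ → Measure ℝ) (k : ℕ → ℝ → ℝ → ℝ) : Measure (Path N) :=
  (Measure.pi fun i : Fin (N + 1) => lam i).withDensity
    fun ω => ENNReal.ofReal (∏ i : Fin N, k i (ω i.castSucc) (ω i.succ))

/-- The law of `X_i`. -/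
def marginal {N : ℕ} (P : Measure (Path N)) (i : Fin (N + 1)) : Measure ℝ :=
  P.map fun ω => ω i

/-- The joint law of `(X_i, X_{i+1})`. -/
def twoMarginal {N : ℕ} (P : Measure (Path N)) (i : Fin N) : Measure (ℝ × ℝ) :=
  P.map fun ω => (ω i.castSucc, ω i.succ)

/-- The transition kernel `P_{i → i+1}`: the conditional law of `X_{i+1}` given `X_i`. -/
def transition {N : ℕ} (P : ProbabilityMeasure (Path N)) (i : Fin N) : Kernel ℝ ℝ :=
  condDistrib (fun ω : Path N => ω i.succ) (fun ω : Path N => ω i.castSucc) (P : Measure (Path N))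

/-- The discrete drift `b_i(x) = h⁻¹ E[X_{i+1} - x | X_i = x]`. -/
def drift {N : ℕ} (h : ℝ) (P : ProbabilityMeasure (Path N)) (i : Fin N) (x : ℝ) : ℝ :=
  1 / h * ∫ y, (y - x) ∂(transition P i x)

/-- The positions at the times `0, …, i`. -/
def past {N : ℕ} (i : Fin N) (ω : Path N) : {j : Fin (N + 1) // j ≤ i.castSucc} → ℝ :=
  fun j => ω j

/-- Markov property: the conditional law of `X_{i+1}` given `X_0, …, X_i` is the one given `X_i`. -/
def IsMarkov {N : ℕ} (P : ProbabilityMeasure (Path N)) : Prop :=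
  ∀ i : Fin N, ∀ᵐ p ∂((P : Measure (Path N)).map (past i)),
    condDistrib (fun ω : Path N => ω i.succ) (past i) (P : Measure (Path N)) p
      = transition P i (p ⟨i.castSucc, le_rfl⟩)

open Classical in
/-- Hard constraint: `0` if `μ = ρ` and `+∞` otherwise. -/
def hardPenalty (μ ρ : Measure ℝ) : EReal := if μ = ρ then 0 else ⊤

/-- The discrete primal functional. `klDiv P R` is `E_P[log dP/dR]` if `R` is a probability
measure, and `E_P[log dP/dR] + R(Ω) - 1` for a general finite `R`. -/
def primalObjective {N : ℕ} (h : ℝ) (F : ℝ → ℝ) (ρ₀ ρ₁ : Measure ℝ) (R : Measure (Path N))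
    (P : ProbabilityMeasure (Path N)) : EReal :=
  ((h * ∑ i : Fin N, ∫ x, F (drift h P i x) ∂(marginal (P : Measure (Path N)) i.castSucc) : ℝ)
      : EReal)
    + hardPenalty (marginal (P : Measure (Path N)) 0) ρ₀
    + hardPenalty (marginal (P : Measure (Path N)) (Fin.last N)) ρ₁
    + (h : EReal) * ((InformationTheory.klDiv (P : Measure (Path N)) R : ℝ≥0∞) : EReal)

/-- `P` is a minimiser of the primal functional over the probability measures on `Ω`. -/
def IsPrimalSolution {N : ℕ} (h : ℝ) (X : ℕ → Set ℝ) (F : ℝ → ℝ) (ρ₀ ρ₁ : Measure ℝ)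
    (R : Measure (Path N)) (P : ProbabilityMeasure (Path N)) : Prop :=
  (P : Measure (Path N)) (pathSpace N X)ᶜ = 0 ∧
    ∀ Q : ProbabilityMeasure (Path N), (Q : Measure (Path N)) (pathSpace N X)ᶜ = 0 →
      primalObjective h F ρ₀ ρ₁ R P ≤ primalObjective h F ρ₀ ρ₁ R Q

/-- A vector of potentials `Φ = (φ_{0,0}, (φ_{1,i})_{0 ≤ i < N}, φ_{0,N})`; the entries
`drift i` with `i ≥ N` are never used. -/
structure Potentials where
  init : ℝ → ℝ
  drift : ℕ → ℝ → ℝ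
  final : ℝ → ℝ

/-- The potentials are continuous functions on the slices. -/
def Potentials.IsCont (N : ℕ) (X : ℕ → Set ℝ) (Φ : Potentials) : Prop :=
  ContinuousOn Φ.init (X 0) ∧ (∀ i < N, ContinuousOn (Φ.drift i) (X i)) ∧
    ContinuousOn Φ.final (X N)

/-- The zero vector of potentials. -/
def Potentials.zero : Potentials := ⟨fun _ => 0, fun _ _ => 0, fun _ => 0⟩

/-- The function `Δ Φ` on paths. -/
def delta (N : ℕ) (h : ℝ) (F : ℝ → ℝ) (Φ : Potentials) (ω : Path N) : ℝ :=
  Φ.init (ω 0)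
    + ∑ i : Fin N, ((if (i : ℕ) = 0 then 0 else h * conj F (-(1 / h) * Φ.drift i (ω i.castSucc)))
        + 1 / h * (ω i.succ - ω i.castSucc) * Φ.drift i (ω i.castSucc))
    + Φ.final (ω (Fin.last N))

/-- The dual functional `- 𝓕*(-Φ) - h E_R[exp(ΔΦ / h) - 1]`, where
`𝓕*(Φ) = E_{ρ₀}[φ_{0,0} + h F*(φ_{1,0} / h)] + E_{ρ₁}[φ_{0,N}]`. -/
def dualObjective (N : ℕ) (h : ℝ) (F : ℝ → ℝ) (ρ₀ ρ₁ : Measure ℝ) (R : Measure (Path N))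
    (Φ : Potentials) : ℝ :=
  -((∫ x, (-Φ.init x + h * conj F (-Φ.drift 0 x / h)) ∂ρ₀) + ∫ x, -Φ.final x ∂ρ₁)
    - h * ∫ ω, (Real.exp (delta N h F Φ ω / h) - 1) ∂(R)

/-- `Φ` is a maximiser of the dual functional over the vectors of continuous potentials. -/
def IsDualSolution (N : ℕ) (h : ℝ) (X : ℕ → Set ℝ) (F : ℝ → ℝ) (ρ₀ ρ₁ : Measure ℝ)
    (R : Measure (Path N)) (Φ : Potentials) : Prop :=
  Φ.IsCont N X ∧ ∀ Ψ : Potentials, Ψ.IsCont N X →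
    dualObjective N h F ρ₀ ρ₁ R Ψ ≤ dualObjective N h F ρ₀ ρ₁ R Φ

/-- `U₀, …, U_{N-1}` solve the upward recursion (with `G` in the place of `F*`). -/
def IsUpward (N : ℕ) (h : ℝ) (G : ℝ → ℝ) (lam : ℕ → Measure ℝ) (k : ℕ → ℝ → ℝ → ℝ)
    (Φ : Potentials) (U : ℕ → ℝ → ℝ) : Prop :=
  (∀ x, U 0 x = Real.exp (1 / h * Φ.init x)) ∧
    ∀ i, i + 1 < N → ∀ y, U (i + 1) y = Real.exp (G (-(1 / h) * Φ.drift (i + 1) y)) *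
      ∫ x, U i x * Real.exp (1 / h ^ 2 * (y - x) * Φ.drift i x) * k i x y ∂(lam i)

/-- `D_N, …, D₁` solve the downward recursion (with `G` in the place of `F*`). -/
def IsDownward (N : ℕ) (h : ℝ) (G : ℝ → ℝ) (lam : ℕ → Measure ℝ) (k : ℕ → ℝ → ℝ → ℝ)
    (Φ : Potentials) (D : ℕ → ℝ → ℝ) : Prop :=
  (∀ x, D N x = Real.exp (1 / h * Φ.final x)) ∧
    ∀ i, 1 ≤ i → i < N → ∀ x, D i x = Real.exp (G (-(1 / h) * Φ.drift i x)) *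
      ∫ y, k i x y * Real.exp (1 / h ^ 2 * (y - x) * Φ.drift i x) * D (i + 1) y ∂(lam (i + 1))

/-- The density `P_i` of the law of `X_i` with respect to `lamᵢ`. -/
def marginalDensity {N : ℕ} (lam : ℕ → Measure ℝ) (P : Measure (Path N)) (i : Fin N) :
    ℝ → ℝ≥0∞ :=
  (marginal P i.castSucc).rnDeriv (lam i)

/-- The density `P_{i,i+1}` of the joint law of `(X_i, X_{i+1})` with respect to
`lamᵢ ⊗ lamᵢ₊₁`. -/
def twoMarginalDensity {N : ℕ} (lam : ℕ → Measure ℝ) (P : Measure (Path N)) (i : Fin N) :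
    ℝ × ℝ → ℝ≥0∞ :=
  (twoMarginal P i).rnDeriv ((lam i).prod (lam (i + 1)))

/-- The ratio of densities `P_{i,i+1} / P_i`. -/
def transitionDensity {N : ℕ} (lam : ℕ → Measure ℝ) (P : Measure (Path N)) (i : Fin N)
    (x y : ℝ) : ℝ≥0∞ :=
  twoMarginalDensity lam P i (x, y) / marginalDensity lam P i x

end EntropicSMOT

end

/-! The duality gap is an exact identity. For every competitor `Q` with the two prescribed marginals
and finite entropy, and for all continuous potentials, the primal value at `Q` minus the dual value
at `Φ` equals `h` times the relative entropy of `Q` with respect to `exp (ΔΦ / h) R`, plus `h` times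
the integrated gaps in Fenchel's inequality for `F` between the drift of `Q` and the slope `-φ/h`
(`duality_gap`). Both terms are nonnegative. So a single pair `(P, Ψ)` with `P = exp (ΔΨ / h) R`,
the right marginals and no Fenchel gap settles everything: `P` is optimal, `Ψ` is a dual optimiser,
the values agree. A second primal solution, or any other dual solution, must make the entropy term
vanish, which gives both uniqueness and the exponential representation.

The pair is built by dynamic programming. Write `l = -φ/h` for the slope. Given a terminal function
`D_N > 0`, set `D_i(x)` equal to the minimum over `l` of the integral of `exp (F*(l) - l (y - x) /
h) k_i(x, y) D_{i+1}(y)` (`RegularChain.exists_optBackward`). The integrand is log-convex in `l`,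
strictly enough because the slice measure is not a point mass, and it grows in `l` because `F` is
superlinear; hence the minimiser is unique and continuous in `x` (`exists_continuous_minimizer`).
Its first-order condition says that the drift of the tilted transition is a subgradient of `F*` at
`l` (`subgradient_of_minimizer`), which is equality in Fenchel's inequality
(`add_conj_eq_of_subgradient`). Starting the tilted chain with weight `1 / D_0` gives it the initial
law `ρ₀` automatically.

What remains is to choose `D_N` so that the final law is `ρ₁`, a nonlinear Schrödinger system
(`RegularChain.exists_fit`). With the other potentials eliminated, the dual becomes `J = ∫ log D_N
dρ₁ - ∫ log D_0 dρ₀`. If `S` is the forward density at time `N`, replacing `D_N` by `r₁ / S` never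
decreases `J`, and leaves it unchanged only if the terminal law already fits (`OptBackward.refit_le`
and the inequality `exp t ≥ 1 + t`). The optimal slopes are bounded independently of `D_N`, so `log
S` has a Lipschitz constant independent of `D_N`. Since `J` ignores additive constants in `log D_N`,
refitted functions can be normalised into one Arzelà–Ascoli compact set. A maximiser of `J` on that
set cannot be improved by refitting, hence it fits.

The Markov property, the conditional laws and the marginals come from a general computation for path
densities of product form `α₀ ∏ K_i β_N`: summing out the past produces the forward recursion `α`,
summing out the future the backward recursion `β`. This computation applies to the constructed pair
and, separately, to the representation by an arbitrary dual solution. -/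

noncomputable section

namespace EntropicSMOT

/-! ### Path measures of product form: forward and backward summation -/

section Chain

variable {N : ℕ} {lam : ℕ → Measure ℝ} {K : ℕ → ℝ → ℝ → ℝ≥0∞} {α β : ℕ → ℝ → ℝ≥0∞}

/-- `α` solves the forward recursion of the chain with kernels `K`. -/
def IsForward (N : ℕ) (lam : ℕ → Measure ℝ) (K : ℕ → ℝ → ℝ → ℝ≥0∞) (α : ℕ → ℝ → ℝ≥0∞) : Prop :=
  ∀ i < N, ∀ y, α (i + 1) y = ∫⁻ x, α i x * K i x y ∂lam i

/-- `β` solves the backward recursion of the chain with kernels `K`. -/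
def IsBackward (N : ℕ) (lam : ℕ → Measure ℝ) (K : ℕ → ℝ → ℝ → ℝ≥0∞) (β : ℕ → ℝ → ℝ≥0∞) : Prop :=
  ∀ i < N, ∀ x, β i x = ∫⁻ y, K i x y * β (i + 1) y ∂lam (i + 1)

/-- The product of the kernels over the steps before time `i`, with initial weight `a`. -/
def headWeight (N : ℕ) (a : ℝ → ℝ≥0∞) (K : ℕ → ℝ → ℝ → ℝ≥0∞) (i : ℕ) (ω : Path N) : ℝ≥0∞ :=
  a (ω 0) * ∏ j ∈ Finset.univ.filter (fun j : Fin N => (j : ℕ) < i), K j (ω j.castSucc) (ω j.succ)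

/-- The product of the kernels over the steps from time `i` on, with final weight `c`. -/
def tailWeight (N : ℕ) (K : ℕ → ℝ → ℝ → ℝ≥0∞) (c : ℝ → ℝ≥0∞) (i : ℕ) (ω : Path N) : ℝ≥0∞ :=
  (∏ j ∈ Finset.univ.filter (fun j : Fin N => i ≤ (j : ℕ)), K j (ω j.castSucc) (ω j.succ)) * c (ω (Fin.last N))

/-- The path density with initial weight `a`, kernels `K` and final weight `c`. -/
def chainWeight (N : ℕ) (a : ℝ → ℝ≥0∞) (K : ℕ → ℝ → ℝ → ℝ≥0∞) (c : ℝ → ℝ≥0∞) (ω : Path N) :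
    ℝ≥0∞ :=
  a (ω 0) * (∏ j : Fin N, K j (ω j.castSucc) (ω j.succ)) * c (ω (Fin.last N))

lemma measurable_kernel_eval (hK : ∀ i < N, Measurable (Function.uncurry (K i))) (j : Fin N) :
    Measurable fun ω : Path N => K j (ω j.castSucc) (ω j.succ) :=
  Measurable.comp (g := Function.uncurry (K j)) (f := fun ω : Path N => (ω j.castSucc, ω j.succ))
    (hK j j.2) ((measurable_pi_apply j.castSucc).prodMk (measurable_pi_apply j.succ))

lemma measurable_headWeight {a : ℝ → ℝ≥0∞} (ha : Measurable a)
    (hK : ∀ i < N, Measurable (Function.uncurry (K i))) (i : ℕ) :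
    Measurable (headWeight N a K i) :=
  (ha.comp (measurable_pi_apply _)).mul
    (Finset.measurable_prod _ fun j _ => measurable_kernel_eval hK j)

lemma measurable_tailWeight {c : ℝ → ℝ≥0∞} (hc : Measurable c)
    (hK : ∀ i < N, Measurable (Function.uncurry (K i))) (i : ℕ) :
    Measurable (tailWeight N K c i) :=
  (Finset.measurable_prod _ fun j _ => measurable_kernel_eval hK j).mul
    (hc.comp (measurable_pi_apply _))

lemma measurable_chainWeight {a c : ℝ → ℝ≥0∞} (ha : Measurable a) (hc : Measurable c)
    (hK : ∀ i < N, Measurable (Function.uncurry (K i))) :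
    Measurable (chainWeight N a K c) :=
  ((ha.comp (measurable_pi_apply _)).mul
    (Finset.measurable_prod _ fun j _ => measurable_kernel_eval hK j)).mul
    (hc.comp (measurable_pi_apply _))

lemma headWeight_mul_tailWeight (a c : ℝ → ℝ≥0∞) (i : ℕ) (ω : Path N) :
    headWeight N a K i ω * tailWeight N K c i ω = chainWeight N a K c ω := by
  have h := Finset.prod_filter_mul_prod_filter_not Finset.univ (fun j : Fin N => (j : ℕ) < i)
    (fun j => K j (ω j.castSucc) (ω j.succ))
  simp only [not_lt] at h
  rw [headWeight, tailWeight, chainWeight, ← h]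
  ring

lemma tailWeight_of_lt (c : ℝ → ℝ≥0∞) (i : Fin N) (ω : Path N) :
    tailWeight N K c i ω
      = K i (ω i.castSucc) (ω i.succ) * tailWeight N K c (i + 1) ω := by
  have : (Finset.univ.filter fun j : Fin N => (i : ℕ) ≤ j)
      = insert i (Finset.univ.filter fun j : Fin N => (i : ℕ) + 1 ≤ j) := by
    ext j; simp [Fin.ext_iff]; omega
  rw [tailWeight, this, Finset.prod_insert (by simp), mul_assoc, tailWeight]

lemma headWeight_succ (a : ℝ → ℝ≥0∞) (i : Fin N) (ω : Path N) :
    headWeight N a K (i + 1) ω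
      = headWeight N a K i ω * K i (ω i.castSucc) (ω i.succ) := by
  have : (Finset.univ.filter fun j : Fin N => (j : ℕ) < i + 1)
      = insert i (Finset.univ.filter fun j : Fin N => (j : ℕ) < i) := by
    ext j; simp [Fin.ext_iff]; omega
  rw [headWeight, this, Finset.prod_insert (by simp), headWeight]
  ring

lemma dependsOn_headWeight (a : ℝ → ℝ≥0∞) (i : Fin (N + 1)) :
    DependsOn (headWeight N a K i) {j : Fin (N + 1) | j ≤ i} := by
  intro x y hxy
  rw [headWeight, headWeight, hxy 0 (Fin.zero_le _)]
  congr 1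
  refine Finset.prod_congr rfl fun j hj => ?_
  have hj' : (j : ℕ) < i := by simpa using hj
  have h1 : j.castSucc ≤ i := Fin.le_def.2 (by rw [Fin.val_castSucc]; omega)
  have h2 : j.succ ≤ i := Fin.le_def.2 (by rw [Fin.val_succ]; omega)
  rw [hxy j.castSucc h1, hxy j.succ h2]

/-- The future is integrated out one coordinate at a time, and each step uses one instance of the
backward recursion. The factor `G`, a function of the past, is kept general so that it can absorb
one kernel per induction step. -/
lemma lmarginal_mul_tailWeight [∀ i, SigmaFinite (lam i)]
    (hK : ∀ i < N, Measurable (Function.uncurry (K i)))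
    (hβm : ∀ i ≤ N, Measurable (β i)) (hβ : IsBackward N lam K β) (n : ℕ) (i : Fin (N + 1))
    (hin : (i : ℕ) + n = N) (G : Path N → ℝ≥0∞) (hG : Measurable G)
    (hGd : DependsOn G {j : Fin (N + 1) | j ≤ i}) :
    lmarginal (fun j : Fin (N + 1) => lam j) (Finset.univ.filter fun j => i < j)
      (fun ω => G ω * tailWeight N K (β N) i ω) = fun ω => G ω * β i (ω i) := by
  induction n generalizing i G with
  | zero =>
    have hi : i = Fin.last N := Fin.ext (by simpa using hin)
    have h1 : (Finset.univ.filter fun j => Fin.last N < j) = ∅ := by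
      ext j; simpa using Fin.le_last j
    have h2 : (Finset.univ.filter fun j : Fin N => N ≤ (j : ℕ)) = ∅ := by
      ext j; simp
    subst hi
    funext ω
    simp [h1, h2, tailWeight]
  | succ n ih =>
    obtain ⟨i', rfl⟩ : ∃ i' : Fin N, i = i'.castSucc :=
      ⟨⟨i, by omega⟩, rfl⟩
    have hset : (Finset.univ.filter fun j : Fin (N + 1) => i'.castSucc < j)
        = insert i'.succ (Finset.univ.filter fun j : Fin (N + 1) => i'.succ < j) := by
      ext j; simp [Fin.ext_iff, Fin.lt_def]; omega
    -- The kernel leaving the present is moved into `G`, which then depends on one more coordinate;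
    -- the induction hypothesis applies to the later time.
    have hfun : (fun ω : Path N => G ω * tailWeight N K (β N) i'.castSucc ω)
        = fun ω => (G ω * K i' (ω i'.castSucc) (ω i'.succ))
            * tailWeight N K (β N) i'.succ ω := by
      funext ω
      have := tailWeight_of_lt (K := K) (β N) i' ω
      simp only [Fin.val_castSucc, Fin.val_succ]
      rw [this, mul_assoc]
    have hGm : Measurable fun ω : Path N => G ω * K i' (ω i'.castSucc) (ω i'.succ) :=
      hG.mul (measurable_kernel_eval hK i')
    rw [hfun, hset]
    funext ω
    rw [lmarginal_insert (fun ω => _) (hGm.fun_mul (measurable_tailWeight (hβm N le_rfl) hK _)) (by simp)]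
    rw [ih i'.succ (by simp at hin ⊢; omega) _ hGm]
    · have e1 : ∀ y, G (Function.update ω i'.succ y) = G ω := fun y => hGd fun j hj => by
        rw [Function.update_of_ne]
        rintro rfl
        simp [Fin.le_def] at hj
      simp only [e1, Function.update_self]
      have hne : i'.castSucc ≠ i'.succ := by simp [Fin.ext_iff]
      simp only [Function.update_of_ne hne, mul_assoc]
      rw [lintegral_const_mul, Fin.val_castSucc, hβ _ i'.2, Fin.val_succ]
      exact ((hK i' i'.2).comp measurable_prodMk_left).mul (hβm _ i'.2)
    · intro x y hxy
      have h1 : i'.castSucc ≤ i'.succ := Fin.castSucc_le_succ i'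
      simp only [hxy i'.castSucc h1, hxy i'.succ (le_refl i'.succ)]
      congr 1
      exact hGd fun j hj => hxy j (le_trans hj h1)

/-- Time reversal of the preceding argument: integrating out the past collapses the head of the
product to the forward solution. -/
lemma lmarginal_headWeight_mul [∀ i, SigmaFinite (lam i)]
    (hK : ∀ i < N, Measurable (Function.uncurry (K i)))
    (hαm : ∀ i ≤ N, Measurable (α i)) (hα : IsForward N lam K α) (n : ℕ) (i : Fin (N + 1))
    (hin : (i : ℕ) = n) (G : Path N → ℝ≥0∞) (hG : Measurable G)
    (hGd : DependsOn G {j : Fin (N + 1) | i ≤ j}) :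
    lmarginal (fun j : Fin (N + 1) => lam j) (Finset.univ.filter fun j => j < i)
      (fun ω => headWeight N (α 0) K i ω * G ω) = fun ω => α i (ω i) * G ω := by
  induction n generalizing i G with
  | zero =>
    have hi : i = 0 := Fin.ext (by simpa using hin)
    subst hi
    funext ω
    simp [headWeight]
  | succ n ih =>
    obtain ⟨i', rfl⟩ : ∃ i' : Fin N, i = i'.succ :=
      ⟨⟨n, by omega⟩, Fin.ext (by simpa using hin)⟩
    have hset : (Finset.univ.filter fun j : Fin (N + 1) => j < i'.succ)
        = insert i'.castSucc (Finset.univ.filter fun j : Fin (N + 1) => j < i'.castSucc) := by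
      ext j; simp [Fin.ext_iff, Fin.lt_def]; omega
    have hfun : (fun ω : Path N => headWeight N (α 0) K i'.succ ω * G ω)
        = fun ω => headWeight N (α 0) K i'.castSucc ω
            * (K i' (ω i'.castSucc) (ω i'.succ) * G ω) := by
      funext ω
      have := headWeight_succ (K := K) (α 0) i' ω
      simp only [Fin.val_castSucc, Fin.val_succ]
      rw [this, mul_assoc]
    have hGm : Measurable fun ω : Path N => K i' (ω i'.castSucc) (ω i'.succ) * G ω :=
      (measurable_kernel_eval hK i').mul hG
    rw [hfun, hset]
    funext ω
    rw [lmarginal_insert (fun ω => _) ((measurable_headWeight (hαm 0 (zero_le)) hK _).fun_mul hGm) (by simp)]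
    rw [ih i'.castSucc (by simp at hin ⊢; omega) _ hGm]
    · have e1 : ∀ y, G (Function.update ω i'.castSucc y) = G ω := fun y => hGd fun j hj => by
        rw [Function.update_of_ne]
        rintro rfl
        simp [Fin.le_def] at hj
      simp only [e1, Function.update_self]
      have hne : i'.succ ≠ i'.castSucc := by simp [Fin.ext_iff]
      simp only [Function.update_of_ne hne, ← mul_assoc]
      rw [lintegral_mul_const, Fin.val_succ, hα _ i'.2, Fin.val_castSucc]
      exact (hαm _ (by simp)).mul ((hK i' i'.2).comp measurable_prodMk_right)
    · intro x y hxy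
      have h1 : i'.castSucc ≤ i'.succ := Fin.castSucc_le_succ i'
      simp only [hxy i'.castSucc (le_refl i'.castSucc), hxy i'.succ h1]
      congr 1
      exact hGd fun j hj => hxy j (le_trans h1 hj)

/-- Integrating out the future of time `i`. -/
lemma lintegral_mul_chainWeight [∀ i, SigmaFinite (lam i)]
    {a : ℝ → ℝ≥0∞} (ha : Measurable a)
    (hK : ∀ i < N, Measurable (Function.uncurry (K i)))
    (hβm : ∀ i ≤ N, Measurable (β i)) (hβ : IsBackward N lam K β) (i : Fin (N + 1))
    (G : Path N → ℝ≥0∞) (hG : Measurable G) (hGd : DependsOn G {j : Fin (N + 1) | j ≤ i})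
    (x : Path N) :
    ∫⁻ ω, G ω * chainWeight N a K (β N) ω ∂(Measure.pi fun j : Fin (N + 1) => lam j)
      = lmarginal (fun j : Fin (N + 1) => lam j) (Finset.univ.filter fun j => j ≤ i)
          (fun ω => headWeight N a K i ω * (G ω * β i (ω i))) x := by
  have hh := measurable_headWeight ha hK (i : ℕ)
  have e : ∀ ω : Path N, G ω * chainWeight N a K (β N) ω
      = (G ω * headWeight N a K i ω) * tailWeight N K (β N) i ω := fun ω => by
    rw [mul_assoc, headWeight_mul_tailWeight]
  have hd : DependsOn (fun ω => G ω * headWeight N a K i ω) {j : Fin (N + 1) | j ≤ i} := by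
    intro x y hxy
    simp only
    rw [hGd hxy, dependsOn_headWeight a i hxy]
  have hu : (Finset.univ : Finset (Fin (N + 1)))
      = (Finset.univ.filter fun j => j ≤ i) ∪ (Finset.univ.filter fun j => i < j) := by
    ext j; simpa using le_or_gt j i
  have hdisj : Disjoint (Finset.univ.filter fun j : Fin (N + 1) => j ≤ i)
      (Finset.univ.filter fun j : Fin (N + 1) => i < j) := by
    rw [Finset.disjoint_left]
    intro j; simp
  simp only [e]
  -- The base point `x` is arbitrary: a marginal over all coordinates is a constant function.
  rw [lintegral_eq_lmarginal_univ x]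
  conv_lhs => rw [hu]
  rw [lmarginal_union _ (fun ω => _)
    ((hG.fun_mul hh).fun_mul (measurable_tailWeight (hβm N le_rfl) hK i)) hdisj]
  have := lmarginal_mul_tailWeight hK hβm hβ (N - i) i (by omega) _ (hG.mul hh) hd
  simp only [Pi.mul_apply] at this
  rw [this]
  congr 2
  funext ω
  ring

/-- The path measure with initial weight `α 0`, kernels `K` and final weight `β N`. -/
def chainMeasure (N : ℕ) (lam : ℕ → Measure ℝ) (a : ℝ → ℝ≥0∞) (K : ℕ → ℝ → ℝ → ℝ≥0∞)
    (c : ℝ → ℝ≥0∞) : Measure (Path N) :=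
  (Measure.pi fun j : Fin (N + 1) => lam j).withDensity (chainWeight N a K c)

lemma lintegral_chainMeasure [∀ i, SigmaFinite (lam i)] {a c : ℝ → ℝ≥0∞} (ha : Measurable a)
    (hc : Measurable c) (hK : ∀ i < N, Measurable (Function.uncurry (K i)))
    {G : Path N → ℝ≥0∞} (hG : Measurable G) :
    ∫⁻ ω, G ω ∂(chainMeasure N lam a K c)
      = ∫⁻ ω, G ω * chainWeight N a K c ω ∂(Measure.pi fun j : Fin (N + 1) => lam j) := by
  rw [chainMeasure, lintegral_withDensity_eq_lintegral_mul _ (measurable_chainWeight ha hc hK) hG]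
  simp only [Pi.mul_apply, mul_comm]

/-- Future and past of time `i` are integrated out separately; they meet only in the coordinate `i`,
which leaves the product of the forward and backward solutions. -/
lemma marginal_chainMeasure [∀ i, SigmaFinite (lam i)]
    (hK : ∀ i < N, Measurable (Function.uncurry (K i)))
    (hαm : ∀ i ≤ N, Measurable (α i)) (hα : IsForward N lam K α)
    (hβm : ∀ i ≤ N, Measurable (β i)) (hβ : IsBackward N lam K β) (i : Fin (N + 1)) :
    marginal (chainMeasure N lam (α 0) K (β N)) i
      = (lam i).withDensity fun x => α i x * β i x := by
  have hi : (i : ℕ) ≤ N := by omega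
  have hm : Measurable fun x => α i x * β i x := (hαm i hi).mul (hβm i hi)
  refine Measure.ext_of_lintegral _ fun f hf => ?_
  have hfi : Measurable fun ω : Path N => f (ω i) := hf.comp (measurable_pi_apply i)
  rw [marginal, lintegral_map hf (measurable_pi_apply i),
    lintegral_chainMeasure (hαm 0 (zero_le)) (hβm N le_rfl) hK hfi,
    lintegral_mul_chainWeight (hαm 0 (zero_le)) hK hβm hβ i _ hfi _ 0,
    lintegral_withDensity_eq_lintegral_mul _ hm hf]
  · have hu : (Finset.univ.filter fun j : Fin (N + 1) => j ≤ i)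
        = {i} ∪ (Finset.univ.filter fun j => j < i) := by
      ext j; simp [le_iff_eq_or_lt]
    have hG : Measurable fun ω : Path N => f (ω i) * β i (ω i) :=
      hfi.mul ((hβm i hi).comp (measurable_pi_apply i))
    rw [hu, lmarginal_union _ (fun ω => _)
      ((measurable_headWeight (hαm 0 (zero_le)) hK _).fun_mul hG) (by simp),
      lmarginal_headWeight_mul hK hαm hα i i rfl _ hG, lmarginal_singleton]
    · simp only [Function.update_self, Pi.mul_apply]
      refine lintegral_congr fun x => ?_
      ring
    · intro x y hxy
      simp only [hxy i (by simp)]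
  · intro x y hxy
    simp only [hxy i (by simp)]

lemma twoMarginal_chainMeasure [∀ i, SigmaFinite (lam i)]
    (hK : ∀ i < N, Measurable (Function.uncurry (K i)))
    (hαm : ∀ i ≤ N, Measurable (α i)) (hα : IsForward N lam K α)
    (hβm : ∀ i ≤ N, Measurable (β i)) (hβ : IsBackward N lam K β) (i : Fin N) :
    twoMarginal (chainMeasure N lam (α 0) K (β N)) i
      = ((lam i).prod (lam (i + 1))).withDensity
          fun z => α i z.1 * K i z.1 z.2 * β (i + 1) z.2 := by
  have hα1 := hαm i (by omega)
  have hβ1 := hβm (i + 1) (by omega)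
  have hm : Measurable fun z : ℝ × ℝ => α i z.1 * K i z.1 z.2 * β (i + 1) z.2 :=
    ((hα1.comp measurable_fst).mul (hK i i.2)).mul (hβ1.comp measurable_snd)
  refine Measure.ext_of_lintegral _ fun f hf => ?_
  have hpm : Measurable fun ω : Path N => (ω i.castSucc, ω i.succ) :=
    (measurable_pi_apply i.castSucc).prodMk (measurable_pi_apply i.succ)
  have hfi : Measurable fun ω : Path N => f (ω i.castSucc, ω i.succ) := hf.comp hpm
  rw [twoMarginal, lintegral_map hf hpm,
    lintegral_chainMeasure (hαm 0 (zero_le)) (hβm N le_rfl) hK hfi,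
    lintegral_mul_chainWeight (hαm 0 (zero_le)) hK hβm hβ i.succ _ hfi _ 0,
    lintegral_withDensity_eq_lintegral_mul _ hm hf, lintegral_prod _ (hm.mul hf).aemeasurable]
  · have hu : (Finset.univ.filter fun j : Fin (N + 1) => j ≤ i.succ)
        = insert i.castSucc {i.succ} ∪ (Finset.univ.filter fun j => j < i.castSucc) := by
      ext j; simp [Fin.ext_iff, Fin.le_def, Fin.lt_def]; omega
    have hG : Measurable fun ω : Path N => K i (ω i.castSucc) (ω i.succ) *
        (f (ω i.castSucc, ω i.succ) * β (i + 1) (ω i.succ)) :=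
      (measurable_kernel_eval hK i).mul (hfi.mul (hβ1.comp (measurable_pi_apply _)))
    have hfun : (fun ω : Path N => headWeight N (α 0) K i.succ ω
          * (f (ω i.castSucc, ω i.succ) * β i.succ (ω i.succ)))
        = fun ω => headWeight N (α 0) K i.castSucc ω * (K i (ω i.castSucc) (ω i.succ) *
        (f (ω i.castSucc, ω i.succ) * β (i + 1) (ω i.succ))) := by
      funext ω
      have := headWeight_succ (K := K) (α 0) i ω
      simp only [Fin.val_castSucc, Fin.val_succ]
      rw [this, mul_assoc]
    have hdisj : Disjoint (insert i.castSucc {i.succ} : Finset (Fin (N + 1)))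
        (Finset.univ.filter fun j => j < i.castSucc) := by
      rw [Finset.disjoint_right]
      intro j; simp [Fin.ext_iff, Fin.lt_def]; omega
    have hne : i.castSucc ≠ i.succ := by simp [Fin.ext_iff]
    have hG2 : Measurable fun ω : Path N => α i (ω i.castSucc) * (K i (ω i.castSucc) (ω i.succ) *
        (f (ω i.castSucc, ω i.succ) * β (i + 1) (ω i.succ))) :=
      (hα1.comp (measurable_pi_apply _)).mul hG
    rw [hfun, hu, lmarginal_union _ (fun ω => _)
      ((measurable_headWeight (hαm 0 (zero_le)) hK _).fun_mul hG) hdisj,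
      lmarginal_headWeight_mul hK hαm hα i i.castSucc rfl _ hG]
    · rw [Fin.val_castSucc, lmarginal_insert _ hG2 (by simpa using hne), lmarginal_singleton]
      simp only [Function.update_self, Pi.mul_apply, Function.update_of_ne hne, Fin.val_castSucc,
        Fin.val_succ]
      refine lintegral_congr fun x => lintegral_congr fun y => ?_
      ring
    · intro x y hxy
      simp only [hxy i.castSucc (by simp), hxy i.succ (by simp [Fin.le_def])]
  · intro x y hxy
    simp only [hxy i.castSucc (by simp [Fin.le_def]), hxy i.succ (by simp)]

/-- One step of the chain, given its past. -/
lemma lintegral_chainMeasure_update [∀ i, SigmaFinite (lam i)]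
    {a : ℝ → ℝ≥0∞} (ha : Measurable a) (hK : ∀ i < N, Measurable (Function.uncurry (K i)))
    (hβm : ∀ i ≤ N, Measurable (β i)) (hβ : IsBackward N lam K β) (i : Fin N)
    (hβ0 : ∀ x, β i x ≠ 0) (hβt : ∀ x, β i x ≠ ∞)
    (G : Path N → ℝ≥0∞) (hG : Measurable G) (hGd : DependsOn G {j : Fin (N + 1) | j ≤ i.succ}) :
    ∫⁻ ω, G ω ∂(chainMeasure N lam a K (β N))
      = ∫⁻ ω, (∫⁻ y, (K i (ω i.castSucc) y * β (i + 1) y / β i (ω i.castSucc))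
          * G (Function.update ω i.succ y) ∂lam (i + 1)) ∂(chainMeasure N lam a K (β N)) := by
  have hne : i.castSucc ≠ i.succ := by simp [Fin.ext_iff]
  have hβ1 := hβm (i + 1) (by omega)
  have hβs : Measurable (β (i.succ : ℕ)) := hβ1
  have hβi := hβm i (by omega)
  have hup : Measurable fun p : Path N × ℝ => Function.update p.1 i.succ p.2 := by
    rw [measurable_pi_iff]
    intro j
    rcases eq_or_ne j i.succ with rfl | hj
    · simpa using measurable_snd
    · simp only [Function.update_of_ne hj]
      exact (measurable_pi_apply j).comp measurable_fst
  have hG' : Measurable fun ω : Path N =>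
      ∫⁻ y, (K i (ω i.castSucc) y * β (i + 1) y / β i (ω i.castSucc))
          * G (Function.update ω i.succ y) ∂lam (i + 1) := by
    refine Measurable.lintegral_prod_right (f := fun (ω : Path N) (y : ℝ) =>
      (K i (ω i.castSucc) y * β (i + 1) y / β i (ω i.castSucc))
          * G (Function.update ω i.succ y)) ?_
    have h1 : Measurable fun p : Path N × ℝ => p.1 i.castSucc :=
      (measurable_pi_apply _).comp measurable_fst
    exact ((((hK i i.2).comp (h1.prodMk measurable_snd)).mul (hβ1.comp measurable_snd)).div
      (hβi.comp h1)).mul (hG.comp hup)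
  rw [lintegral_chainMeasure ha (hβm N le_rfl) hK hG,
    lintegral_chainMeasure ha (hβm N le_rfl) hK hG',
    lintegral_mul_chainWeight ha hK hβm hβ i.succ _ hG hGd 0,
    lintegral_mul_chainWeight ha hK hβm hβ i.castSucc _ hG' _ 0]
  · have hu : (Finset.univ.filter fun j : Fin (N + 1) => j ≤ i.succ)
        = insert i.succ (Finset.univ.filter fun j => j ≤ i.castSucc) := by
      ext j; simp [Fin.ext_iff, Fin.le_def]; omega
    -- The integral over the coordinate `i + 1` is put innermost. The head up to time `i` does not
    -- see that coordinate, so both sides can be compared under the integral over the coordinates up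
    -- to `i`.
    rw [hu, lmarginal_insert' (fun ω => _)
      ((measurable_headWeight ha hK i.succ).fun_mul
        (hG.fun_mul (Measurable.fun_comp hβs (measurable_pi_apply i.succ))))
      (by simp [Fin.le_def])]
    congr 1
    funext ω
    have hhd : ∀ y, headWeight N a K i (Function.update ω i.succ y) = headWeight N a K i ω :=
      fun y => dependsOn_headWeight a i.castSucc fun j hj => by
        rw [Function.update_of_ne]
        rintro rfl
        simp [Fin.le_def] at hj
    simp only [Fin.val_succ, Fin.val_castSucc, headWeight_succ, hhd, Function.update_self,
      Function.update_of_ne hne]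
    have hm1 : Measurable fun y => (K i (ω i.castSucc) y * β (i + 1) y / β i (ω i.castSucc))
          * G (Function.update ω i.succ y) :=
      ((((hK i i.2).comp measurable_prodMk_left).mul hβ1).div_const _).mul
        (hG.comp (measurable_update _))
    rw [← lintegral_mul_const _ hm1, ← lintegral_const_mul _ (hm1.mul_const _)]
    refine lintegral_congr fun y => ?_
    rw [show ∀ a b c d e : ℝ≥0∞, a * (b / c * d * e) = a * b * (d * (e / c)) from fun a b c d e => by
      simp only [div_eq_mul_inv]; ring, ENNReal.div_self (hβ0 _) (hβt _)]
    ring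
  · intro x y hxy
    simp only [hxy i.castSucc (by simp)]
    refine lintegral_congr fun z => ?_
    congr 1
    refine hGd fun j hj => ?_
    rcases eq_or_ne j i.succ with rfl | hj'
    · simp
    · rw [Function.update_of_ne hj', Function.update_of_ne hj']
      refine hxy j ?_
      simp [Fin.le_def, Fin.ext_iff] at hj hj' ⊢
      omega

end Chain

end EntropicSMOT

end

noncomputable section

namespace EntropicSMOT

/-! ### Conditional laws, the Markov property and transition densities of a chain -/

section ChainTransition

variable {N : ℕ} {lam : ℕ → Measure ℝ} {K : ℕ → ℝ → ℝ → ℝ≥0∞} {α β : ℕ → ℝ → ℝ≥0∞}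

/-- The transition kernel of the chain with kernels `K`, conditioned through `β`. -/
def stepKernel (lam : ℕ → Measure ℝ) [∀ i, SFinite (lam i)] (K : ℕ → ℝ → ℝ → ℝ≥0∞)
    (β : ℕ → ℝ → ℝ≥0∞) (i : ℕ) : Kernel ℝ ℝ :=
  Kernel.withDensity (Kernel.const ℝ (lam (i + 1))) fun x y => K i x y * β (i + 1) y / β i x

lemma measurable_stepDensity {i : ℕ} (hK : Measurable (Function.uncurry (K i)))
    (hβ0 : Measurable (β i)) (hβ1 : Measurable (β (i + 1))) :
    Measurable (Function.uncurry fun x y => K i x y * β (i + 1) y / β i x) :=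
  (Measurable.mul hK (hβ1.comp measurable_snd)).div (hβ0.comp measurable_fst)

lemma stepKernel_apply [∀ i, SFinite (lam i)] {i : ℕ} (hK : Measurable (Function.uncurry (K i)))
    (hβ0 : Measurable (β i)) (hβ1 : Measurable (β (i + 1))) (x : ℝ) :
    stepKernel lam K β i x
      = (lam (i + 1)).withDensity fun y => K i x y * β (i + 1) y / β i x := by
  rw [stepKernel, Kernel.withDensity_apply _ (measurable_stepDensity hK hβ0 hβ1)]
  simp

/-- Doob's transform: the backward recursion is precisely the normalisation of `K i x y * β (i + 1)
y` by `β i x`. -/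
lemma isMarkovKernel_stepKernel [∀ i, SFinite (lam i)] {i : ℕ}
    (hK : Measurable (Function.uncurry (K i))) (hβ0 : Measurable (β i))
    (hβ1 : Measurable (β (i + 1))) (hpos : ∀ x, β i x ≠ 0) (htop : ∀ x, β i x ≠ ∞)
    (hβ : ∀ x, β i x = ∫⁻ y, K i x y * β (i + 1) y ∂lam (i + 1)) :
    IsMarkovKernel (stepKernel lam K β i) := by
  refine ⟨fun x => ⟨?_⟩⟩
  have hm : Measurable fun y => K i x y * β (i + 1) y :=
    (hK.comp measurable_prodMk_left).mul hβ1
  rw [stepKernel_apply hK hβ0 hβ1, withDensity_apply _ MeasurableSet.univ, setLIntegral_univ]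
  simp only [div_eq_mul_inv]
  rw [lintegral_mul_const _ hm, ← hβ, ENNReal.mul_inv_cancel (hpos x) (htop x)]

/-- The conditional law of the next position given an observation of the past that contains the
present position. -/
lemma condDistrib_chainMeasure [∀ i, SigmaFinite (lam i)]
    {a : ℝ → ℝ≥0∞} (ha : Measurable a) (hK : ∀ i < N, Measurable (Function.uncurry (K i)))
    (hβm : ∀ i ≤ N, Measurable (β i)) (hβ : IsBackward N lam K β) (i : Fin N)
    (hβ0 : ∀ x, β i x ≠ 0) (hβt : ∀ x, β i x ≠ ∞)
    {μ : Measure (Path N)} [IsFiniteMeasure μ] (hμ : μ = chainMeasure N lam a K (β N))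
    {γ : Type*} [MeasurableSpace γ] {Z : Path N → γ} (hZ : Measurable Z)
    (hZd : DependsOn Z {j : Fin (N + 1) | j ≤ i.castSucc}) {p : γ → ℝ} (hp : Measurable p)
    (hpZ : ∀ ω, p (Z ω) = ω i.castSucc) :
    condDistrib (fun ω : Path N => ω i.succ) Z μ
      =ᵐ[μ.map Z] fun z => stepKernel lam K β i (p z) := by
  subst hμ
  have hβ1 := hβm (i + 1) (by omega)
  have hβi := hβm i (by omega)
  have hmk := isMarkovKernel_stepKernel (hK i i.2) hβi hβ1 hβ0 hβt (hβ i i.2)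
  have hs : Measurable fun ω : Path N => ω i.succ := measurable_pi_apply _
  refine condDistrib_ae_eq_of_measure_eq_compProd
    (κ := (stepKernel lam K β i).comap p hp) Z hs.aemeasurable ?_
  refine Measure.ext_of_lintegral _ fun f hf => ?_
  have hne : i.castSucc ≠ i.succ := by simp [Fin.ext_iff]
  rw [lintegral_map hf (hZ.prodMk hs), Measure.lintegral_compProd hf,
    lintegral_map (Measurable.lintegral_kernel_prod_right' hf) hZ,
    lintegral_chainMeasure_update ha hK hβm hβ i hβ0 hβt (fun ω => _) (Measurable.fun_comp hf (hZ.prodMk hs))]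
  · refine lintegral_congr fun ω => ?_
    rw [Kernel.comap_apply, hpZ, stepKernel_apply (hK i i.2) hβi hβ1,
      lintegral_withDensity_eq_lintegral_mul _ _ (Measurable.fun_comp hf measurable_prodMk_left)]
    · refine lintegral_congr fun y => ?_
      have : Z (Function.update ω i.succ y) = Z ω := hZd fun j hj => by
        rw [Function.update_of_ne]
        rintro rfl
        exact absurd (Fin.le_def.1 hj) (by simp)
      simp [this]
    · exact (measurable_stepDensity (hK i i.2) hβi hβ1).comp measurable_prodMk_left
  · intro x y hxy
    simp only
    rw [hxy i.succ (le_refl i.succ),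
      hZd fun j hj => hxy j (le_trans (b := i.castSucc) hj (Fin.castSucc_le_succ i))]

variable {P : ProbabilityMeasure (Path N)}

lemma transition_chainMeasure [∀ i, SigmaFinite (lam i)]
    {a : ℝ → ℝ≥0∞} (ha : Measurable a) (hK : ∀ i < N, Measurable (Function.uncurry (K i)))
    (hβm : ∀ i ≤ N, Measurable (β i)) (hβ : IsBackward N lam K β)
    (hβ0 : ∀ i < N, ∀ x, β i x ≠ 0) (hβt : ∀ i < N, ∀ x, β i x ≠ ∞)
    (hP : (P : Measure (Path N)) = chainMeasure N lam a K (β N)) (i : Fin N) :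
    ∀ᵐ x ∂marginal (P : Measure (Path N)) i.castSucc,
      transition P i x = (lam (i + 1)).withDensity fun y => K i x y * β (i + 1) y / β i x := by
  have h := condDistrib_chainMeasure ha hK hβm hβ i (hβ0 i i.2) (hβt i i.2) hP
    (Z := fun ω : Path N => ω i.castSucc) (measurable_pi_apply _)
    (fun x y hxy => hxy _ (le_refl i.castSucc)) measurable_id (fun _ => rfl)
  filter_upwards [h] with x hx
  rw [transition, hx]
  exact stepKernel_apply (hK i i.2) (hβm i (by omega)) (hβm _ (by omega)) x

/-- Conditioning on the whole past and conditioning on the present alone yield the same kernel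
evaluated at the present position: both are instances of `condDistrib_chainMeasure`, whose
observation `Z` was left general for this purpose. -/
lemma isMarkov_chainMeasure [∀ i, SigmaFinite (lam i)]
    {a : ℝ → ℝ≥0∞} (ha : Measurable a) (hK : ∀ i < N, Measurable (Function.uncurry (K i)))
    (hβm : ∀ i ≤ N, Measurable (β i)) (hβ : IsBackward N lam K β)
    (hβ0 : ∀ i < N, ∀ x, β i x ≠ 0) (hβt : ∀ i < N, ∀ x, β i x ≠ ∞)
    (hP : (P : Measure (Path N)) = chainMeasure N lam a K (β N)) : IsMarkov P := by
  intro i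
  have hpm : Measurable (past i : Path N → _) :=
    measurable_pi_iff.2 fun j => measurable_pi_apply _
  have hproj : Measurable fun p : {j : Fin (N + 1) // j ≤ i.castSucc} → ℝ =>
      p ⟨i.castSucc, le_rfl⟩ := measurable_pi_apply _
  have h := condDistrib_chainMeasure ha hK hβm hβ i (hβ0 i i.2) (hβt i i.2) hP
    (Z := past i) hpm (fun x y hxy => funext fun j => hxy _ j.2) hproj (fun _ => rfl)
  have h2 := transition_chainMeasure ha hK hβm hβ hβ0 hβt hP i
  have h3 : marginal (P : Measure (Path N)) i.castSucc
      = ((P : Measure (Path N)).map (past i)).map fun p => p ⟨i.castSucc, le_rfl⟩ := by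
    rw [Measure.map_map hproj hpm]; rfl
  rw [h3] at h2
  filter_upwards [h, ae_of_ae_map hproj.aemeasurable h2] with p hp1 hp2
  rw [hp1, hp2, stepKernel_apply (hK i i.2) (hβm i (by omega)) (hβm _ (by omega))]

/-- The forward solution is a common factor of the one-time and two-time densities and cancels in
their quotient, since it is neither zero nor infinite. -/
lemma transitionDensity_chainMeasure [∀ i, SigmaFinite (lam i)]
    (hK : ∀ i < N, Measurable (Function.uncurry (K i)))
    (hαm : ∀ i ≤ N, Measurable (α i)) (hα : IsForward N lam K α)
    (hβm : ∀ i ≤ N, Measurable (β i)) (hβ : IsBackward N lam K β)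
    (hα0 : ∀ i < N, ∀ x, α i x ≠ 0) (hαt : ∀ i < N, ∀ x, α i x ≠ ∞) (i : Fin N) :
    ∀ᵐ z ∂(lam i).prod (lam (i + 1)),
      transitionDensity lam (chainMeasure N lam (α 0) K (β N)) i z.1 z.2
        = K i z.1 z.2 * β (i + 1) z.2 / β i z.1 := by
  have hβ1 := hβm (i + 1) (by omega)
  have hβi := hβm i (by omega)
  have hαi := hαm i (by omega)
  have h2 : twoMarginalDensity lam (chainMeasure N lam (α 0) K (β N)) i
      =ᵐ[(lam i).prod (lam (i + 1))] fun z => α i z.1 * K i z.1 z.2 * β (i + 1) z.2 := by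
    rw [twoMarginalDensity, twoMarginal_chainMeasure hK hαm hα hβm hβ i]
    exact Measure.rnDeriv_withDensity _
      ((Measurable.mul (hαi.comp measurable_fst) (hK i i.2)).mul (hβ1.comp measurable_snd))
  have h1 : marginalDensity lam (chainMeasure N lam (α 0) K (β N)) i
      =ᵐ[lam i] fun x => α i x * β i x := by
    rw [marginalDensity, marginal_chainMeasure hK hαm hα hβm hβ i.castSucc]
    exact Measure.rnDeriv_withDensity _ (hαi.mul hβi)
  have h1' := (Measure.quasiMeasurePreserving_fst (μ := lam i) (ν := lam (i + 1))).ae h1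
  filter_upwards [h2, h1'] with z hz2 hz1
  rw [transitionDensity, hz1, show ((z.1, z.2) : ℝ × ℝ) = z from rfl, hz2, mul_assoc]
  exact ENNReal.mul_div_mul_left _ _ (hα0 i i.2 _) (hαt i i.2 _)

lemma transition_eq_withDensity_transitionDensity [∀ i, SigmaFinite (lam i)]
    (hK : ∀ i < N, Measurable (Function.uncurry (K i)))
    (hαm : ∀ i ≤ N, Measurable (α i)) (hα : IsForward N lam K α)
    (hβm : ∀ i ≤ N, Measurable (β i)) (hβ : IsBackward N lam K β)
    (hα0 : ∀ i < N, ∀ x, α i x ≠ 0) (hαt : ∀ i < N, ∀ x, α i x ≠ ∞)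
    (hβ0 : ∀ i < N, ∀ x, β i x ≠ 0) (hβt : ∀ i < N, ∀ x, β i x ≠ ∞)
    (hP : (P : Measure (Path N)) = chainMeasure N lam (α 0) K (β N)) (i : Fin N) :
    ∀ᵐ x ∂marginal (P : Measure (Path N)) i.castSucc,
      transition P i x = (lam (i + 1)).withDensity (transitionDensity lam P i x) := by
  have h1 := transitionDensity_chainMeasure hK hαm hα hβm hβ hα0 hαt i
  rw [← hP] at h1
  have hac : marginal (P : Measure (Path N)) i.castSucc ≪ lam i := by
    rw [hP, marginal_chainMeasure hK hαm hα hβm hβ i.castSucc]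
    exact withDensity_absolutelyContinuous _ _
  filter_upwards [transition_chainMeasure (hαm 0 (zero_le)) hK hβm hβ hβ0 hβt hP i,
    hac.ae_le (Measure.ae_ae_of_ae_prod h1)] with x hx1 hx2
  rw [hx1]
  exact (withDensity_congr_ae hx2).symm

/-- The factors `β (i + 1) / β i` telescope to `β N / β 0`. No density of the initial law appears in
the product because `hone` says that this law is `lam 0` itself; it also turns `1 / β 0` into the
initial weight `α 0`. -/
lemma eq_withDensity_prod_transitionDensity [∀ i, SigmaFinite (lam i)]
    (hK : ∀ i < N, Measurable (Function.uncurry (K i)))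
    (hαm : ∀ i ≤ N, Measurable (α i)) (hα : IsForward N lam K α)
    (hβm : ∀ i ≤ N, Measurable (β i)) (hβ : IsBackward N lam K β)
    (hα0 : ∀ i < N, ∀ x, α i x ≠ 0) (hαt : ∀ i < N, ∀ x, α i x ≠ ∞)
    (hβ0 : ∀ i ≤ N, ∀ x, β i x ≠ 0) (hβt : ∀ i ≤ N, ∀ x, β i x ≠ ∞)
    (hK0 : ∀ i < N, ∀ x y, K i x y ≠ 0) (hN : 0 < N)
    (hone : ∀ᵐ x ∂lam 0, α 0 x * β 0 x = 1) :
    chainMeasure N lam (α 0) K (β N)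
      = (Measure.pi fun i : Fin (N + 1) => lam i).withDensity fun ω =>
          ∏ i : Fin N, transitionDensity lam (chainMeasure N lam (α 0) K (β N)) i
            (ω i.castSucc) (ω i.succ) := by
  have hwm := measurable_chainWeight (hαm 0 (zero_le)) (hβm N le_rfl) hK
  have hw0 : ∀ ω : Path N, chainWeight N (α 0) K (β N) ω ≠ 0 := fun ω =>
    mul_ne_zero (mul_ne_zero (hα0 0 hN _)
      (Finset.prod_ne_zero_iff.2 fun j _ => hK0 j j.2 _ _)) (hβ0 N le_rfl _)
  have h1 : ∀ᵐ ω ∂(Measure.pi fun i : Fin (N + 1) => lam i), ∀ i : Fin N,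
      transitionDensity lam (chainMeasure N lam (α 0) K (β N)) i (ω i.castSucc) (ω i.succ)
        = K i (ω i.castSucc) (ω i.succ) * β (i + 1) (ω i.succ) / β i (ω i.castSucc) := by
    rw [ae_all_iff]
    intro i
    have hac : twoMarginal (chainMeasure N lam (α 0) K (β N)) i ≪ (lam i).prod (lam (i + 1)) := by
      rw [twoMarginal_chainMeasure hK hαm hα hβm hβ i]
      exact withDensity_absolutelyContinuous _ _
    have h2 := hac.ae_le (transitionDensity_chainMeasure hK hαm hα hβm hβ hα0 hαt i)
    have hpm : Measurable fun ω : Path N => (ω i.castSucc, ω i.succ) :=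
      (measurable_pi_apply i.castSucc).prodMk (measurable_pi_apply i.succ)
    have h3 := ae_of_ae_map hpm.aemeasurable h2
    -- The exceptional set is null for the chain measure; as the path density vanishes nowhere, it
    -- is also null for the product measure.
    have h4 := (ae_withDensity_iff (μ := Measure.pi fun i : Fin (N + 1) => lam i) hwm).1 h3
    filter_upwards [h4] with ω hω
    exact hω (hw0 ω)
  have h5 := (Measure.tendsto_eval_ae_ae (μ := fun i : Fin (N + 1) => lam i) (i := 0)).eventually
    hone
  rw [chainMeasure]
  refine withDensity_congr_ae ?_
  filter_upwards [h1, h5] with ω hω h0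
  rw [← chainMeasure]
  simp only [hω]
  -- `Fin.ofNat` reduces modulo `N + 1`; for `n ≤ N` this is harmless, and it keeps bound proofs out
  -- of the induction statement.
  have key : ∀ n ≤ N, (∏ j ∈ Finset.univ.filter (fun j : Fin N => (j : ℕ) < n),
      K j (ω j.castSucc) (ω j.succ) * β (j + 1) (ω j.succ) / β j (ω j.castSucc))
      = (∏ j ∈ Finset.univ.filter (fun j : Fin N => (j : ℕ) < n), K j (ω j.castSucc) (ω j.succ))
        * β n (ω (Fin.ofNat (N + 1) n)) / β 0 (ω 0) := by
    intro n
    induction n with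
    | zero =>
      intro _
      simp [ENNReal.div_self (hβ0 0 (zero_le) _) (hβt 0 (zero_le) _)]
    | succ n ih =>
      intro hn
      have hset : (Finset.univ.filter fun j : Fin N => (j : ℕ) < n + 1)
          = insert ⟨n, hn⟩ (Finset.univ.filter fun j : Fin N => (j : ℕ) < n) := by
        ext j; simp [Fin.ext_iff]; omega
      have e1 : (Fin.ofNat (N + 1) n) = (⟨n, hn⟩ : Fin N).castSucc :=
        Fin.ext (Nat.mod_eq_of_lt (by omega))
      have e2 : (Fin.ofNat (N + 1) (n + 1)) = (⟨n, hn⟩ : Fin N).succ :=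
        Fin.ext (Nat.mod_eq_of_lt (by omega))
      rw [hset, Finset.prod_insert (by simp), Finset.prod_insert (by simp), ih (by omega), e1, e2]
      have hc := ENNReal.mul_inv_cancel (hβ0 n (by omega) (ω (⟨n, hn⟩ : Fin N).castSucc))
        (hβt n (by omega) _)
      simp only [div_eq_mul_inv]
      rw [show ∀ a b c d e f : ℝ≥0∞, a * b * c * (d * e * f) = a * d * b * f * (e * c) from
        fun a b c d e f => by ring, hc, mul_one]
  have hfull := key N le_rfl
  have hset : (Finset.univ.filter fun j : Fin N => (j : ℕ) < N) = Finset.univ := by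
    ext j; simp
  have hlast : Fin.ofNat (N + 1) N = Fin.last N := Fin.ext (Nat.mod_eq_of_lt (by omega))
  rw [hset, hlast] at hfull
  rw [hfull, chainWeight]
  have h0' : α 0 (ω 0) = (β 0 (ω 0))⁻¹ := ENNReal.eq_inv_of_mul_eq_one_left h0
  rw [h0', div_eq_mul_inv]
  ring

end ChainTransition

end EntropicSMOT

end

noncomputable section

namespace EntropicSMOT

/-! ### The Legendre–Fenchel transform of a superlinear convex function -/

section Conjugate

variable {F : ℝ → ℝ}

lemma continuous_of_convexOn_univ (hF : ConvexOn ℝ univ F) : Continuous F :=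
  continuousOn_univ.1 (hF.continuousOn isOpen_univ)

lemma bddAbove_conj (hF : ConvexOn ℝ univ F)
    (hFc : Tendsto (fun b => F b / |b|) (cocompact ℝ) atTop) (l : ℝ) :
    BddAbove (range fun b : ℝ => l * b - F b) := by
  obtain ⟨t, ht, hsub⟩ := mem_cocompact.1 (hFc.eventually_ge_atTop |l|)
  have hc : Continuous fun b : ℝ => l * b - F b :=
    (continuous_const.mul continuous_id).sub (continuous_of_convexOn_univ hF)
  obtain ⟨C, hC⟩ := ht.bddAbove_image hc.continuousOn
  -- `C` bounds the values on the compact set, `0` those outside it by superlinearity. The point `b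
  -- = 0` may lie outside, where the quotient `F b / |b|` has the default value `0` and says
  -- nothing; hence the extra `-F 0`.
  refine ⟨max (max C 0) (-F 0), ?_⟩
  rintro _ ⟨b, rfl⟩
  by_cases hb : b ∈ t
  · exact ((hC (mem_image_of_mem _ hb)).trans (le_max_left _ _)).trans (le_max_left _ _)
  rcases eq_or_ne b 0 with rfl | hb0
  · simp
  · have h1 : |l| ≤ F b / |b| := hsub hb
    rw [le_div_iff₀ (abs_pos.2 hb0), ← abs_mul] at h1
    have h2 := le_abs_self (l * b)
    exact le_trans (by simp only; linarith) ((le_max_right C 0).trans (le_max_left _ _))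

lemma mul_sub_le_conj (hF : ConvexOn ℝ univ F)
    (hFc : Tendsto (fun b => F b / |b|) (cocompact ℝ) atTop) (l b : ℝ) : l * b - F b ≤ conj F l :=
  le_ciSup (bddAbove_conj hF hFc l) b

lemma convexOn_conj (hF : ConvexOn ℝ univ F)
    (hFc : Tendsto (fun b => F b / |b|) (cocompact ℝ) atTop) : ConvexOn ℝ univ (conj F) := by
  refine ⟨convex_univ, fun x _ y _ a b ha hb hab => ciSup_le fun z => ?_⟩
  have h1 := mul_le_mul_of_nonneg_left (mul_sub_le_conj hF hFc x z) ha
  have h2 := mul_le_mul_of_nonneg_left (mul_sub_le_conj hF hFc y z) hb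
  simp only [smul_eq_mul]
  have : (a * x + b * y) * z - F z = a * (x * z - F z) + b * (y * z - F z) := by
    linear_combination F z * hab
  linarith

lemma continuous_conj (hF : ConvexOn ℝ univ F)
    (hFc : Tendsto (fun b => F b / |b|) (cocompact ℝ) atTop) : Continuous (conj F) := continuous_of_convexOn_univ (convexOn_conj hF hFc)

/-- Superlinear growth of `F*`, obtained by testing the supremum at the two points `R` and `-R`. -/
lemma mul_abs_le_conj_add (hF : ConvexOn ℝ univ F)
    (hFc : Tendsto (fun b => F b / |b|) (cocompact ℝ) atTop) (R l : ℝ) : R * |l| ≤ conj F l + max (F R) (F (-R)) := by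
  have h1 := mul_sub_le_conj hF hFc l R
  have h2 := mul_sub_le_conj hF hFc l (-R)
  have h3 := le_max_left (F R) (F (-R))
  have h4 := le_max_right (F R) (F (-R))
  rcases abs_cases l with ⟨h, _⟩ | ⟨h, _⟩ <;> rw [h] <;> linarith

/-- If `b` is a subgradient of `F*` at `l` then Fenchel's inequality is an equality. -/
lemma add_conj_eq_of_subgradient (hF : ConvexOn ℝ univ F)
    (hFc : Tendsto (fun b => F b / |b|) (cocompact ℝ) atTop) {l b : ℝ}
    (hb : ∀ l', (l' - l) * b ≤ conj F l' - conj F l) : F b + conj F l = l * b := by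
  refine le_antisymm ?_ (by linarith [mul_sub_le_conj hF hFc l b])
  refine le_of_forall_pos_le_add fun ε hε => ?_
  -- This is `F** = F` at `b`: an affine minorant of slope `l'` almost touches `F` there. It bounds
  -- `F* l'` from above, and the subgradient inequality at `l'` gives the claim up to `ε`.
  obtain ⟨l', c, hle, hlt⟩ := ConvexOn.exists_affine_le_of_lt_real (x := b) (a := F b - ε)
    (mem_univ b) (by linarith) isClosed_univ
    ((continuous_of_convexOn_univ hF).lowerSemicontinuous.lowerSemicontinuousOn _) hF
  have h1 : conj F l' ≤ -c := ciSup_le fun z => by linarith [hle z (mem_univ z)]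
  linarith [hb l']

end Conjugate

/-! ### Integrals of continuous functions against measures carried by compact sets -/

section Compact

variable {T : Type*} [TopologicalSpace T] [T2Space T] [MeasurableSpace T] [OpensMeasurableSpace T]
  {ν : Measure T} [IsFiniteMeasure ν] {Y : Set T}

lemma integrable_of_continuousOn_of_compact (hY : IsCompact Y) (hν : ν Yᶜ = 0) {f : T → ℝ}
    (hf : ContinuousOn f Y) : Integrable f ν := by
  have h := hf.integrableOn_compact (μ := ν) hY
  rwa [IntegrableOn, Measure.restrict_eq_self_of_ae_mem (mem_ae_iff.2 hν)] at h

lemma integrable_of_continuous_of_compact (hY : IsCompact Y) (hν : ν Yᶜ = 0) {f : T → ℝ}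
    (hf : Continuous f) : Integrable f ν :=
  integrable_of_continuousOn_of_compact hY hν hf.continuousOn

lemma continuous_integral_of_compact {ν : Measure ℝ} [IsFiniteMeasure ν] {Y : Set ℝ}
    {T : Type*} [TopologicalSpace T] [FirstCountableTopology T]
    [LocallyCompactSpace T] (hY : IsCompact Y) (hν : ν Yᶜ = 0) {f : T → ℝ → ℝ}
    (hf : Continuous (Function.uncurry f)) : Continuous fun x => ∫ y, f x y ∂ν := by
  have h := continuous_parametric_integral_of_continuous (μ := ν) hf hY
  rwa [Measure.restrict_eq_self_of_ae_mem (mem_ae_iff.2 hν)] at h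

lemma integral_pos_of_continuous (hY : IsCompact Y) (hν : ν Yᶜ = 0) (h0 : ν ≠ 0) {f : T → ℝ}
    (hf : Continuous f) (hpos : ∀ y, 0 < f y) : 0 < ∫ y, f y ∂ν := by
  rw [integral_pos_iff_support_of_nonneg (fun y => (hpos y).le)
    (integrable_of_continuous_of_compact hY hν hf)]
  have : Function.support f = univ := by
    ext y; simpa using (hpos y).ne'
  rw [this]
  exact Measure.measure_univ_pos.2 h0

end Compact

/-! ### The one-step minimisation over the slope -/

section TiltedMass

variable {F : ℝ → ℝ} {h : ℝ} {ν : Measure ℝ} {q : ℝ → ℝ → ℝ} {Y : Set ℝ}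

/-- The integrand of the one-step problem: the weight of a displacement under the dual slope `l`. -/
def tilt (F : ℝ → ℝ) (h x l y : ℝ) : ℝ := Real.exp (conj F l - l * ((y - x) / h))

/-- The one-step dual functional of the slope `l` at the position `x`. -/
def tiltedMass (F : ℝ → ℝ) (h : ℝ) (ν : Measure ℝ) (q : ℝ → ℝ → ℝ) (x l : ℝ) : ℝ :=
  ∫ y, tilt F h x l y * q x y ∂ν

lemma tilt_pos (F : ℝ → ℝ) (h x l y : ℝ) : 0 < tilt F h x l y := Real.exp_pos _

lemma continuous_tilt (hF : ConvexOn ℝ univ F)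
    (hFc : Tendsto (fun b => F b / |b|) (cocompact ℝ) atTop) {T : Type*} [TopologicalSpace T]
    {x l y : T → ℝ} (hx : Continuous x) (hl : Continuous l) (hy : Continuous y) :
    Continuous fun t => tilt F h (x t) (l t) (y t) :=
  Real.continuous_exp.comp
    (((continuous_conj hF hFc).comp hl).sub (hl.mul ((hy.sub hx).div_const h)))

lemma continuous_tilt_mul (hF : ConvexOn ℝ univ F)
    (hFc : Tendsto (fun b => F b / |b|) (cocompact ℝ) atTop)
    (hq : Continuous (Function.uncurry q)) (x l : ℝ) :
    Continuous fun y => tilt F h x l y * q x y :=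
  (continuous_tilt hF hFc continuous_const continuous_const continuous_id).mul
    (hq.comp (continuous_const.prodMk continuous_id))

lemma continuous_tiltedMass [IsFiniteMeasure ν] (hF : ConvexOn ℝ univ F)
    (hFc : Tendsto (fun b => F b / |b|) (cocompact ℝ) atTop)
    (hY : IsCompact Y) (hν : ν Yᶜ = 0) (hq : Continuous (Function.uncurry q)) :
    Continuous (Function.uncurry (tiltedMass F h ν q)) := by
  refine continuous_integral_of_compact hY hν (T := ℝ × ℝ)
    (f := fun p y => tilt F h p.1 p.2 y * q p.1 y) ?_
  have h1 : Continuous fun z : (ℝ × ℝ) × ℝ => z.1.1 := continuous_fst.comp continuous_fst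
  have h2 : Continuous fun z : (ℝ × ℝ) × ℝ => z.1.2 := continuous_snd.comp continuous_fst
  exact (continuous_tilt hF hFc h1 h2 continuous_snd).mul (hq.comp (h1.prodMk continuous_snd))

/-- On the slice the exponent is at least `F* l - B |l|`, and `F* l` grows faster than `(B + 1) |l|`
up to a constant. The mass of `q x` occurs on both sides and cancels, so the bound does not involve
`q`; later this makes it uniform in the terminal condition. -/
lemma abs_le_of_tiltedMass_le [IsFiniteMeasure ν] (hF : ConvexOn ℝ univ F)
    (hFc : Tendsto (fun b => F b / |b|) (cocompact ℝ) atTop)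
    (hY : IsCompact Y) (hν : ν Yᶜ = 0) (hν0 : ν ≠ 0) (hq : Continuous (Function.uncurry q))
    (hqpos : ∀ x y, 0 < q x y) {x l B : ℝ} (hB : ∀ y ∈ Y, |(y - x) / h| ≤ B)
    (hl : tiltedMass F h ν q x l ≤ tiltedMass F h ν q x 0) :
    |l| ≤ conj F 0 + max (F (B + 1)) (F (-(B + 1))) := by
  have hqx : Continuous (q x) := hq.comp (continuous_const.prodMk continuous_id)
  have hM : 0 < ∫ y, q x y ∂ν := integral_pos_of_continuous hY hν hν0 hqx (hqpos x)
  have h0 : tiltedMass F h ν q x 0 = Real.exp (conj F 0) * ∫ y, q x y ∂ν := by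
    simp [tiltedMass, tilt, integral_const_mul]
  have h1 : Real.exp (conj F l - B * |l|) * ∫ y, q x y ∂ν ≤ tiltedMass F h ν q x l := by
    rw [← integral_const_mul]
    refine integral_mono_ae (integrable_of_continuous_of_compact hY hν (continuous_const.mul hqx))
      (integrable_of_continuous_of_compact hY hν (continuous_tilt_mul hF hFc hq x l)) ?_
    have hae : ∀ᵐ y ∂ν, y ∈ Y := mem_ae_iff.2 hν
    filter_upwards [hae] with y hy
    refine mul_le_mul_of_nonneg_right (Real.exp_le_exp.2 ?_) (hqpos x y).le
    have h2 := le_abs_self (l * ((y - x) / h))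
    rw [abs_mul] at h2
    have h3 := mul_le_mul_of_nonneg_left (hB y hy) (abs_nonneg l)
    linarith
  have h2 := h1.trans (hl.trans h0.le)
  have h3 := Real.exp_le_exp.1 (le_of_mul_le_mul_right h2 hM)
  have h4 := mul_abs_le_conj_add hF hFc (B + 1) l
  linarith

/-- Convexity of `F*` bounds the midpoint weight by the geometric mean of the two weights, which is
at most the arithmetic mean. Equality of the means forces the two exponents to agree, and for
distinct slopes this holds at a single `y`, to which `ν` is not confined. -/
lemma tiltedMass_midpoint_lt [IsFiniteMeasure ν] (hF : ConvexOn ℝ univ F)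
    (hFc : Tendsto (fun b => F b / |b|) (cocompact ℝ) atTop) (hh : 0 < h)
    (hY : IsCompact Y) (hν : ν Yᶜ = 0) (hnd : ∀ y : ℝ, ν {y}ᶜ ≠ 0)
    (hq : Continuous (Function.uncurry q)) (hqpos : ∀ x y, 0 < q x y) {x l l' : ℝ}
    (hll : l ≠ l') :
    tiltedMass F h ν q x ((l + l') / 2)
      < (tiltedMass F h ν q x l + tiltedMass F h ν q x l') / 2 := by
  have hi := fun l => integrable_of_continuous_of_compact hY hν
    (continuous_tilt_mul (h := h) hF hFc hq x l)
  have hmid : conj F ((l + l') / 2) ≤ (conj F l + conj F l') / 2 := by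
    have h2 : (0 : ℝ) ≤ 1 / 2 := by norm_num
    have := (convexOn_conj hF hFc).2 (mem_univ l) (mem_univ l') h2 h2 (by norm_num)
    simp only [smul_eq_mul] at this
    rw [show (l + l') / 2 = 1 / 2 * l + 1 / 2 * l' by ring]
    linarith
  have hpt : ∀ y, tilt F h x ((l + l') / 2) y ≤
      Real.exp ((conj F l - l * ((y - x) / h)) / 2) *
        Real.exp ((conj F l' - l' * ((y - x) / h)) / 2) := by
    intro y
    rw [tilt, ← Real.exp_add]
    refine Real.exp_le_exp.2 ?_
    linarith
  have hsq : ∀ l y, tilt F h x l y = Real.exp ((conj F l - l * ((y - x) / h)) / 2) ^ 2 := by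
    intro l y
    rw [tilt, ← Real.exp_nat_mul]
    congr 1
    push_cast
    ring
  have hle : ∀ y, tilt F h x ((l + l') / 2) y ≤ (tilt F h x l y + tilt F h x l' y) / 2 := by
    intro y
    rw [hsq l, hsq l']
    refine (hpt y).trans ?_
    nlinarith [sq_nonneg (Real.exp ((conj F l - l * ((y - x) / h)) / 2)
      - Real.exp ((conj F l' - l' * ((y - x) / h)) / 2))]
  have hd : 0 < ∫ y, ((tilt F h x l y * q x y + tilt F h x l' y * q x y) / 2
      - tilt F h x ((l + l') / 2) y * q x y) ∂ν := by
    rw [integral_pos_iff_support_of_nonneg]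
    · refine lt_of_lt_of_le (pos_iff_ne_zero.2
        (hnd (x + h * ((conj F l - conj F l') / (l - l'))))) (measure_mono fun y hy => ?_)
      rw [Function.mem_support]
      have hne : Real.exp ((conj F l - l * ((y - x) / h)) / 2)
          ≠ Real.exp ((conj F l' - l' * ((y - x) / h)) / 2) := by
        intro he
        have h1 := Real.exp_injective he
        refine hy ?_
        rw [mem_singleton_iff]
        have h2 : l - l' ≠ 0 := sub_ne_zero.2 hll
        have h3 : (y - x) / h = (conj F l - conj F l') / (l - l') := by
          rw [eq_div_iff h2]; linarith
        rw [← h3]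
        field_simp
        ring
      have h1 : 0 < (Real.exp ((conj F l - l * ((y - x) / h)) / 2)
          - Real.exp ((conj F l' - l' * ((y - x) / h)) / 2)) ^ 2 :=
        by have := sub_ne_zero.2 hne; positivity
      have h2 : tilt F h x ((l + l') / 2) y < (tilt F h x l y + tilt F h x l' y) / 2 := by
        rw [hsq l, hsq l']
        refine (hpt y).trans_lt ?_
        nlinarith
      have h3 := mul_lt_mul_of_pos_right h2 (hqpos x y)
      intro h4
      linarith
    · intro y
      have h3 := mul_le_mul_of_nonneg_right (hle y) (hqpos x y).le
      simp only [Pi.zero_apply]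
      linarith
    · exact (((hi l).add (hi l')).div_const 2).sub (hi _)
  rw [integral_sub (((hi l).fun_add (hi l')).div_const 2) (hi _), integral_div,
    integral_add (hi l) (hi l')] at hd
  simp only [tiltedMass]
  linarith

/-- The optimal slope exists and depends continuously on the position. -/
lemma exists_continuous_minimizer [IsFiniteMeasure ν] (hF : ConvexOn ℝ univ F)
    (hFc : Tendsto (fun b => F b / |b|) (cocompact ℝ) atTop) (hh : 0 < h)
    (hY : IsCompact Y) (hν : ν Yᶜ = 0) (hnd : ∀ y : ℝ, ν {y}ᶜ ≠ 0)
    (hq : Continuous (Function.uncurry q)) (hqpos : ∀ x y, 0 < q x y) :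
    ∃ l : ℝ → ℝ, Continuous l ∧ ∀ x l', tiltedMass F h ν q x (l x) ≤ tiltedMass F h ν q x l' := by
  have hν0 : ν ≠ 0 := fun h0 => hnd 0 (by simp [h0])
  have hE := continuous_tiltedMass (h := h) hF hFc hY hν hq
  obtain ⟨C, hC⟩ := hY.isBounded.exists_norm_le
  -- The displacement bound is uniform for `x` near `x₀`, so the minimisers near `x₀` stay in one
  -- compact interval.
  have hB : ∀ x₀ x : ℝ, |x - x₀| ≤ 1 → ∀ y ∈ Y, |(y - x) / h| ≤ (C + |x₀| + 1) / h := by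
    intro x₀ x hx y hy
    rw [abs_div, abs_of_pos hh]
    gcongr
    have h1 : |y| ≤ C := hC y hy
    have h2 : y - x = y - x₀ - (x - x₀) := by ring
    rw [h2]
    exact (abs_sub _ _).trans (add_le_add ((abs_sub _ _).trans (add_le_add h1 le_rfl)) hx)
  have hmin : ∀ x, ∃ l, ∀ l', tiltedMass F h ν q x l ≤ tiltedMass F h ν q x l' := by
    intro x
    set L := conj F 0 + max (F ((C + |x| + 1) / h + 1)) (F (-((C + |x| + 1) / h + 1))) with hL
    have hbd : ∀ l, tiltedMass F h ν q x l ≤ tiltedMass F h ν q x 0 → |l| ≤ L := fun l hl =>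
      abs_le_of_tiltedMass_le hF hFc hY hν hν0 hq hqpos (hB x x (by simp)) hl
    have hL0 : 0 ≤ L := (abs_nonneg _).trans (hbd 0 le_rfl)
    obtain ⟨l, -, hl⟩ := (isCompact_Icc (a := -L) (b := L)).exists_isMinOn
      ⟨0, by simp [hL0]⟩ (f := tiltedMass F h ν q x)
      (hE.comp (continuous_const.prodMk continuous_id)).continuousOn
    refine ⟨l, fun l' => ?_⟩
    by_cases h1 : tiltedMass F h ν q x l' ≤ tiltedMass F h ν q x 0
    · exact hl (abs_le.1 (hbd l' h1))
    · exact (hl (show (0 : ℝ) ∈ Icc (-L) L by simp [hL0])).trans (not_le.1 h1).le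
  choose l hl using hmin
  refine ⟨l, continuous_iff_continuousAt.2 fun x₀ => ?_, hl⟩
  set L := conj F 0 + max (F ((C + |x₀| + 1) / h + 1)) (F (-((C + |x₀| + 1) / h + 1))) with hL
  -- Every cluster point of the minimisers minimises at `x₀` by joint continuity; two distinct
  -- minimisers would be beaten by their midpoint.
  refine (isCompact_Icc (a := -L) (b := L)).tendsto_nhds_of_unique_mapClusterPt ?_ ?_
  · filter_upwards [Metric.closedBall_mem_nhds x₀ one_pos] with x hx
    exact abs_le.1 (abs_le_of_tiltedMass_le hF hFc hY hν hν0 hq hqpos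
      (hB x₀ x (by simpa [Real.dist_eq] using hx)) (hl x 0))
  · intro l₀ _ hcl
    obtain ⟨U, hU, hUl⟩ := mapClusterPt_iff_ultrafilter.1 hcl
    have hUx : Tendsto (fun x : ℝ => x) U (nhds x₀) := hU
    have hle : ∀ l', tiltedMass F h ν q x₀ l₀ ≤ tiltedMass F h ν q x₀ l' := fun l' =>
      le_of_tendsto_of_tendsto'
        ((hE.tendsto (x₀, l₀)).comp (hUx.prodMk_nhds hUl))
        ((hE.tendsto (x₀, l')).comp (hUx.prodMk_nhds tendsto_const_nhds)) (fun x => hl x l')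
    by_contra hne
    have h1 := tiltedMass_midpoint_lt (x := x₀) hF hFc hh hY hν hnd hq hqpos hne
    have h2 := hle ((l₀ + l x₀) / 2)
    have h3 := hl x₀ ((l₀ + l x₀) / 2)
    linarith

/-- At the optimal slope `l`, the drift of the tilted transition law is a subgradient of `F*`. -/
lemma subgradient_of_minimizer [IsFiniteMeasure ν] (hF : ConvexOn ℝ univ F)
    (hFc : Tendsto (fun b => F b / |b|) (cocompact ℝ) atTop)
    (hY : IsCompact Y) (hν : ν Yᶜ = 0) (hν0 : ν ≠ 0)
    (hq : Continuous (Function.uncurry q)) (hqpos : ∀ x y, 0 < q x y) {x l : ℝ}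
    (hl : ∀ l', tiltedMass F h ν q x l ≤ tiltedMass F h ν q x l') (l' : ℝ) :
    (l' - l) * ((∫ y, (y - x) / h * (tilt F h x l y * q x y) ∂ν) / tiltedMass F h ν q x l)
      ≤ conj F l' - conj F l := by
  set s : ℝ → ℝ := fun y => conj F l' - conj F l - (l' - l) * ((y - x) / h) with hs
  have hsc : Continuous s :=
    continuous_const.sub (continuous_const.mul ((continuous_id.sub continuous_const).div_const h))
  have hw := continuous_tilt_mul (h := h) hF hFc hq x l
  have hwpos : ∀ y, 0 < tilt F h x l y * q x y := fun y => mul_pos (tilt_pos _ _ _ _ _) (hqpos x y)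
  have hint := fun {f : ℝ → ℝ} (hf : Continuous f) =>
    integrable_of_continuous_of_compact (ν := ν) hY hν hf
  have hZ : 0 < tiltedMass F h ν q x l := integral_pos_of_continuous hY hν hν0 hw hwpos
  obtain ⟨M, hM⟩ := hY.exists_bound_of_continuousOn hsc.continuousOn
  set A := ∫ y, s y * (tilt F h x l y * q x y) ∂ν with hA
  set V := ∫ y, s y ^ 2 * (tilt F h x l y * q x y) ∂ν with hV
  -- One-sided variation from `l` towards `l'`. Convexity bounds the increment of the exponent by `t
  -- * s y`, so differentiability of `F*` is not needed, and `exp u ≤ 1 + u + u ^ 2` for `|u| ≤ 1`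
  -- expands the weight. Dividing by `t` and letting `t → 0` leaves `A ≥ 0`.
  have hkey : ∀ t : ℝ, 0 < t → t ≤ 1 → t * (|M| + 1) ≤ 1 → 0 ≤ A + t * V := by
    intro t ht ht1 htM
    have hcv : conj F (l + t * (l' - l)) ≤ conj F l + t * (conj F l' - conj F l) := by
      have := (convexOn_conj hF hFc).2 (mem_univ l) (mem_univ l')
        (sub_nonneg.2 ht1) ht.le (sub_add_cancel 1 t)
      simp only [smul_eq_mul] at this
      rw [show l + t * (l' - l) = (1 - t) * l + t * l' by ring]
      linarith
    have h1 : tiltedMass F h ν q x (l + t * (l' - l))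
        ≤ ∫ y, (1 + t * s y + t ^ 2 * s y ^ 2) * (tilt F h x l y * q x y) ∂ν := by
      refine integral_mono_ae (hint (continuous_tilt_mul hF hFc hq x _)) (hint
        (((continuous_const.add (continuous_const.mul hsc)).add
          (continuous_const.mul (hsc.pow 2))).mul hw)) ?_
      have hae : ∀ᵐ y ∂ν, y ∈ Y := mem_ae_iff.2 hν
      filter_upwards [hae] with y hy
      rw [← mul_assoc]
      refine mul_le_mul_of_nonneg_right ?_ (hqpos x y).le
      have h2 : tilt F h x (l + t * (l' - l)) y ≤ Real.exp (t * s y) * tilt F h x l y := by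
        rw [tilt, tilt, ← Real.exp_add]
        refine Real.exp_le_exp.2 ?_
        simp only [hs]
        nlinarith
      refine h2.trans (mul_le_mul_of_nonneg_right ?_ (tilt_pos _ _ _ _ _).le)
      have h3 : |t * s y| ≤ 1 := by
        rw [abs_mul, abs_of_pos ht]
        have h4 : |s y| ≤ |M| + 1 := (hM y hy).trans ((le_abs_self M).trans (by linarith))
        exact (mul_le_mul_of_nonneg_left h4 ht.le).trans htM
      have h4 := (abs_le.1 (Real.abs_exp_sub_one_sub_id_le h3)).2
      nlinarith
    have h2 : ∫ y, (1 + t * s y + t ^ 2 * s y ^ 2) * (tilt F h x l y * q x y) ∂ν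
        = tiltedMass F h ν q x l + t * A + t ^ 2 * V := by
      have e : ∀ y, (1 + t * s y + t ^ 2 * s y ^ 2) * (tilt F h x l y * q x y)
          = tilt F h x l y * q x y + t * (s y * (tilt F h x l y * q x y))
            + t ^ 2 * (s y ^ 2 * (tilt F h x l y * q x y)) := fun y => by ring
      simp only [e]
      rw [integral_add, integral_add, integral_const_mul, integral_const_mul]
      · rfl
      · exact hint hw
      · exact hint (continuous_const.mul (hsc.mul hw))
      · exact hint (hw.add (continuous_const.mul (hsc.mul hw)))
      · exact hint (continuous_const.mul ((hsc.pow 2).mul hw))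
    have h3 := hl (l + t * (l' - l))
    have h4 : 0 ≤ t * (A + t * V) := by nlinarith
    exact nonneg_of_mul_nonneg_right h4 ht
  have hA0 : 0 ≤ A := by
    have ht : Tendsto (fun t : ℝ => A + t * V) (nhdsWithin 0 (Ioi 0)) (nhds (A + 0 * V)) :=
      ((continuous_const.add (continuous_id.mul continuous_const)).tendsto 0).mono_left
        nhdsWithin_le_nhds
    rw [zero_mul, add_zero] at ht
    refine ge_of_tendsto ht ?_
    have hpos : 0 < 1 / (|M| + 1) := by positivity
    filter_upwards [Ioc_mem_nhdsGT (lt_min one_pos hpos)] with t htt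
    refine hkey t htt.1 (htt.2.trans (min_le_left _ _)) ?_
    rw [← le_div_iff₀ (by positivity)]
    exact htt.2.trans (min_le_right _ _)
  have hA2 : A = (conj F l' - conj F l) * tiltedMass F h ν q x l
      - (l' - l) * ∫ y, (y - x) / h * (tilt F h x l y * q x y) ∂ν := by
    have e : ∀ y, s y * (tilt F h x l y * q x y)
        = (conj F l' - conj F l) * (tilt F h x l y * q x y)
          - (l' - l) * ((y - x) / h * (tilt F h x l y * q x y)) := fun y => by
      simp only [hs]; ring
    rw [hA]
    simp only [e]
    rw [integral_sub, integral_const_mul, integral_const_mul]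
    · rfl
    · exact hint (continuous_const.mul hw)
    · exact hint (continuous_const.mul (((continuous_id.sub continuous_const).div_const h).mul hw))
  rw [← mul_div_assoc, div_le_iff₀ hZ]
  linarith

end TiltedMass

end EntropicSMOT

end

/-! ### The dynamic programming recursion and the reduced dual functional -/

noncomputable section

namespace EntropicSMOT

/-- A relation that can be solved backwards has a solution sequence with a given last term. -/
lemma exists_downward_seq {A : Type*} (N : ℕ) (c : A) (r : ℕ → A → A → Prop)
    (hr : ∀ i < N, ∀ a, ∃ b, r i b a) :
    ∃ D : ℕ → A, D N = c ∧ ∀ i < N, r i (D i) (D (i + 1)) := by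
  induction N generalizing c with
  | zero => exact ⟨fun _ => c, rfl, fun i hi => absurd hi (Nat.not_lt_zero i)⟩
  | succ N ih =>
    obtain ⟨b, hb⟩ := hr N (Nat.lt_succ_self N) c
    obtain ⟨D, hD, hD'⟩ := ih b fun i hi => hr i (by omega)
    refine ⟨fun i => if i ≤ N then D i else c, by simp, fun i hi => ?_⟩
    rcases Nat.lt_succ_iff_lt_or_eq.1 hi with h | rfl
    · simpa [h.le, Nat.succ_le_of_lt h] using hD' i h
    · simpa [hD] using hb

/-- The standing assumptions on the slices and on the reference chain, with globally defined
continuous positive transition densities. -/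
structure RegularChain (N : ℕ) (h : ℝ) (F : ℝ → ℝ) (X : ℕ → Set ℝ) (lam : ℕ → Measure ℝ)
    (k : ℕ → ℝ → ℝ → ℝ) : Prop where
  hpos : 0 < h
  convex : ConvexOn ℝ univ F
  coercive : Tendsto (fun b => F b / |b|) (cocompact ℝ) atTop
  compact : ∀ i ≤ N, IsCompact (X i)
  supp : ∀ i ≤ N, lam i (X i)ᶜ = 0
  init_ne_zero : lam 0 ≠ 0
  nondeg : ∀ i, 1 ≤ i → i ≤ N → ∀ y, lam i {y}ᶜ ≠ 0
  cont : ∀ i < N, Continuous (Function.uncurry (k i))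
  pos : ∀ i < N, ∀ x y, 0 < k i x y

/-- `D` solves the backward recursion of the dynamic programming principle, and `l` is the
corresponding optimal slope. -/
structure OptBackward (N : ℕ) (h : ℝ) (F : ℝ → ℝ) (lam : ℕ → Measure ℝ)
    (k : ℕ → ℝ → ℝ → ℝ) (D l : ℕ → ℝ → ℝ) : Prop where
  cont : ∀ i ≤ N, Continuous (D i)
  pos : ∀ i ≤ N, ∀ x, 0 < D i x
  cont_slope : ∀ i < N, Continuous (l i)
  eq : ∀ i < N, ∀ x, D i x
    = tiltedMass F h (lam (i + 1)) (fun x y => k i x y * D (i + 1) y) x (l i x)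
  le : ∀ i < N, ∀ x l', D i x
    ≤ tiltedMass F h (lam (i + 1)) (fun x y => k i x y * D (i + 1) y) x l'

/-- The forward density of the chain tilted by the slopes `l`. -/
def forwardDensity (F : ℝ → ℝ) (h : ℝ) (lam : ℕ → Measure ℝ) (k : ℕ → ℝ → ℝ → ℝ)
    (l : ℕ → ℝ → ℝ) (u : ℝ → ℝ) : ℕ → ℝ → ℝ
  | 0 => u
  | i + 1 => fun y =>
      ∫ x, forwardDensity F h lam k l u i x * (tilt F h x (l i x) y * k i x y) ∂lam i

/-- The reduced dual functional, at a solution of the backward recursion. -/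
def reducedDual (N : ℕ) (lam : ℕ → Measure ℝ) (r : ℝ → ℝ) (D : ℕ → ℝ → ℝ) : ℝ :=
  (∫ y, Real.log (D N y) * r y ∂lam N) - ∫ x, Real.log (D 0 x) ∂lam 0

section Regular

variable {N : ℕ} {h : ℝ} {F : ℝ → ℝ} {X : ℕ → Set ℝ} {lam : ℕ → Measure ℝ}
  {k : ℕ → ℝ → ℝ → ℝ} {D D' l l' : ℕ → ℝ → ℝ}

lemma RegularChain.ne_zero (hc : RegularChain N h F X lam k) {i : ℕ} (hi : i ≤ N) : lam i ≠ 0 := by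
  rcases Nat.eq_zero_or_pos i with rfl | h0
  · exact hc.init_ne_zero
  · exact fun h1 => hc.nondeg i h0 hi 0 (by simp [h1])

lemma RegularChain.continuous_kernel_mul (hc : RegularChain N h F X lam k) {i : ℕ} (hi : i < N)
    {f : ℝ → ℝ} (hf : Continuous f) :
    Continuous (Function.uncurry fun x y => k i x y * f y) :=
  (hc.cont i hi).mul (hf.comp continuous_snd)

lemma RegularChain.continuous_tilted_kernel (hc : RegularChain N h F X lam k) {i : ℕ} (hi : i < N)
    {f : ℝ → ℝ} (hf : Continuous f) :
    Continuous (Function.uncurry fun x y => tilt F h x (f x) y * k i x y) :=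
  (continuous_tilt hc.convex hc.coercive continuous_fst (hf.comp continuous_fst)
    continuous_snd).mul (hc.cont i hi)

variable [∀ i, IsFiniteMeasure (lam i)]

/-- Continuity and positivity of the value function are part of the induction: they make `k i x y *
D (i + 1) y` an admissible kernel for the next one-step minimisation. -/
lemma RegularChain.exists_optBackward (hc : RegularChain N h F X lam k) {f : ℝ → ℝ}
    (hf : Continuous f) (hpos : ∀ x, 0 < f x) :
    ∃ D l, OptBackward N h F lam k D l ∧ D N = f := by
  obtain ⟨D, hDN, hD⟩ := exists_downward_seq (A := {f : ℝ → ℝ // Continuous f ∧ ∀ x, 0 < f x}) N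
    ⟨f, hf, hpos⟩ (fun i b a => ∃ l : ℝ → ℝ, Continuous l ∧
      (∀ x, b.1 x = tiltedMass F h (lam (i + 1)) (fun x y => k i x y * a.1 y) x (l x)) ∧
      ∀ x l', b.1 x ≤ tiltedMass F h (lam (i + 1)) (fun x y => k i x y * a.1 y) x l') (by
    rintro i hi ⟨a, hac, hap⟩
    have hq := hc.continuous_kernel_mul hi hac
    have hqp : ∀ x y, 0 < k i x y * a y := fun x y => mul_pos (hc.pos i hi x y) (hap y)
    have hY := hc.compact (i + 1) hi
    have hν := hc.supp (i + 1) hi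
    obtain ⟨l, hl, hmin⟩ := exists_continuous_minimizer hc.convex hc.coercive hc.hpos hY hν
      (hc.nondeg (i + 1) (by omega) hi) hq hqp
    refine ⟨⟨fun x => tiltedMass F h (lam (i + 1)) (fun x y => k i x y * a y) x (l x),
      (continuous_tiltedMass hc.convex hc.coercive hY hν hq).comp (continuous_id.prodMk hl),
      fun x => ?_⟩, l, hl, fun x => rfl, hmin⟩
    exact integral_pos_of_continuous hY hν (hc.ne_zero hi)
      (continuous_tilt_mul hc.convex hc.coercive hq x _)
      fun y => mul_pos (tilt_pos _ _ _ _ _) (hqp x y))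
  choose! l hl hl1 hl2 using hD
  exact ⟨fun i => (D i).1, l, ⟨fun i _ => (D i).2.1, fun i _ => (D i).2.2, hl, hl1, hl2⟩,
    by simp [hDN]⟩

/-- Monotonicity and homogeneity of the backward recursion. -/
lemma OptBackward.le_exp_mul (hc : RegularChain N h F X lam k) (hD : OptBackward N h F lam k D l)
    (hD' : OptBackward N h F lam k D' l') {ε : ℝ}
    (hε : ∀ y ∈ X N, D N y ≤ Real.exp ε * D' N y) :
    ∀ i ≤ N, ∀ x ∈ X i, D i x ≤ Real.exp ε * D' i x := by
  intro i hi
  induction hi using Nat.decreasingInduction with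
  | self => exact hε
  | of_succ i hi' ih =>
    intro x _
    rw [hD'.eq i hi' x]
    -- The slope that is optimal for `D'` is only a competitor for `D`, which gives the inequality
    -- in the required direction.
    refine (hD.le i hi' x (l' i x)).trans ?_
    have hY := hc.compact (i + 1) hi'
    have hν := hc.supp (i + 1) hi'
    rw [tiltedMass, tiltedMass, ← integral_const_mul]
    refine integral_mono_ae
      (integrable_of_continuous_of_compact hY hν (continuous_tilt_mul hc.convex hc.coercive
        (hc.continuous_kernel_mul hi' (hD.cont _ hi')) x _))
      (integrable_of_continuous_of_compact hY hν (continuous_const.mul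
        (continuous_tilt_mul hc.convex hc.coercive
        (hc.continuous_kernel_mul hi' (hD'.cont _ hi')) x _))) ?_
    have hae : ∀ᵐ y ∂lam (i + 1), y ∈ X (i + 1) := mem_ae_iff.2 hν
    filter_upwards [hae] with y hy
    have h1 := mul_le_mul_of_nonneg_left (ih y hy)
      (mul_pos (tilt_pos F h x (l' i x) y) (hc.pos i hi' x y)).le
    linarith

lemma OptBackward.integrable_log (hc : RegularChain N h F X lam k)
    (hD : OptBackward N h F lam k D l) {i : ℕ} (hi : i ≤ N) :
    Integrable (fun x => Real.log (D i x)) (lam i) :=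
  integrable_of_continuous_of_compact (hc.compact i hi) (hc.supp i hi)
    ((hD.cont i hi).log fun x => (hD.pos i hi x).ne')

lemma OptBackward.integrable_log_mul (hc : RegularChain N h F X lam k)
    (hD : OptBackward N h F lam k D l) {r : ℝ → ℝ} (hr : Continuous r) :
    Integrable (fun x => Real.log (D N x) * r x) (lam N) :=
  integrable_of_continuous_of_compact (hc.compact N le_rfl) (hc.supp N le_rfl)
    (((hD.cont N le_rfl).log fun x => (hD.pos N le_rfl x).ne').mul hr)

/-- A terminal shift by at most `ε` changes the reduced dual functional by at most `2 ε`. -/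
lemma OptBackward.reducedDual_le (hc : RegularChain N h F X lam k)
    [IsProbabilityMeasure (lam 0)] {r : ℝ → ℝ} (hr : Continuous r) (hrpos : ∀ y, 0 < r y)
    (hr1 : ∫ y, r y ∂lam N = 1)
    (hD : OptBackward N h F lam k D l) (hD' : OptBackward N h F lam k D' l') {δ ε : ℝ}
    (hδ : ∀ y ∈ X N, Real.log (D N y) ≤ Real.log (D' N y) + δ)
    (hε : ∀ y ∈ X N, Real.log (D' N y) ≤ Real.log (D N y) + ε) :
    reducedDual N lam r D ≤ reducedDual N lam r D' + (δ + ε) := by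
  have hri : Integrable r (lam N) := integrable_of_continuous_of_compact (hc.compact N le_rfl)
    (hc.supp N le_rfl) hr
  have h1 : ∫ y, Real.log (D N y) * r y ∂lam N ≤ (∫ y, Real.log (D' N y) * r y ∂lam N) + δ := by
    have : (∫ y, Real.log (D' N y) * r y ∂lam N) + δ
        = ∫ y, (Real.log (D' N y) * r y + δ * r y) ∂lam N := by
      rw [integral_add (hD'.integrable_log_mul hc hr) (hri.const_mul δ), integral_const_mul, hr1,
        mul_one]
    rw [this]
    refine integral_mono_ae (hD.integrable_log_mul hc hr)
      ((hD'.integrable_log_mul hc hr).add (hri.const_mul δ)) ?_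
    have hae : ∀ᵐ y ∂lam N, y ∈ X N := mem_ae_iff.2 (hc.supp N le_rfl)
    filter_upwards [hae] with y hy
    have := mul_le_mul_of_nonneg_right (hδ y hy) (hrpos y).le
    linarith
  have h2 : ∫ x, Real.log (D' 0 x) ∂lam 0 ≤ (∫ x, Real.log (D 0 x) ∂lam 0) + ε := by
    have : (∫ x, Real.log (D 0 x) ∂lam 0) + ε = ∫ x, (Real.log (D 0 x) + ε) ∂lam 0 := by
      rw [integral_add (hD.integrable_log hc (zero_le)) (integrable_const ε)]
      simp
    rw [this]
    refine integral_mono_ae (hD'.integrable_log hc (zero_le))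
      ((hD.integrable_log hc (zero_le)).add (integrable_const ε)) ?_
    have hae : ∀ᵐ y ∂lam 0, y ∈ X 0 := mem_ae_iff.2 (hc.supp 0 (zero_le))
    filter_upwards [hae] with x hx
    -- Monotonicity is used with the roles exchanged because `log D 0` enters `reducedDual` with a
    -- minus sign.
    have h3 := hD'.le_exp_mul hc hD (ε := ε) (fun y hy => by
      have := Real.exp_le_exp.2 (hε y hy)
      rwa [Real.exp_add, Real.exp_log (hD'.pos N le_rfl y), Real.exp_log (hD.pos N le_rfl y),
        mul_comm] at this) 0 (zero_le) x hx
    have h4 := Real.log_le_log (hD'.pos 0 (zero_le) x) h3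
    rwa [Real.log_mul (Real.exp_pos _).ne' (hD.pos 0 (zero_le) x).ne', Real.log_exp,
      add_comm] at h4
  simp only [reducedDual]
  linarith

lemma RegularChain.continuous_forwardDensity (hc : RegularChain N h F X lam k)
    (hl : ∀ i < N, Continuous (l i)) {u : ℝ → ℝ} (hu : Continuous u) :
    ∀ i ≤ N, Continuous (forwardDensity F h lam k l u i) := by
  intro i
  induction i with
  | zero => exact fun _ => hu
  | succ i ih =>
    intro hi
    refine continuous_integral_of_compact (hc.compact i (by omega)) (hc.supp i (by omega))
      (f := fun y x => forwardDensity F h lam k l u i x * (tilt F h x (l i x) y * k i x y)) ?_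
    exact ((ih (by omega)).comp continuous_snd).mul
      ((hc.continuous_tilted_kernel hi (hl i hi)).comp continuous_swap)

lemma RegularChain.forwardDensity_pos (hc : RegularChain N h F X lam k)
    (hl : ∀ i < N, Continuous (l i)) {u : ℝ → ℝ} (hu : Continuous u) (hupos : ∀ x, 0 < u x) :
    ∀ i ≤ N, ∀ x, 0 < forwardDensity F h lam k l u i x := by
  intro i
  induction i with
  | zero => exact fun _ => hupos
  | succ i ih =>
    intro hi y
    refine integral_pos_of_continuous (hc.compact i (by omega)) (hc.supp i (by omega))
      (hc.ne_zero (by omega)) ((hc.continuous_forwardDensity hl hu i (by omega)).mul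
        ((hc.continuous_tilted_kernel hi (hl i hi)).comp (continuous_id.prodMk continuous_const)))
      fun x => mul_pos (ih (by omega) x) (mul_pos (tilt_pos _ _ _ _ _) (hc.pos i hi x y))

/-- The forward and the backward step are adjoint to each other. -/
lemma RegularChain.integral_forwardDensity_succ_mul (hc : RegularChain N h F X lam k)
    (hl : ∀ i < N, Continuous (l i)) {u : ℝ → ℝ} (hu : Continuous u) {i : ℕ} (hi : i < N)
    {f : ℝ → ℝ} (hf : Continuous f) :
    ∫ y, forwardDensity F h lam k l u (i + 1) y * f y ∂lam (i + 1)
      = ∫ x, forwardDensity F h lam k l u i x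
          * tiltedMass F h (lam (i + 1)) (fun x y => k i x y * f y) x (l i x) ∂lam i := by
  have hU := hc.continuous_forwardDensity hl hu i hi.le
  have hg : Continuous (Function.uncurry fun y x =>
      forwardDensity F h lam k l u i x * (tilt F h x (l i x) y * k i x y) * f y) :=
    ((hU.comp continuous_snd).mul ((hc.continuous_tilted_kernel hi (hl i hi)).comp
      continuous_swap)).mul (hf.comp continuous_fst)
  have hsupp : ((lam (i + 1)).prod (lam i)) (X (i + 1) ×ˢ X i)ᶜ = 0 := by
    rw [← mem_ae_iff]
    have h1 : ∀ᵐ y ∂lam (i + 1), y ∈ X (i + 1) := mem_ae_iff.2 (hc.supp (i + 1) hi)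
    have h2 : ∀ᵐ y ∂lam i, y ∈ X i := mem_ae_iff.2 (hc.supp i hi.le)
    filter_upwards [Measure.quasiMeasurePreserving_fst.ae h1,
      Measure.quasiMeasurePreserving_snd.ae h2] with z hz1 hz2
    exact ⟨hz1, hz2⟩
  have hint := integrable_of_continuous_of_compact (ν := (lam (i + 1)).prod (lam i))
    ((hc.compact (i + 1) hi).prod (hc.compact i hi.le)) hsupp hg
  simp only [forwardDensity, tiltedMass, ← integral_mul_const, ← integral_const_mul]
  rw [integral_integral_swap hint]
  refine integral_congr_ae (Eventually.of_forall fun x => integral_congr_ae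
    (Eventually.of_forall fun y => ?_))
  simp only
  ring

/-- Along its own optimal slopes the backward recursion is linear and adjoint to the forward one, so
this pairing is conserved in time. -/
lemma OptBackward.integral_forwardDensity_mul (hc : RegularChain N h F X lam k)
    (hD : OptBackward N h F lam k D l) {u : ℝ → ℝ} (hu : Continuous u) :
    ∀ i ≤ N, ∫ y, forwardDensity F h lam k l u i y * D i y ∂lam i = ∫ x, u x * D 0 x ∂lam 0 := by
  intro i
  induction i with
  | zero => exact fun _ => rfl
  | succ i ih =>
    intro hi
    rw [hc.integral_forwardDensity_succ_mul hD.cont_slope hu hi (hD.cont _ hi), ← ih (by omega)]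
    simp only [← hD.eq i hi]

/-- For slopes that need not be optimal for `D'`, conservation weakens to growth, since `D' i` is a
minimum over all slopes. -/
lemma OptBackward.integral_mul_le (hc : RegularChain N h F X lam k)
    (hl : ∀ i < N, Continuous (l i)) (hD' : OptBackward N h F lam k D' l') {u : ℝ → ℝ}
    (hu : Continuous u) (hupos : ∀ x, 0 < u x) :
    ∀ i ≤ N, ∫ x, u x * D' 0 x ∂lam 0
      ≤ ∫ y, forwardDensity F h lam k l u i y * D' i y ∂lam i := by
  intro i
  induction i with
  | zero => exact fun _ => le_rfl
  | succ i ih =>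
    intro hi
    refine (ih (by omega)).trans ?_
    rw [hc.integral_forwardDensity_succ_mul hl hu hi (hD'.cont _ hi)]
    have hU := hc.continuous_forwardDensity hl hu i (Nat.le_of_succ_le hi)
    refine integral_mono (integrable_of_continuous_of_compact (hc.compact i (by omega))
      (hc.supp i (by omega)) (hU.mul (hD'.cont i (by omega))))
      (integrable_of_continuous_of_compact (hc.compact i (by omega))
      (hc.supp i (by omega)) (hU.mul ?_)) fun x => ?_
    · exact (continuous_tiltedMass hc.convex hc.coercive (hc.compact _ hi) (hc.supp _ hi)
        (hc.continuous_kernel_mul hi (hD'.cont _ hi))).comp (continuous_id.prodMk (hl i hi))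
    · exact mul_le_mul_of_nonneg_left (hD'.le i hi x (l i x))
        (hc.forwardDensity_pos hl hu hupos i (by omega) x).le

/-- Refitting the terminal law increases the reduced dual functional. -/
lemma OptBackward.refit_le (hc : RegularChain N h F X lam k) [IsProbabilityMeasure (lam 0)]
    {r : ℝ → ℝ} (hr1 : ∫ y, r y ∂lam N = 1)
    (hD : OptBackward N h F lam k D l) (hD' : OptBackward N h F lam k D' l')
    (hfit : ∀ y ∈ X N, forwardDensity F h lam k l (fun x => (D 0 x)⁻¹) N y * D' N y = r y) :
    (∫ y, Real.log (D' N y) * r y ∂lam N) - ∫ x, Real.log (D 0 x) ∂lam 0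
      ≤ reducedDual N lam r D' := by
  have h0 : (0 : ℕ) ≤ N := zero_le
  have hu : Continuous fun x => (D 0 x)⁻¹ := (hD.cont 0 h0).inv₀ fun x => (hD.pos 0 h0 x).ne'
  have hupos : ∀ x, 0 < (D 0 x)⁻¹ := fun x => inv_pos.2 (hD.pos 0 h0 x)
  -- After insertion of `hfit` this says that the mean of `D' 0 / D 0` is at most `∫ r = 1`; with
  -- `log t ≤ t - 1` it follows that `∫ log D' 0 ≤ ∫ log D 0`.
  have h1 := hD'.integral_mul_le hc hD.cont_slope hu hupos N le_rfl
  have hae : ∀ᵐ y ∂lam N, y ∈ X N := mem_ae_iff.2 (hc.supp N le_rfl)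
  rw [integral_congr_ae (μ := lam N) (g := r)
    (by filter_upwards [hae] with y hy using hfit y hy), hr1] at h1
  have hi1 : Integrable (fun x => (D 0 x)⁻¹ * D' 0 x) (lam 0) :=
    integrable_of_continuous_of_compact (hc.compact 0 h0) (hc.supp 0 h0) (hu.mul (hD'.cont 0 h0))
  have hi2 : Integrable (fun x => (D 0 x)⁻¹ * D' 0 x - 1) (lam 0) :=
    hi1.sub (integrable_const 1)
  have h2 : ∫ x, Real.log (D' 0 x) ∂lam 0
      ≤ ∫ x, (Real.log (D 0 x) + ((D 0 x)⁻¹ * D' 0 x - 1)) ∂lam 0 := by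
    refine integral_mono (hD'.integrable_log hc h0)
      ((hD.integrable_log hc h0).add hi2) fun x => ?_
    have h3 := Real.log_le_sub_one_of_pos (mul_pos (hupos x) (hD'.pos 0 h0 x))
    rw [Real.log_mul (hupos x).ne' (hD'.pos 0 h0 x).ne', Real.log_inv] at h3
    simp only
    linarith
  rw [integral_add (hD.integrable_log hc h0) hi2,
    integral_sub hi1 (integrable_const 1)] at h2
  simp only [integral_const, probReal_univ, smul_eq_mul, mul_one] at h2
  simp only [reducedDual]
  linarith

end Regular

end EntropicSMOT

end

noncomputable section

namespace EntropicSMOT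

/-! ### Existence for the Schrödinger system, by compactness -/

section Fit

variable {n : ℕ} {h : ℝ} {F : ℝ → ℝ} {X : ℕ → Set ℝ} {lam : ℕ → Measure ℝ}
  {k : ℕ → ℝ → ℝ → ℝ}

/-- Arzelà–Ascoli: a common Lipschitz constant gives equicontinuity, and vanishing at `t₀` gives the
pointwise bound `A * dist t t₀`. -/
lemma isCompact_setOf_lipschitzWith_of_eq_zero {T : Type*} [PseudoMetricSpace T] [CompactSpace T]
    (A : ℝ≥0) (t₀ : T) : IsCompact {v : C(T, ℝ) | LipschitzWith A v ∧ v t₀ = 0} := by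
  refine ArzelaAscoli.isCompact_of_equicontinuous _ ?_ ?_
  · have hset : (ContinuousMap.toFun '' {v : C(T, ℝ) | LipschitzWith A v ∧ v t₀ = 0})
        = {f : T → ℝ | LipschitzWith A f} ∩ {f | f t₀ = 0} := by
      ext f
      constructor
      · rintro ⟨v, hv, rfl⟩
        exact hv
      · rintro ⟨hf, hf0⟩
        exact ⟨⟨f, hf.continuous⟩, ⟨hf, hf0⟩, rfl⟩
    rw [hset]
    refine IsCompact.of_isClosed_subset (isCompact_univ_pi fun t : T =>
      isCompact_closedBall (0 : ℝ) (A * dist t t₀)) ?_ ?_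
    · exact (isClosed_setOfPred_lipschitzWith A).inter
        (isClosed_eq (continuous_apply t₀) continuous_const)
    · rintro f ⟨hf, hf0⟩ t -
      have h1 := hf.dist_le_mul t t₀
      rw [show f t₀ = 0 from hf0] at h1
      exact h1
  · exact (LipschitzWith.uniformEquicontinuous _ A fun v => v.2.1).equicontinuous

variable [∀ i, IsFiniteMeasure (lam i)]

/-- A bound for the last optimal slope which does not depend on the terminal condition. -/
lemma RegularChain.exists_slope_bound (hc : RegularChain (n + 1) h F X lam k) :
    ∃ L, 0 ≤ L ∧ ∀ D l, OptBackward (n + 1) h F lam k D l → ∀ x ∈ X n, |l n x| ≤ L := by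
  obtain ⟨C, hC⟩ := (hc.compact n (by omega)).isBounded.exists_norm_le
  obtain ⟨C', hC'⟩ := (hc.compact (n + 1) le_rfl).isBounded.exists_norm_le
  set B := (C' + C) / h with hB
  refine ⟨max 0 (conj F 0 + max (F (B + 1)) (F (-(B + 1)))), le_max_left _ _,
    fun D l hD x hx => le_trans ?_ (le_max_right _ _)⟩
  refine abs_le_of_tiltedMass_le hc.convex hc.coercive (hc.compact (n + 1) le_rfl)
    (hc.supp (n + 1) le_rfl) (hc.ne_zero le_rfl)
    (hc.continuous_kernel_mul (Nat.lt_succ_self n) (hD.cont (n + 1) le_rfl))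
    (fun x y => mul_pos (hc.pos n (Nat.lt_succ_self n) x y) (hD.pos (n + 1) le_rfl y))
    (x := x) (fun y hy => ?_)
    ((hD.eq n (Nat.lt_succ_self n) x).symm.le.trans (hD.le n (Nat.lt_succ_self n) x 0))
  rw [abs_div, abs_of_pos hc.hpos, hB]
  have h1 : |x| ≤ C := hC x hx
  have h2 : |y| ≤ C' := hC' y hy
  have := hc.hpos
  gcongr
  exact (abs_sub _ _).trans (add_le_add h2 h1)

/-- In the last kernel the exponent of the tilt is affine in `y` with slope at most `L / h` in
modulus, and the reference density contributes `C`. The earlier steps and `u` enter only as positive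
weights, so the constant depends on neither. -/
lemma RegularChain.forwardDensity_le_exp_mul (hc : RegularChain (n + 1) h F X lam k)
    {C L : ℝ} (hk : ∀ x ∈ X n, ∀ y ∈ X (n + 1), ∀ y' ∈ X (n + 1),
      k n x y ≤ Real.exp (C * |y - y'|) * k n x y')
    {l : ℕ → ℝ → ℝ} (hl : ∀ i < n + 1, Continuous (l i)) (hL : ∀ x ∈ X n, |l n x| ≤ L)
    {u : ℝ → ℝ} (hu : Continuous u) (hupos : ∀ x, 0 < u x) {y y' : ℝ} (hy : y ∈ X (n + 1))
    (hy' : y' ∈ X (n + 1)) :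
    forwardDensity F h lam k l u (n + 1) y
      ≤ Real.exp ((C + L / h) * |y - y'|) * forwardDensity F h lam k l u (n + 1) y' := by
  have hn : n < n + 1 := Nat.lt_succ_self n
  have hY := hc.compact n hn.le
  have hν := hc.supp n hn.le
  have hU := hc.continuous_forwardDensity hl hu n hn.le
  have hcont : ∀ y, Continuous fun x =>
      forwardDensity F h lam k l u n x * (tilt F h x (l n x) y * k n x y) := fun y =>
    hU.mul ((hc.continuous_tilted_kernel hn (hl n hn)).comp
      (continuous_id.prodMk continuous_const))
  simp only [forwardDensity]
  rw [← integral_const_mul]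
  refine integral_mono_ae (integrable_of_continuous_of_compact hY hν (hcont y))
    (integrable_of_continuous_of_compact hY hν (continuous_const.mul (hcont y'))) ?_
  have hae : ∀ᵐ x ∂lam n, x ∈ X n := mem_ae_iff.2 hν
  filter_upwards [hae] with x hx
  have h1 : tilt F h x (l n x) y ≤ Real.exp (L / h * |y - y'|) * tilt F h x (l n x) y' := by
    rw [tilt, tilt, ← Real.exp_add]
    refine Real.exp_le_exp.2 ?_
    have e : conj F (l n x) - l n x * ((y - x) / h)
        = -(l n x * (y - y')) / h + (conj F (l n x) - l n x * ((y' - x) / h)) := by ring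
    rw [e]
    have h2 : -(l n x * (y - y')) ≤ L * |y - y'| :=
      (neg_le_abs _).trans ((abs_mul _ _).le.trans
        (mul_le_mul_of_nonneg_right (hL x hx) (abs_nonneg _)))
    have h3 := div_le_div_of_nonneg_right h2 hc.hpos.le
    rw [mul_div_right_comm] at h3
    linarith
  have h2 := mul_le_mul h1 (hk x hx y hy y' hy') (hc.pos n hn x y).le
    (mul_pos (Real.exp_pos _) (tilt_pos _ _ _ _ _)).le
  have h3 := mul_le_mul_of_nonneg_left h2 (hc.forwardDensity_pos hl hu hupos n hn.le x).le
  rw [add_mul, Real.exp_add]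
  linarith

/-- The Schrödinger system has a solution. -/
theorem RegularChain.exists_fit (hc : RegularChain (n + 1) h F X lam k)
    [IsProbabilityMeasure (lam 0)] {r : ℝ → ℝ} (hr : Continuous r) (hrpos : ∀ y, 0 < r y)
    (hr1 : ∫ y, r y ∂lam (n + 1) = 1) {C : ℝ} (hC0 : 0 ≤ C)
    (hk : ∀ x ∈ X n, ∀ y ∈ X (n + 1), ∀ y' ∈ X (n + 1),
      k n x y ≤ Real.exp (C * |y - y'|) * k n x y') :
    ∃ D l, OptBackward (n + 1) h F lam k D l ∧ ∀ᵐ y ∂lam (n + 1),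
      forwardDensity F h lam k l (fun x => (D 0 x)⁻¹) (n + 1) y * D (n + 1) y = r y := by
  have hN := hc.compact (n + 1) le_rfl
  have hNs := hc.supp (n + 1) le_rfl
  have hae : ∀ᵐ y ∂lam (n + 1), y ∈ X (n + 1) := mem_ae_iff.2 hNs
  obtain ⟨L, hL0, hL⟩ := hc.exists_slope_bound
  have : CompactSpace (X (n + 1)) := isCompact_iff_compactSpace.1 hN
  obtain ⟨y₀, hy₀⟩ : (X (n + 1)).Nonempty := by
    have : NeBot (ae (lam (n + 1))) := ae_neBot.2 (hc.ne_zero le_rfl)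
    exact hae.exists
  have hA0 : 0 ≤ C + L / h := add_nonneg hC0 (div_nonneg hL0 hc.hpos.le)
  obtain ⟨A, hAc⟩ : ∃ A : ℝ≥0, (A : ℝ) = C + L / h := ⟨⟨C + L / h, hA0⟩, rfl⟩
  -- The unknown is `v = log D_N - log r`. Subtracting `log r` matters: the refitted choice is `-log
  -- S`, which is Lipschitz although `r` is only continuous.
  have hext : ∀ v : C(X (n + 1), ℝ), ∃ D l, OptBackward (n + 1) h F lam k D l ∧
      ∀ y (hy : y ∈ X (n + 1)), Real.log (D (n + 1) y) = v ⟨y, hy⟩ + Real.log (r y) := by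
    intro v
    obtain ⟨g, hg⟩ := ContinuousMap.exists_restrict_eq hN.isClosed v
    obtain ⟨D, l, hD, hDN⟩ := hc.exists_optBackward (f := fun y => Real.exp (g y) * r y)
      ((Real.continuous_exp.comp g.continuous).mul hr) (fun y => mul_pos (Real.exp_pos _) (hrpos y))
    refine ⟨D, l, hD, fun y hy => ?_⟩
    rw [hDN, Real.log_mul (Real.exp_pos _).ne' (hrpos y).ne', Real.log_exp, ← hg]
    rfl
  choose D l hD hDN using hext
  have hJ : ∀ v w, reducedDual (n + 1) lam r (D v) ≤ reducedDual (n + 1) lam r (D w)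
      + 2 * dist v w := by
    intro v w
    have h1 := (hD v).reducedDual_le hc hr hrpos hr1 (hD w) (δ := dist v w) (ε := dist v w)
      (fun y hy => ?_) (fun y hy => ?_)
    · linarith
    all_goals
      rw [hDN v y hy, hDN w y hy]
      have h2 := abs_le.1 ((Real.dist_eq _ _).symm.le.trans
        (ContinuousMap.dist_apply_le_dist (f := v) (g := w) ⟨y, hy⟩))
      linarith [h2.1, h2.2]
  have hJc : Continuous fun v => reducedDual (n + 1) lam r (D v) := by
    refine (LipschitzWith.of_dist_le_mul (K := 2) fun v w => ?_).continuous
    rw [Real.dist_eq, abs_le]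
    have h1 := hJ v w
    have h2 := hJ w v
    rw [dist_comm w v] at h2
    push_cast
    constructor <;> linarith
  obtain ⟨v, hv, hmax⟩ := (isCompact_setOf_lipschitzWith_of_eq_zero A
    (⟨y₀, hy₀⟩ : X (n + 1))).exists_isMaxOn ⟨0, LipschitzWith.const' 0, rfl⟩ hJc.continuousOn
  have hDv := hD v
  have hu : Continuous fun x => (D v 0 x)⁻¹ :=
    (hDv.cont 0 (zero_le)).inv₀ fun x => (hDv.pos 0 (zero_le) x).ne'
  have hupos : ∀ x, 0 < (D v 0 x)⁻¹ := fun x => inv_pos.2 (hDv.pos 0 (zero_le) x)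
  refine ⟨D v, l v, hDv, ?_⟩
  set S := forwardDensity F h lam k (l v) (fun x => (D v 0 x)⁻¹) (n + 1) with hS
  have hSc : Continuous S := hc.continuous_forwardDensity hDv.cont_slope hu (n + 1) le_rfl
  have hSp : ∀ y, 0 < S y := hc.forwardDensity_pos hDv.cont_slope hu hupos (n + 1) le_rfl
  have hSlog : Continuous fun y => Real.log (S y) := hSc.log fun y => (hSp y).ne'
  -- The refitted terminal function, shifted to vanish at `y₀` so that it lies in the compact set
  -- over which `v` maximises.
  set w : C(X (n + 1), ℝ) := ⟨fun y => -Real.log (S y) + Real.log (S y₀),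
    ((hSlog.comp continuous_subtype_val).neg).add continuous_const⟩ with hw
  have hSle : ∀ y ∈ X (n + 1), ∀ y' ∈ X (n + 1),
      Real.log (S y) ≤ Real.log (S y') + (C + L / h) * |y - y'| := by
    intro y hy y' hy'
    have h1 := hc.forwardDensity_le_exp_mul hk hDv.cont_slope (hL _ _ hDv) hu hupos hy hy'
    have h2 := Real.log_le_log (hSp y) h1
    rwa [Real.log_mul (Real.exp_pos _).ne' (hSp y').ne', Real.log_exp, add_comm] at h2
  have hwK : LipschitzWith A w ∧ w ⟨y₀, hy₀⟩ = 0 := by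
    refine ⟨LipschitzWith.of_dist_le_mul fun y y' => ?_, by simp [hw]⟩
    have h1 := hSle y y.2 y' y'.2
    have h2 := hSle y' y'.2 y y.2
    rw [abs_sub_comm] at h2
    rw [Real.dist_eq, Subtype.dist_eq, Real.dist_eq, abs_le]
    simp only [hw, ContinuousMap.coe_mk, hAc]
    constructor <;> linarith
  obtain ⟨D', l', hD', hD'N⟩ := hc.exists_optBackward (f := fun y => r y / S y)
    (hr.div hSc fun y => (hSp y).ne') (fun y => div_pos (hrpos y) (hSp y))
  have hlogD' : ∀ y, Real.log (D' (n + 1) y) = Real.log (r y) - Real.log (S y) := fun y => by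
    rw [hD'N, Real.log_div (hrpos y).ne' (hSp y).ne']
  have h1 : reducedDual (n + 1) lam r D' ≤ reducedDual (n + 1) lam r (D v) := by
    -- The two terminal functions differ by the constant `log (S y₀)`; opposite values of `δ` and
    -- `ε` make their contributions cancel, so the shift is free.
    have h2 := hD'.reducedDual_le hc hr hrpos hr1 (hD w) (δ := -Real.log (S y₀))
      (ε := Real.log (S y₀)) (fun y hy => ?_) (fun y hy => ?_)
    · have h3 : reducedDual (n + 1) lam r (D w) ≤ reducedDual (n + 1) lam r (D v) := hmax hwK
      linarith
    all_goals
      rw [hDN w y hy, hlogD']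
      simp only [hw, ContinuousMap.coe_mk]
      linarith
  have h2 := hDv.refit_le hc hr1 hD' fun y _ => by
    rw [hD'N]
    exact mul_div_cancel₀ _ (hSp y).ne'
  have h3 : ∫ y, S y * D v (n + 1) y ∂lam (n + 1) = 1 := by
    rw [hS, hDv.integral_forwardDensity_mul hc hu (n + 1) le_rfl]
    simp [inv_mul_cancel₀ (hDv.pos 0 (zero_le) _).ne']
  have hint := fun {f : ℝ → ℝ} (hf : Continuous f) =>
    integrable_of_continuous_of_compact (ν := lam (n + 1)) hN hNs hf
  have hDc := hDv.cont (n + 1) le_rfl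
  have hDp := hDv.pos (n + 1) le_rfl
  have hDlog : Continuous fun y => Real.log (D v (n + 1) y) := hDc.log fun y => (hDp y).ne'
  have hD'log : Continuous fun y => Real.log (D' (n + 1) y) :=
    (hD'.cont (n + 1) le_rfl).log fun y => (hD'.pos (n + 1) le_rfl y).ne'
  -- With `t = log D_N - log D'_N` the expression is `(exp t - 1 - t) * r`, which is nonnegative and
  -- vanishes only for `t = 0`, that is, when the terminal density fits.
  have hkey : ∀ y, 0 ≤ S y * D v (n + 1) y - r y
      - (Real.log (D v (n + 1) y) - Real.log (D' (n + 1) y)) * r y ∧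
      (S y * D v (n + 1) y - r y
      - (Real.log (D v (n + 1) y) - Real.log (D' (n + 1) y)) * r y = 0 →
        S y * D v (n + 1) y = r y) := by
    intro y
    set t := Real.log (D v (n + 1) y) - Real.log (D' (n + 1) y) with ht
    have he : S y * D v (n + 1) y = Real.exp t * r y := by
      rw [ht, hlogD', Real.exp_sub, Real.exp_sub, Real.exp_log (hDp y), Real.exp_log (hrpos y),
        Real.exp_log (hSp y)]
      have := (hrpos y).ne'
      have := (hSp y).ne'
      field_simp
    rw [he]
    constructor
    · have := mul_le_mul_of_nonneg_right (Real.add_one_le_exp t) (hrpos y).le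
      linarith
    · intro h0
      by_contra hne
      have ht0 : t ≠ 0 := by
        intro h4
        simp [h4] at hne
      have := mul_lt_mul_of_pos_right (Real.add_one_lt_exp ht0) (hrpos y)
      linarith
  -- The masses of `S * D_N` and `r` are both `1`; the logarithmic term is controlled by maximality
  -- of `v` together with the improvement under refitting.
  have h4 : ∫ y, (S y * D v (n + 1) y - r y
      - (Real.log (D v (n + 1) y) - Real.log (D' (n + 1) y)) * r y) ∂lam (n + 1) ≤ 0 := by
    have e : ∀ y, S y * D v (n + 1) y - r y
        - (Real.log (D v (n + 1) y) - Real.log (D' (n + 1) y)) * r y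
        = S y * D v (n + 1) y - r y - Real.log (D v (n + 1) y) * r y
          + Real.log (D' (n + 1) y) * r y := fun y => by ring
    simp only [e]
    have i1 : Integrable (fun y => S y * D v (n + 1) y) (lam (n + 1)) := hint (hSc.mul hDc)
    have i2 : Integrable (fun y => Real.log (D v (n + 1) y) * r y) (lam (n + 1)) :=
      hint (hDlog.mul hr)
    have i3 : Integrable (fun y => S y * D v (n + 1) y - r y) (lam (n + 1)) := i1.sub (hint hr)
    have i4 : Integrable (fun y => S y * D v (n + 1) y - r y - Real.log (D v (n + 1) y) * r y)
      (lam (n + 1)) := i3.sub i2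
    have i5 : Integrable (fun y => Real.log (D' (n + 1) y) * r y) (lam (n + 1)) :=
      hint (hD'log.mul hr)
    rw [integral_add i4 i5, integral_sub i3 i2, integral_sub i1 (hint hr), h3,
      hr1]
    have h5 : reducedDual (n + 1) lam r (D v) = (∫ y, Real.log (D v (n + 1) y) * r y ∂lam (n + 1))
      - ∫ x, Real.log (D v 0 x) ∂lam 0 := rfl
    linarith
  have h5 := (integral_eq_zero_iff_of_nonneg (fun y => (hkey y).1) (hint
    (((hSc.mul hDc).sub hr).sub ((hDlog.sub hD'log).mul hr)))).1
    (le_antisymm h4 (integral_nonneg fun y => (hkey y).1))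
  filter_upwards [h5] with y hy
  exact (hkey y).2 hy

end Fit

end EntropicSMOT

end

noncomputable section

namespace EntropicSMOT

/-! ### Compactness of path space and globally continuous potentials -/

section Support

variable {N : ℕ} {X : ℕ → Set ℝ}

lemma isCompact_pathSpace (hX : ∀ i ≤ N, IsCompact (X i)) : IsCompact (pathSpace N X) := by
  have : pathSpace N X = univ.pi fun i : Fin (N + 1) => X i := by
    ext ω; simp [pathSpace]
  rw [this]
  exact isCompact_univ_pi fun i => hX i (by omega)

/-- All the potentials are continuous on the whole line. -/
structure Potentials.Cont (Φ : Potentials) : Prop where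
  init : Continuous Φ.init
  drift : ∀ i, Continuous (Φ.drift i)
  final : Continuous Φ.final

variable {F : ℝ → ℝ} {h : ℝ} {Φ : Potentials}

lemma Potentials.Cont.continuous_conj_drift (hΦ : Φ.Cont) (hF : ConvexOn ℝ univ F)
    (hFc : Tendsto (fun b => F b / |b|) (cocompact ℝ) atTop) (c : ℝ) (i : ℕ) :
    Continuous fun x => conj F (c * Φ.drift i x) :=
  (continuous_conj hF hFc).comp (continuous_const.mul (hΦ.drift i))

lemma Potentials.Cont.continuous_delta (hΦ : Φ.Cont) (hF : ConvexOn ℝ univ F)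
    (hFc : Tendsto (fun b => F b / |b|) (cocompact ℝ) atTop) :
    Continuous (delta N h F Φ) := by
  refine ((hΦ.init.comp (continuous_apply 0)).add (continuous_finsetSum _ fun i _ =>
    Continuous.add ?_ ?_)).add (hΦ.final.comp (continuous_apply _))
  · split_ifs
    · exact continuous_const
    · exact continuous_const.mul
        ((hΦ.continuous_conj_drift hF hFc _ i).comp (continuous_apply i.castSucc))
  · exact (continuous_const.mul ((continuous_apply i.succ).sub (continuous_apply i.castSucc))).mul
      ((hΦ.drift i).comp (continuous_apply i.castSucc))

end Support

/-! ### The drift of a path measure on compact slices -/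

section Drift

variable {N : ℕ} {X : ℕ → Set ℝ} {h : ℝ} {Q : ProbabilityMeasure (Path N)}

instance isMarkovKernel_transition (Q : ProbabilityMeasure (Path N)) (i : Fin N) :
    IsMarkovKernel (transition Q i) := by
  unfold transition; infer_instance

instance isProbabilityMeasure_marginal (Q : ProbabilityMeasure (Path N)) (i : Fin (N + 1)) :
    IsProbabilityMeasure (marginal (Q : Measure (Path N)) i) :=
  Measure.isProbabilityMeasure_map (measurable_pi_apply i).aemeasurable

lemma marginal_compProd_transition (Q : ProbabilityMeasure (Path N)) (i : Fin N) :
    marginal (Q : Measure (Path N)) i.castSucc ⊗ₘ transition Q i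
      = twoMarginal (Q : Measure (Path N)) i :=
  compProd_map_condDistrib (measurable_pi_apply i.succ).aemeasurable

lemma ae_mem_pathSpace (hQ : (Q : Measure (Path N)) (pathSpace N X)ᶜ = 0) :
    ∀ᵐ ω ∂(Q : Measure (Path N)), ω ∈ pathSpace N X := mem_ae_iff.2 hQ

lemma marginal_compl_eq_zero (hX : ∀ i ≤ N, IsCompact (X i))
    (hQ : (Q : Measure (Path N)) (pathSpace N X)ᶜ = 0) (i : Fin (N + 1)) :
    marginal (Q : Measure (Path N)) i (X i)ᶜ = 0 := by
  rw [marginal, Measure.map_apply (measurable_pi_apply i)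
    (hX i (by omega)).measurableSet.compl]
  exact measure_mono_null (t := (pathSpace N X)ᶜ)
    (fun ω hω (hω' : ω ∈ pathSpace N X) => hω (hω' i)) hQ

lemma ae_transition_mem (hX : ∀ i ≤ N, IsCompact (X i))
    (hQ : (Q : Measure (Path N)) (pathSpace N X)ᶜ = 0) (i : Fin N) :
    ∀ᵐ x ∂marginal (Q : Measure (Path N)) i.castSucc,
      ∀ᵐ y ∂transition Q i x, x ∈ X i ∧ y ∈ X (i + 1) := by
  refine Measure.ae_ae_of_ae_compProd (p := fun z : ℝ × ℝ => z.1 ∈ X i ∧ z.2 ∈ X (i + 1)) ?_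
  have hm : MeasurableSet {z : ℝ × ℝ | z.1 ∈ X i ∧ z.2 ∈ X (i + 1)} :=
    (hX i (by omega)).measurableSet.prod (hX (i + 1) (by omega)).measurableSet
  have hpm : Measurable fun ω : Path N => (ω i.castSucc, ω i.succ) :=
    (measurable_pi_apply i.castSucc).prodMk (measurable_pi_apply i.succ)
  rw [marginal_compProd_transition, twoMarginal, ae_map_iff hpm.aemeasurable hm]
  filter_upwards [ae_mem_pathSpace hQ] with ω hω
  exact ⟨hω i.castSucc, hω i.succ⟩

lemma stronglyMeasurable_drift (h : ℝ) (Q : ProbabilityMeasure (Path N)) (i : Fin N) :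
    StronglyMeasurable (drift h Q i) := by
  have hm : StronglyMeasurable (Function.uncurry fun x y : ℝ => y - x) :=
    (measurable_snd.sub measurable_fst).stronglyMeasurable
  exact hm.integral_kernel_prod_right.const_mul (1 / h)

lemma exists_drift_bound (hX : ∀ i ≤ N, IsCompact (X i))
    (hQ : (Q : Measure (Path N)) (pathSpace N X)ᶜ = 0) (i : Fin N) :
    ∃ B, ∀ᵐ x ∂marginal (Q : Measure (Path N)) i.castSucc, |drift h Q i x| ≤ B := by
  obtain ⟨C, hC⟩ := (hX i (by omega)).isBounded.exists_norm_le
  obtain ⟨C', hC'⟩ := (hX (i + 1) (by omega)).isBounded.exists_norm_le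
  refine ⟨|1 / h| * (C' + C), ?_⟩
  filter_upwards [ae_transition_mem hX hQ i] with x hx
  rw [drift, abs_mul]
  refine mul_le_mul_of_nonneg_left ?_ (abs_nonneg _)
  have := norm_integral_le_of_norm_le_const (μ := transition Q i x) (f := fun y => y - x)
    (C := C' + C) (hx.mono fun y hy => (norm_sub_le _ _).trans
      (add_le_add (hC' y hy.2) (hC x hy.1)))
  simpa using this

/-- The mean of the increment against a function of the present position. -/
lemma integral_increment_mul (hX : ∀ i ≤ N, IsCompact (X i))
    (hQ : (Q : Measure (Path N)) (pathSpace N X)ᶜ = 0) (i : Fin N) {φ : ℝ → ℝ}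
    (hφ : Continuous φ) :
    ∫ ω, 1 / h * (ω i.succ - ω i.castSucc) * φ (ω i.castSucc) ∂(Q : Measure (Path N))
      = ∫ x, φ x * drift h Q i x ∂marginal (Q : Measure (Path N)) i.castSucc := by
  have hpm : Measurable fun ω : Path N => (ω i.castSucc, ω i.succ) :=
    (measurable_pi_apply i.castSucc).prodMk (measurable_pi_apply i.succ)
  have hf : Continuous fun z : ℝ × ℝ => 1 / h * (z.2 - z.1) * φ z.1 :=
    (continuous_const.mul (continuous_snd.sub continuous_fst)).mul (hφ.comp continuous_fst)
  have h1 : ∫ ω, 1 / h * (ω i.succ - ω i.castSucc) * φ (ω i.castSucc) ∂(Q : Measure (Path N))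
      = ∫ z, 1 / h * (z.2 - z.1) * φ z.1 ∂twoMarginal (Q : Measure (Path N)) i :=
    (integral_map hpm.aemeasurable hf.aestronglyMeasurable).symm
  have hint : Integrable (fun z : ℝ × ℝ => 1 / h * (z.2 - z.1) * φ z.1)
      (twoMarginal (Q : Measure (Path N)) i) := by
    rw [twoMarginal, integrable_map_measure hf.aestronglyMeasurable hpm.aemeasurable]
    exact integrable_of_continuous_of_compact (isCompact_pathSpace hX) hQ
      (hf.comp ((continuous_apply i.castSucc).prodMk (continuous_apply i.succ)))
  rw [h1]
  rw [← marginal_compProd_transition] at hint ⊢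
  rw [Measure.integral_compProd hint]
  refine integral_congr_ae (Eventually.of_forall fun x => ?_)
  simp only [drift, integral_mul_const, integral_const_mul]
  ring

/-- The drift is almost everywhere bounded because increments between compact slices are. In
particular the integrals of `F` along the drift in the primal functional are never the default value
of a divergent integral. -/
lemma integrable_comp_drift (hX : ∀ i ≤ N, IsCompact (X i))
    (hQ : (Q : Measure (Path N)) (pathSpace N X)ᶜ = 0) (i : Fin N) {G : ℝ → ℝ}
    (hG : Continuous G) :
    Integrable (fun x => G (drift h Q i x)) (marginal (Q : Measure (Path N)) i.castSucc) := by
  obtain ⟨B, hB⟩ := exists_drift_bound (h := h) hX hQ i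
  obtain ⟨C, hC⟩ := (isCompact_Icc (a := -B) (b := B)).exists_bound_of_continuousOn hG.continuousOn
  refine Integrable.of_bound
    (hG.comp_stronglyMeasurable (stronglyMeasurable_drift h Q i)).aestronglyMeasurable C ?_
  filter_upwards [hB] with x hx
  exact hC _ (abs_le.1 hx)

lemma integrable_mul_drift (hX : ∀ i ≤ N, IsCompact (X i))
    (hQ : (Q : Measure (Path N)) (pathSpace N X)ᶜ = 0) (i : Fin N) {φ : ℝ → ℝ}
    (hφ : Continuous φ) :
    Integrable (fun x => φ x * drift h Q i x) (marginal (Q : Measure (Path N)) i.castSucc) := by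
  obtain ⟨B, hB⟩ := exists_drift_bound (h := h) hX hQ i
  refine Integrable.mul_bdd (c := B) (integrable_of_continuous_of_compact (hX i (by omega))
    (marginal_compl_eq_zero hX hQ i.castSucc) hφ)
    (stronglyMeasurable_drift h Q i).aestronglyMeasurable hB

end Drift

/-! ### The duality gap identity -/

section Duality

variable {N : ℕ} {X : ℕ → Set ℝ} {h : ℝ} {F : ℝ → ℝ} {Q : ProbabilityMeasure (Path N)}
  {ρ₀ ρ₁ : Measure ℝ} {R : Measure (Path N)} {Φ : Potentials}

/-- The path measure `exp (Δ Φ / h) R`. -/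
def gibbs (N : ℕ) (h : ℝ) (F : ℝ → ℝ) (Φ : Potentials) (R : Measure (Path N)) :
    Measure (Path N) :=
  R.withDensity fun ω => ENNReal.ofReal (Real.exp (1 / h * delta N h F Φ ω))

/-- The relative entropy with respect to a measure with an exponential density. -/
lemma llr_withDensity_exp {Ω : Type*} [MeasurableSpace Ω] {μ ν : Measure Ω} [SigmaFinite μ]
    [SigmaFinite ν] (hμν : μ ≪ ν) {f : Ω → ℝ} (hf : Measurable f) :
    llr μ (ν.withDensity fun x => ENNReal.ofReal (Real.exp (f x)))
      =ᵐ[μ] fun x => llr μ ν x - f x := by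
  have h1 := Measure.rnDeriv_withDensity_right μ ν (f := fun x => ENNReal.ofReal (Real.exp (f x)))
    (hf.exp.ennreal_ofReal.aemeasurable)
    (Eventually.of_forall fun x => by simpa using Real.exp_pos (f x))
    (Eventually.of_forall fun x => ENNReal.ofReal_ne_top)
  filter_upwards [hμν.ae_le h1, Measure.rnDeriv_pos hμν,
    hμν.ae_le (Measure.rnDeriv_lt_top μ ν)] with x hx hx_pos hx_top
  have h2 : (μ.rnDeriv ν x).toReal ≠ 0 := by
    simp [ENNReal.toReal_eq_zero_iff, hx_pos.ne', hx_top.ne]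
  rw [llr, hx, ENNReal.toReal_mul, ENNReal.toReal_inv, ENNReal.toReal_ofReal (Real.exp_pos _).le,
    Real.log_mul (inv_ne_zero (Real.exp_pos _).ne') h2, Real.log_inv, Real.log_exp, llr]
  ring

lemma absolutelyContinuous_withDensity_exp {Ω : Type*} [MeasurableSpace Ω] {ν : Measure Ω}
    {f : Ω → ℝ} (hf : Measurable f) :
    ν ≪ ν.withDensity fun x => ENNReal.ofReal (Real.exp (f x)) :=
  withDensity_absolutelyContinuous' hf.exp.ennreal_ofReal.aemeasurable
    (Eventually.of_forall fun x => by simpa using Real.exp_pos (f x))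

/-- The endpoint marginals turn the outer potentials into integrals against `ρ₀` and `ρ₁`, and
conditioning turns increments into drifts. `delta` omits the conjugate at time `0`; this term is
added to the sum and compensated in the `ρ₀` integral. -/
lemma integral_delta (hX : ∀ i ≤ N, IsCompact (X i)) (hN : 1 ≤ N)
    (hF : ConvexOn ℝ univ F) (hFc : Tendsto (fun b => F b / |b|) (cocompact ℝ) atTop)
    (hΦ : Φ.Cont) (hQ : (Q : Measure (Path N)) (pathSpace N X)ᶜ = 0)
    (hQ0 : marginal (Q : Measure (Path N)) 0 = ρ₀)
    (hQ1 : marginal (Q : Measure (Path N)) (Fin.last N) = ρ₁) :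
    ∫ ω, delta N h F Φ ω ∂(Q : Measure (Path N))
      = (∑ i : Fin N, ∫ x, (h * conj F (-(1 / h) * Φ.drift i x) + Φ.drift i x * drift h Q i x)
          ∂marginal (Q : Measure (Path N)) i.castSucc)
        - ((∫ x, (-Φ.init x + h * conj F (-Φ.drift 0 x / h)) ∂ρ₀) + ∫ x, -Φ.final x ∂ρ₁) := by
  have hint := fun {f : Path N → ℝ} (hf : Continuous f) =>
    integrable_of_continuous_of_compact (isCompact_pathSpace hX) hQ hf
  have hmi := fun (i : Fin (N + 1)) {f : ℝ → ℝ} (hf : Continuous f) =>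
    integrable_of_continuous_of_compact (hX i (by omega)) (marginal_compl_eq_zero hX hQ i) hf
  have hmap : ∀ (i : Fin (N + 1)) {f : ℝ → ℝ}, Continuous f →
      ∫ ω, f (ω i) ∂(Q : Measure (Path N)) = ∫ x, f x ∂marginal (Q : Measure (Path N)) i :=
    fun i f hf => (integral_map (measurable_pi_apply i).aemeasurable
      hf.aestronglyMeasurable).symm
  have hc := fun i => hΦ.continuous_conj_drift hF hFc (-(1 / h)) i
  have hcA : ∀ i : Fin N, Continuous fun ω : Path N =>
      (if (i : ℕ) = 0 then 0 else h * conj F (-(1 / h) * Φ.drift i (ω i.castSucc))) := by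
    intro i
    split_ifs
    · exact continuous_const
    · exact continuous_const.mul ((hc i).comp (continuous_apply i.castSucc))
  have hcB : ∀ i : Fin N, Continuous fun ω : Path N =>
      1 / h * (ω i.succ - ω i.castSucc) * Φ.drift i (ω i.castSucc) := fun i =>
    (continuous_const.mul ((continuous_apply i.succ).sub (continuous_apply i.castSucc))).mul
      ((hΦ.drift i).comp (continuous_apply i.castSucc))
  have hterm : ∀ i : Fin N, ∫ ω, ((if (i : ℕ) = 0 then 0
        else h * conj F (-(1 / h) * Φ.drift i (ω i.castSucc)))
        + 1 / h * (ω i.succ - ω i.castSucc) * Φ.drift i (ω i.castSucc)) ∂(Q : Measure (Path N))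
      = (∫ x, (h * conj F (-(1 / h) * Φ.drift i x) + Φ.drift i x * drift h Q i x)
          ∂marginal (Q : Measure (Path N)) i.castSucc)
        - if (i : ℕ) = 0 then ∫ x, h * conj F (-(1 / h) * Φ.drift 0 x) ∂ρ₀ else 0 := by
    intro i
    have e1 : ∫ x, (h * conj F (-(1 / h) * Φ.drift i x) + Φ.drift i x * drift h Q i x)
          ∂marginal (Q : Measure (Path N)) i.castSucc
        = (∫ x, h * conj F (-(1 / h) * Φ.drift i x) ∂marginal (Q : Measure (Path N)) i.castSucc)
          + ∫ x, Φ.drift i x * drift h Q i x ∂marginal (Q : Measure (Path N)) i.castSucc :=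
      integral_add (hmi i.castSucc (continuous_const.mul (hc i)))
        (integrable_mul_drift hX hQ i (hΦ.drift i))
    rw [integral_add (hint (hcA i)) (hint (hcB i)),
      integral_increment_mul hX hQ i (hΦ.drift i), e1]
    by_cases hi : (i : ℕ) = 0
    · have hi0 : i.castSucc = 0 := Fin.ext hi
      simp [hi, hi0, hQ0]
    · simp only [hi, if_false]
      have hch : Continuous fun x => h * conj F (-(1 / h) * Φ.drift i x) :=
        continuous_const.mul (hc i)
      rw [hmap i.castSucc hch]
      ring
  have hsum0 : (∑ i : Fin N, if (i : ℕ) = 0 then ∫ x, h * conj F (-(1 / h) * Φ.drift 0 x) ∂ρ₀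
      else 0) = ∫ x, h * conj F (-(1 / h) * Φ.drift 0 x) ∂ρ₀ := by
    rw [Finset.sum_eq_single (⟨0, hN⟩ : Fin N)]
    · simp
    · intro j _ hj
      have : (j : ℕ) ≠ 0 := fun h0 => hj (Fin.ext h0)
      simp [this]
    · simp
  have hmi0 := fun {f : ℝ → ℝ} (hf : Continuous f) => hmi 0 hf
  rw [hQ0] at hmi0
  have e2 : ∫ x, (-Φ.init x + h * conj F (-Φ.drift 0 x / h)) ∂ρ₀
      = -(∫ x, Φ.init x ∂ρ₀) + ∫ x, h * conj F (-(1 / h) * Φ.drift 0 x) ∂ρ₀ := by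
    have i1 : Integrable (fun x => -Φ.init x) ρ₀ := hmi0 hΦ.init.neg
    have i2 : Integrable (fun x => h * conj F (-(1 / h) * Φ.drift 0 x)) ρ₀ :=
      hmi0 (continuous_const.mul (hc 0))
    rw [← integral_neg, ← integral_add i1 i2]
    refine integral_congr_ae (Eventually.of_forall fun x => ?_)
    simp only
    rw [show -Φ.drift 0 x / h = -(1 / h) * Φ.drift 0 x by ring]
  have hcS : Continuous fun ω : Path N => ∑ i : Fin N, ((if (i : ℕ) = 0 then 0
        else h * conj F (-(1 / h) * Φ.drift i (ω i.castSucc)))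
        + 1 / h * (ω i.succ - ω i.castSucc) * Φ.drift i (ω i.castSucc)) :=
    continuous_finsetSum _ fun i _ => (hcA i).add (hcB i)
  have hci : Continuous fun ω : Path N => Φ.init (ω 0) := hΦ.init.comp (continuous_apply 0)
  have hcf : Continuous fun ω : Path N => Φ.final (ω (Fin.last N)) :=
    hΦ.final.comp (continuous_apply _)
  have hcAB : ∀ i : Fin N, Continuous fun ω : Path N => ((if (i : ℕ) = 0 then 0
        else h * conj F (-(1 / h) * Φ.drift i (ω i.castSucc)))
        + 1 / h * (ω i.succ - ω i.castSucc) * Φ.drift i (ω i.castSucc)) :=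
    fun i => (hcA i).add (hcB i)
  have hcis : Continuous fun ω : Path N => Φ.init (ω 0) + ∑ i : Fin N, ((if (i : ℕ) = 0 then 0
        else h * conj F (-(1 / h) * Φ.drift i (ω i.castSucc)))
        + 1 / h * (ω i.succ - ω i.castSucc) * Φ.drift i (ω i.castSucc)) := hci.add hcS
  simp only [delta]
  rw [integral_add (hint hcis) (hint hcf), integral_add (hint hci) (hint hcS),
    integral_finsetSum _ fun i _ => hint (hcAB i), hmap 0 hΦ.init,
    hmap (Fin.last N) hΦ.final, hQ0, hQ1, Finset.sum_congr rfl fun i _ => hterm i,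
    Finset.sum_sub_distrib, hsum0, e2, integral_neg]
  ring

/-- The duality gap is the relative entropy with respect to `exp (Δ Φ / h) R` plus the gaps in
Fenchel's inequality. -/
theorem duality_gap (hX : ∀ i ≤ N, IsCompact (X i)) (hN : 1 ≤ N) (hh : 0 < h)
    (hF : ConvexOn ℝ univ F) (hFc : Tendsto (fun b => F b / |b|) (cocompact ℝ) atTop)
    (hΦ : Φ.Cont) [IsFiniteMeasure R] (hR : R (pathSpace N X)ᶜ = 0)
    (hQ : (Q : Measure (Path N)) (pathSpace N X)ᶜ = 0)
    (hQ0 : marginal (Q : Measure (Path N)) 0 = ρ₀)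
    (hQ1 : marginal (Q : Measure (Path N)) (Fin.last N) = ρ₁)
    (hac : (Q : Measure (Path N)) ≪ R) (hllr : Integrable (llr (Q : Measure (Path N)) R) Q) :
    h * (∑ i : Fin N, ∫ x, F (drift h Q i x) ∂marginal (Q : Measure (Path N)) i.castSucc)
        + h * (InformationTheory.klDiv (Q : Measure (Path N)) R).toReal
      = dualObjective N h F ρ₀ ρ₁ R Φ
        + h * (InformationTheory.klDiv (Q : Measure (Path N)) (gibbs N h F Φ R)).toReal
        + h * ∑ i : Fin N, ∫ x, (F (drift h Q i x) + conj F (-(1 / h) * Φ.drift i x)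
            - -(1 / h) * Φ.drift i x * drift h Q i x)
            ∂marginal (Q : Measure (Path N)) i.castSucc := by
  have hcd : Continuous fun ω : Path N => 1 / h * delta N h F Φ ω :=
    continuous_const.mul (hΦ.continuous_delta hF hFc)
  have hexpi : Integrable (fun ω => Real.exp (1 / h * delta N h F Φ ω)) R :=
    integrable_of_continuous_of_compact (isCompact_pathSpace hX) hR hcd.rexp
  have hdi : Integrable (fun ω => 1 / h * delta N h F Φ ω) (Q : Measure (Path N)) :=
    integrable_of_continuous_of_compact (isCompact_pathSpace hX) hQ hcd
  have hac' : (Q : Measure (Path N)) ≪ gibbs N h F Φ R :=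
    hac.trans (absolutelyContinuous_withDensity_exp hcd.measurable)
  -- Changing the reference measure shifts the log-likelihood ratio by `ΔΦ / h`; the mass terms in
  -- `klDiv` produce the exponential term of the dual functional.
  have hl : llr (Q : Measure (Path N)) (gibbs N h F Φ R) =ᵐ[(Q : Measure (Path N))]
      fun ω => llr (Q : Measure (Path N)) R ω - 1 / h * delta N h F Φ ω :=
    llr_withDensity_exp hac hcd.measurable
  have hllr' : Integrable (llr (Q : Measure (Path N)) (gibbs N h F Φ R)) Q :=
    (integrable_congr hl).2 (hllr.sub hdi)
  have hfin : IsFiniteMeasure (gibbs N h F Φ R) :=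
    isFiniteMeasure_withDensity_ofReal hexpi.2
  have hmass : (gibbs N h F Φ R).real univ = ∫ ω, Real.exp (1 / h * delta N h F Φ ω) ∂(R) := by
    rw [measureReal_def, gibbs, withDensity_apply _ MeasurableSet.univ, setLIntegral_univ,
      integral_eq_lintegral_of_nonneg_ae (Eventually.of_forall fun ω => (Real.exp_pos _).le)
        hexpi.1]
  rw [InformationTheory.toReal_klDiv hac hllr, InformationTheory.toReal_klDiv hac' hllr',
    integral_congr_ae hl, integral_sub hllr hdi, integral_const_mul, hmass,
    integral_delta hX hN hF hFc hΦ hQ hQ0 hQ1, dualObjective]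
  have e1 : ∫ ω, (Real.exp (delta N h F Φ ω / h) - 1) ∂(R)
      = (∫ ω, Real.exp (1 / h * delta N h F Φ ω) ∂(R)) - R.real univ := by
    have : ∀ ω, delta N h F Φ ω / h = 1 / h * delta N h F Φ ω := fun ω => by ring
    simp only [this]
    rw [integral_sub hexpi (integrable_const 1)]
    simp
  have hFcont := continuous_of_convexOn_univ hF
  have e2 : h * ∑ i : Fin N, ∫ x, (F (drift h Q i x) + conj F (-(1 / h) * Φ.drift i x)
            - -(1 / h) * Φ.drift i x * drift h Q i x)
            ∂marginal (Q : Measure (Path N)) i.castSucc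
      = h * (∑ i : Fin N, ∫ x, F (drift h Q i x) ∂marginal (Q : Measure (Path N)) i.castSucc)
        + ∑ i : Fin N, ∫ x, (h * conj F (-(1 / h) * Φ.drift i x) + Φ.drift i x * drift h Q i x)
          ∂marginal (Q : Measure (Path N)) i.castSucc := by
    rw [Finset.mul_sum, Finset.mul_sum, ← Finset.sum_add_distrib]
    refine Finset.sum_congr rfl fun i _ => ?_
    have i1 := integrable_comp_drift (h := h) hX hQ i hFcont
    have i2 : Integrable (fun x => h * conj F (-(1 / h) * Φ.drift i x)
        + Φ.drift i x * drift h Q i x) (marginal (Q : Measure (Path N)) i.castSucc) :=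
      (integrable_of_continuous_of_compact (hX i (by omega))
        (marginal_compl_eq_zero hX hQ i.castSucc)
        (continuous_const.mul (hΦ.continuous_conj_drift hF hFc _ i))).add
        (integrable_mul_drift hX hQ i (hΦ.drift i))
    rw [← integral_const_mul, ← integral_const_mul, ← integral_add (i1.const_mul h) i2]
    refine integral_congr_ae (Eventually.of_forall fun x => ?_)
    simp only
    have := hh.ne'
    field_simp
    ring
  rw [e1, e2]
  simp only [mul_add, mul_sub]
  have := hh.ne'
  field_simp
  ring

lemma primalObjective_eq_coe
    (hQ0 : marginal (Q : Measure (Path N)) 0 = ρ₀)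
    (hQ1 : marginal (Q : Measure (Path N)) (Fin.last N) = ρ₁)
    (hac : (Q : Measure (Path N)) ≪ R) (hllr : Integrable (llr (Q : Measure (Path N)) R) Q) :
    primalObjective h F ρ₀ ρ₁ R Q
      = ((h * (∑ i : Fin N, ∫ x, F (drift h Q i x) ∂marginal (Q : Measure (Path N)) i.castSucc)
        + h * (InformationTheory.klDiv (Q : Measure (Path N)) R).toReal : ℝ) : EReal) := by
  have hne := InformationTheory.klDiv_ne_top hac hllr
  have h1 : ((InformationTheory.klDiv (Q : Measure (Path N)) R : ℝ≥0∞) : EReal)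
      = (((InformationTheory.klDiv (Q : Measure (Path N)) R).toReal : ℝ) : EReal) := by
    rw [EReal.coe_ennreal_toReal hne]
  rw [primalObjective, h1, hardPenalty, hardPenalty, if_pos hQ0, if_pos hQ1]
  push_cast
  simp

/-- No summand is `⊥`: the drift term is real and the others are nonnegative. This has to be checked
because in `EReal` an added `⊥` would absorb `⊤`. -/
lemma of_primalObjective_ne_top (hh : 0 < h) (hne : primalObjective h F ρ₀ ρ₁ R Q ≠ ⊤) :
    marginal (Q : Measure (Path N)) 0 = ρ₀ ∧
      marginal (Q : Measure (Path N)) (Fin.last N) = ρ₁ ∧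
      (Q : Measure (Path N)) ≪ R ∧ Integrable (llr (Q : Measure (Path N)) R) Q := by
  have hk0 : (h : EReal) * ((InformationTheory.klDiv (Q : Measure (Path N)) R : ℝ≥0∞) : EReal)
      ≠ ⊥ := by
    refine ne_of_gt (lt_of_lt_of_le EReal.bot_lt_zero (mul_nonneg ?_ (EReal.coe_ennreal_nonneg _)))
    exact_mod_cast hh.le
  by_contra hcon
  refine hne ?_
  rw [primalObjective]
  by_cases h0 : marginal (Q : Measure (Path N)) 0 = ρ₀
  · by_cases h1 : marginal (Q : Measure (Path N)) (Fin.last N) = ρ₁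
    · have h2 : InformationTheory.klDiv (Q : Measure (Path N)) R = ∞ := by
        by_contra h3
        exact hcon ⟨h0, h1, InformationTheory.klDiv_ne_top_iff.1 h3⟩
      rw [h2, hardPenalty, hardPenalty, if_pos h0, if_pos h1, EReal.coe_ennreal_top,
        EReal.coe_mul_top_of_pos hh, add_zero, add_zero, EReal.coe_add_top]
    · rw [hardPenalty, hardPenalty, if_neg h1, if_pos h0, add_zero, EReal.coe_add_top,
        EReal.top_add_of_ne_bot hk0]
  · have h4 : hardPenalty (marginal (Q : Measure (Path N)) (Fin.last N)) ρ₁ ≠ ⊥ := by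
      rw [hardPenalty]; split_ifs <;> simp
    rw [hardPenalty, if_neg h0, EReal.coe_add_top, EReal.top_add_of_ne_bot h4,
      EReal.top_add_of_ne_bot hk0]

end Duality

end EntropicSMOT

end

noncomputable section

namespace EntropicSMOT

/-! ### Real-valued chains with continuous positive kernels -/

section ContChain

/-- A chain on compact slices with continuous positive kernels `κ`, together with continuous
positive solutions `u` and `d` of the forward and of the backward recursion. -/
structure ContChain (N : ℕ) (X : ℕ → Set ℝ) (lam : ℕ → Measure ℝ) (κ : ℕ → ℝ → ℝ → ℝ)
    (u d : ℕ → ℝ → ℝ) : Prop where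
  compact : ∀ i ≤ N, IsCompact (X i)
  supp : ∀ i ≤ N, lam i (X i)ᶜ = 0
  cont_kernel : ∀ i < N, Continuous (Function.uncurry (κ i))
  pos_kernel : ∀ i < N, ∀ x y, 0 < κ i x y
  cont_fwd : ∀ i ≤ N, Continuous (u i)
  pos_fwd : ∀ i ≤ N, ∀ x, 0 < u i x
  cont_bwd : ∀ i ≤ N, Continuous (d i)
  pos_bwd : ∀ i ≤ N, ∀ x, 0 < d i x
  fwd : ∀ i < N, ∀ y, u (i + 1) y = ∫ x, u i x * κ i x y ∂lam i
  bwd : ∀ i < N, ∀ x, d i x = ∫ y, κ i x y * d (i + 1) y ∂lam (i + 1)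

/-- The extended nonnegative version of a family of functions. -/
def toENNReal (u : ℕ → ℝ → ℝ) (i : ℕ) (x : ℝ) : ℝ≥0∞ := ENNReal.ofReal (u i x)

/-- The extended nonnegative version of a family of kernels. -/
def kernelToENNReal (κ : ℕ → ℝ → ℝ → ℝ) (i : ℕ) (x y : ℝ) : ℝ≥0∞ := ENNReal.ofReal (κ i x y)

variable {N : ℕ} {X : ℕ → Set ℝ} {lam : ℕ → Measure ℝ} {κ k : ℕ → ℝ → ℝ → ℝ} {u d : ℕ → ℝ → ℝ}

/-- The path measure of a chain. -/
def realChainMeasure (N : ℕ) (lam : ℕ → Measure ℝ) (κ : ℕ → ℝ → ℝ → ℝ) (u d : ℕ → ℝ → ℝ) :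
    Measure (Path N) :=
  chainMeasure N lam (toENNReal u 0) (kernelToENNReal κ) (toENNReal d N)

lemma measurable_kernelToENNReal (hκ : ∀ i < N, Continuous (Function.uncurry (κ i))) :
    ∀ i < N, Measurable (Function.uncurry (kernelToENNReal κ i)) :=
  fun i hi => (hκ i hi).measurable.ennreal_ofReal

lemma measurable_toENNReal (hu : ∀ i ≤ N, Continuous (u i)) :
    ∀ i ≤ N, Measurable (toENNReal u i) :=
  fun i hi => (hu i hi).measurable.ennreal_ofReal

lemma toENNReal_ne_zero {i : ℕ} {x : ℝ} (hu : 0 < u i x) : toENNReal u i x ≠ 0 := by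
  simpa [toENNReal] using hu

lemma toENNReal_ne_top {i : ℕ} {x : ℝ} : toENNReal u i x ≠ ∞ := ENNReal.ofReal_ne_top

lemma ContChain.isForward (hc : ContChain N X lam κ u d) [∀ i, IsFiniteMeasure (lam i)] :
    IsForward N lam (kernelToENNReal κ) (toENNReal u) := by
  intro i hi y
  have hcont : Continuous fun x => u i x * κ i x y :=
    (hc.cont_fwd i hi.le).mul
      ((hc.cont_kernel i hi).comp (continuous_id.prodMk continuous_const))
  simp only [toENNReal, kernelToENNReal]
  rw [hc.fwd i hi y, ofReal_integral_eq_lintegral_ofReal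
    (integrable_of_continuous_of_compact (hc.compact i hi.le) (hc.supp i hi.le) hcont)
    (Eventually.of_forall fun x => (mul_pos (hc.pos_fwd i hi.le x) (hc.pos_kernel i hi x y)).le)]
  exact lintegral_congr fun x => ENNReal.ofReal_mul (hc.pos_fwd i hi.le x).le

lemma ContChain.isBackward (hc : ContChain N X lam κ u d) [∀ i, IsFiniteMeasure (lam i)] :
    IsBackward N lam (kernelToENNReal κ) (toENNReal d) := by
  intro i hi x
  have hcont : Continuous fun y => κ i x y * d (i + 1) y :=
    ((hc.cont_kernel i hi).comp (continuous_const.prodMk continuous_id)).mul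
      (hc.cont_bwd (i + 1) hi)
  simp only [toENNReal, kernelToENNReal]
  rw [hc.bwd i hi x, ofReal_integral_eq_lintegral_ofReal
    (integrable_of_continuous_of_compact (hc.compact (i + 1) hi) (hc.supp (i + 1) hi) hcont)
    (Eventually.of_forall fun y =>
      (mul_pos (hc.pos_kernel i hi x y) (hc.pos_bwd (i + 1) hi y)).le)]
  exact lintegral_congr fun y => ENNReal.ofReal_mul (hc.pos_kernel i hi x y).le

lemma ContChain.marginal_eq (hc : ContChain N X lam κ u d) [∀ i, IsFiniteMeasure (lam i)]
    (i : Fin (N + 1)) :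
    marginal (realChainMeasure N lam κ u d) i
      = (lam i).withDensity fun x => ENNReal.ofReal (u i x * d i x) := by
  rw [realChainMeasure, marginal_chainMeasure (measurable_kernelToENNReal hc.cont_kernel)
    (measurable_toENNReal hc.cont_fwd) hc.isForward (measurable_toENNReal hc.cont_bwd)
    hc.isBackward]
  congr 1
  ext x
  exact (ENNReal.ofReal_mul (hc.pos_fwd i (by omega) x).le).symm

lemma ContChain.twoMarginal_eq (hc : ContChain N X lam κ u d) [∀ i, IsFiniteMeasure (lam i)]
    (i : Fin N) :
    twoMarginal (realChainMeasure N lam κ u d) i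
      = ((lam i).prod (lam (i + 1))).withDensity fun z =>
          ENNReal.ofReal (u i z.1 * κ i z.1 z.2 * d (i + 1) z.2) := by
  rw [realChainMeasure, twoMarginal_chainMeasure (measurable_kernelToENNReal hc.cont_kernel)
    (measurable_toENNReal hc.cont_fwd) hc.isForward (measurable_toENNReal hc.cont_bwd)
    hc.isBackward]
  congr 1
  ext z
  have h1 := (hc.pos_fwd i (by omega) z.1).le
  have h2 := (hc.pos_kernel i i.2 z.1 z.2).le
  rw [ENNReal.ofReal_mul (mul_nonneg h1 h2), ENNReal.ofReal_mul h1]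
  rfl

/-- The mean of a continuous function under the transition kernel of a chain. -/
lemma ContChain.integral_transition (hc : ContChain N X lam κ u d) [∀ i, IsFiniteMeasure (lam i)]
    {P : ProbabilityMeasure (Path N)}
    (hP : (P : Measure (Path N)) = realChainMeasure N lam κ u d) (i : Fin N) (f : ℝ → ℝ → ℝ) :
    ∀ᵐ x ∂marginal (P : Measure (Path N)) i.castSucc,
      ∫ y, f x y ∂transition P i x
        = (∫ y, f x y * (κ i x y * d (i + 1) y) ∂lam (i + 1)) / d i x := by
  have hκ := measurable_kernelToENNReal hc.cont_kernel
  have hd := measurable_toENNReal hc.cont_bwd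
  filter_upwards [transition_chainMeasure (measurable_toENNReal hc.cont_fwd 0 (Nat.zero_le _)) hκ hd
    hc.isBackward (fun i hi x => toENNReal_ne_zero (hc.pos_bwd i hi.le x))
    (fun i hi x => toENNReal_ne_top) hP i] with x hx
  have hm : Measurable fun y => kernelToENNReal κ i x y * toENNReal d (i + 1) y / toENNReal d i x :=
    (((hκ i i.2).comp measurable_prodMk_left).mul (hd (i + 1) i.2)).div_const _
  rw [hx, integral_withDensity_eq_integral_toReal_smul hm]
  · rw [← integral_div]
    refine integral_congr_ae (Eventually.of_forall fun y => ?_)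
    simp only [toENNReal, kernelToENNReal, smul_eq_mul, ENNReal.toReal_div, ENNReal.toReal_mul,
      ENNReal.toReal_ofReal (hc.pos_kernel i i.2 x y).le,
      ENNReal.toReal_ofReal (hc.pos_bwd (i + 1) i.2 y).le,
      ENNReal.toReal_ofReal (hc.pos_bwd i i.2.le x).le]
    ring
  · refine Eventually.of_forall fun y => ENNReal.div_lt_top ?_ ?_
    · exact ENNReal.mul_ne_top ENNReal.ofReal_ne_top ENNReal.ofReal_ne_top
    · exact toENNReal_ne_zero (hc.pos_bwd i i.2.le x)

lemma measurable_prod_kernel (hk : ∀ i < N, Continuous (Function.uncurry (k i))) :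
    Measurable fun ω : Path N => ∏ i : Fin N, k i (ω i.castSucc) (ω i.succ) :=
  Finset.measurable_prod _ fun j _ =>
    Measurable.comp (g := Function.uncurry (k j)) (f := fun ω : Path N => (ω j.castSucc, ω j.succ))
      (hk j j.2).measurable ((measurable_pi_apply j.castSucc).prodMk (measurable_pi_apply j.succ))

/-- The path measure of a chain as a change of measure of the reference measure. -/
lemma realChainMeasure_eq_withDensity_refMeasure
    (hk : ∀ i < N, Continuous (Function.uncurry (k i)))
    (hk0 : ∀ i < N, ∀ x y, 0 < k i x y) (hκ0 : ∀ i < N, ∀ x y, 0 < κ i x y)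
    (hu0 : ∀ x, 0 < u 0 x) {f : Path N → ℝ} (hf : Measurable f)
    (hfk : ∀ ω : Path N, u 0 (ω 0) * (∏ i : Fin N, κ i (ω i.castSucc) (ω i.succ))
        * d N (ω (Fin.last N))
      = (∏ i : Fin N, k i (ω i.castSucc) (ω i.succ)) * f ω) :
    realChainMeasure N lam κ u d
      = (refMeasure N lam k).withDensity fun ω => ENNReal.ofReal (f ω) := by
  rw [refMeasure, ← withDensity_mul _ (measurable_prod_kernel hk).ennreal_ofReal
    hf.ennreal_ofReal, realChainMeasure, chainMeasure]
  congr 1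
  ext ω
  have h1 : 0 ≤ ∏ i : Fin N, k i (ω i.castSucc) (ω i.succ) :=
    Finset.prod_nonneg fun i _ => (hk0 i i.2 _ _).le
  have h2 : 0 ≤ ∏ i : Fin N, κ i (ω i.castSucc) (ω i.succ) :=
    Finset.prod_nonneg fun i _ => (hκ0 i i.2 _ _).le
  rw [Pi.mul_apply, ← ENNReal.ofReal_mul h1, ← hfk,
    ENNReal.ofReal_mul (mul_nonneg (hu0 _).le h2), ENNReal.ofReal_mul (hu0 _).le,
    ENNReal.ofReal_prod_of_nonneg fun (i : Fin N) _ => (hκ0 i i.2 _ _).le]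
  rfl

lemma ae_pi_mem_pathSpace [∀ i, SigmaFinite (lam i)] (hs : ∀ i ≤ N, lam i (X i)ᶜ = 0) :
    ∀ᵐ ω ∂Measure.pi fun i : Fin (N + 1) => lam i, ω ∈ pathSpace N X := by
  refine ae_all_iff.2 fun i => ?_
  have h1 : ∀ᵐ x ∂lam i, x ∈ X i := mem_ae_iff.2 (hs i (by omega))
  exact (Measure.tendsto_eval_ae_ae (μ := fun i : Fin (N + 1) => lam i) (i := i)).eventually h1

lemma refMeasure_compl_eq_zero [∀ i, SigmaFinite (lam i)] (hs : ∀ i ≤ N, lam i (X i)ᶜ = 0) :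
    refMeasure N lam k (pathSpace N X)ᶜ = 0 :=
  withDensity_absolutelyContinuous _ _ (mem_ae_iff.1 (ae_pi_mem_pathSpace hs))

lemma continuous_prod_kernel (hk : ∀ i < N, Continuous (Function.uncurry (k i))) :
    Continuous fun ω : Path N => ∏ i : Fin N, k i (ω i.castSucc) (ω i.succ) :=
  continuous_finsetProd _ fun j _ => Continuous.comp (g := Function.uncurry (k j))
    (f := fun ω : Path N => (ω j.castSucc, ω j.succ)) (hk j j.2)
    ((continuous_apply j.castSucc).prodMk (continuous_apply j.succ))

lemma isFiniteMeasure_refMeasure [∀ i, IsFiniteMeasure (lam i)] (hX : ∀ i ≤ N, IsCompact (X i))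
    (hs : ∀ i ≤ N, lam i (X i)ᶜ = 0) (hk : ∀ i < N, Continuous (Function.uncurry (k i))) :
    IsFiniteMeasure (refMeasure N lam k) :=
  isFiniteMeasure_withDensity_ofReal
    (integrable_of_continuous_of_compact (isCompact_pathSpace hX)
      (mem_ae_iff.1 (ae_pi_mem_pathSpace hs)) (continuous_prod_kernel hk)).2

end ContChain

/-! ### The optimal path measure and its potentials -/

section Optimizer

variable {n N : ℕ} {h : ℝ} {F : ℝ → ℝ} {X : ℕ → Set ℝ} {lam : ℕ → Measure ℝ}
  {k : ℕ → ℝ → ℝ → ℝ} {D l : ℕ → ℝ → ℝ}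

/-- Once the optimal slopes are inserted in the kernels, the nonlinear recursion becomes an ordinary
backward recursion. The initial weight `1 / D 0` makes the initial density equal to `1`. -/
lemma OptBackward.contChain [∀ i, IsFiniteMeasure (lam i)] (hc : RegularChain N h F X lam k)
    (hD : OptBackward N h F lam k D l) :
    ContChain N X lam (fun i x y => tilt F h x (l i x) y * k i x y)
      (forwardDensity F h lam k l fun x => (D 0 x)⁻¹) D := by
  have hu : Continuous fun x => (D 0 x)⁻¹ :=
    (hD.cont 0 (Nat.zero_le _)).inv₀ fun x => (hD.pos 0 (Nat.zero_le _) x).ne'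
  have hu0 : ∀ x, 0 < (D 0 x)⁻¹ := fun x => inv_pos.2 (hD.pos 0 (Nat.zero_le _) x)
  exact
  { compact := hc.compact
    supp := hc.supp
    cont_kernel := fun i hi => hc.continuous_tilted_kernel hi (hD.cont_slope i hi)
    pos_kernel := fun i hi x y => mul_pos (tilt_pos _ _ _ _ _) (hc.pos i hi x y)
    cont_fwd := hc.continuous_forwardDensity hD.cont_slope hu
    pos_fwd := hc.forwardDensity_pos hD.cont_slope hu hu0
    cont_bwd := hD.cont
    pos_bwd := hD.pos
    fwd := fun i hi y => rfl
    bwd := fun i hi x => by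
      rw [hD.eq i hi x, tiltedMass]
      simp only [mul_assoc] }

/-- The potentials associated with a solution of the dynamic programming recursion. -/
def optPotentials (N : ℕ) (h : ℝ) (F : ℝ → ℝ) (D l : ℕ → ℝ → ℝ) : Potentials where
  -- The conjugate at time `0`, which `delta` omits, is supplied here.
  init x := h * conj F (l 0 x) - h * Real.log (D 0 x)
  drift i x := if i < N then -h * l i x else 0
  final x := h * Real.log (D N x)

lemma OptBackward.cont_optPotentials (hc : RegularChain (n + 1) h F X lam k)
    (hD : OptBackward (n + 1) h F lam k D l) : (optPotentials (n + 1) h F D l).Cont where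
  init := (continuous_const.mul ((continuous_conj hc.convex hc.coercive).comp
      (hD.cont_slope 0 (by omega)))).sub (continuous_const.mul
      ((hD.cont 0 (by omega)).log fun x => (hD.pos 0 (by omega) x).ne'))
  drift i := by
    by_cases hi : i < n + 1
    · simpa only [optPotentials, hi, if_true] using (hD.cont_slope i hi).const_mul (-h)
    · simpa only [optPotentials, hi, if_false] using continuous_const
  final := continuous_const.mul ((hD.cont _ le_rfl).log fun x => (hD.pos _ le_rfl x).ne')

lemma neg_inv_mul_optPotentials_drift (hh : h ≠ 0) {i : ℕ} (hi : i < N) (x : ℝ) :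
    -(1 / h) * (optPotentials N h F D l).drift i x = l i x := by
  simp only [optPotentials, hi, if_true]
  field_simp

lemma exp_delta_optPotentials (hh : h ≠ 0) (hD0 : ∀ x, 0 < D 0 x) (hDN : ∀ x, 0 < D (n + 1) x)
    (ω : Path (n + 1)) :
    (D 0 (ω 0))⁻¹ * (∏ i : Fin (n + 1), tilt F h (ω i.castSucc) (l i (ω i.castSucc)) (ω i.succ))
        * D (n + 1) (ω (Fin.last (n + 1)))
      = Real.exp (1 / h * delta (n + 1) h F (optPotentials (n + 1) h F D l) ω) := by
  have hl : ∀ i : Fin (n + 1), -(1 / h) * (optPotentials (n + 1) h F D l).drift i (ω i.castSucc)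
      = l i (ω i.castSucc) := fun i => neg_inv_mul_optPotentials_drift hh i.2 _
  have hl' : ∀ i : Fin (n + 1), (optPotentials (n + 1) h F D l).drift i (ω i.castSucc)
      = -h * l i (ω i.castSucc) := fun i => by simp only [optPotentials, i.2, if_true]
  have hsum : (∑ i : Fin (n + 1), (conj F (l i (ω i.castSucc))
        - l i (ω i.castSucc) * ((ω i.succ - ω i.castSucc) / h)))
      = conj F (l 0 (ω 0)) + ∑ i : Fin (n + 1), 1 / h * ((if (i : ℕ) = 0 then 0
          else h * conj F (l i (ω i.castSucc)))
          + 1 / h * (ω i.succ - ω i.castSucc) * (-h * l i (ω i.castSucc))) := by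
    rw [Fin.sum_univ_succ, Fin.sum_univ_succ, ← add_assoc]
    congr 1
    · simp only [Fin.val_zero, if_true, Fin.castSucc_zero]
      field_simp
      ring
    · refine Finset.sum_congr rfl fun i _ => ?_
      simp only [Fin.val_succ, Nat.succ_ne_zero, if_false]
      field_simp
      ring
  have hexp : 1 / h * delta (n + 1) h F (optPotentials (n + 1) h F D l) ω
      = -Real.log (D 0 (ω 0)) + (∑ i : Fin (n + 1), (conj F (l i (ω i.castSucc))
        - l i (ω i.castSucc) * ((ω i.succ - ω i.castSucc) / h)))
        + Real.log (D (n + 1) (ω (Fin.last (n + 1)))) := by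
    rw [hsum, delta, Finset.sum_congr rfl fun i _ => by rw [hl i, hl' i], ← Finset.mul_sum]
    simp only [optPotentials]
    field_simp
    ring
  rw [hexp, Real.exp_add, Real.exp_add, Real.exp_neg, Real.exp_log (hD0 _), Real.exp_log (hDN _),
    Real.exp_sum]
  rfl

/-- A fitted solution of the dynamic programming recursion gives a Markovian path measure with
the prescribed marginals, of exponential form, and without Fenchel gap. -/
theorem OptBackward.exists_path_measure [∀ i, IsFiniteMeasure (lam i)]
    (hc : RegularChain (n + 1) h F X lam k)
    [IsProbabilityMeasure (lam 0)] (hD : OptBackward (n + 1) h F lam k D l) {r : ℝ → ℝ}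
    (hfit : ∀ᵐ y ∂lam (n + 1),
      forwardDensity F h lam k l (fun x => (D 0 x)⁻¹) (n + 1) y * D (n + 1) y = r y) :
    ∃ (P : ProbabilityMeasure (Path (n + 1))) (Φ : Potentials), Φ.Cont ∧
      (P : Measure (Path (n + 1))) (pathSpace (n + 1) X)ᶜ = 0 ∧
      marginal (P : Measure (Path (n + 1))) 0 = lam 0 ∧
      marginal (P : Measure (Path (n + 1))) (Fin.last (n + 1))
        = (lam (n + 1)).withDensity (fun y => ENNReal.ofReal (r y)) ∧
      (P : Measure (Path (n + 1))) = gibbs (n + 1) h F Φ (refMeasure (n + 1) lam k) ∧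
      (∀ i : Fin (n + 1), ∀ᵐ x ∂marginal (P : Measure (Path (n + 1))) i.castSucc,
        F (drift h P i x) + conj F (-(1 / h) * Φ.drift i x)
          - -(1 / h) * Φ.drift i x * drift h P i x = 0) ∧
      IsMarkov P ∧
      (∀ i : Fin (n + 1), ∀ᵐ x ∂marginal (P : Measure (Path (n + 1))) i.castSucc,
        transition P i x = (lam (i + 1)).withDensity (transitionDensity lam P i x)) ∧
      (P : Measure (Path (n + 1)))
        = (Measure.pi fun i : Fin (n + 1 + 1) => lam i).withDensity
            (fun ω => ∏ i : Fin (n + 1), transitionDensity lam P i (ω i.castSucc) (ω i.succ)) := by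
  have hcc := hD.contChain hc
  set κ : ℕ → ℝ → ℝ → ℝ := fun i x y => tilt F h x (l i x) y * k i x y with hκ
  set u := forwardDensity F h lam k l fun x => (D 0 x)⁻¹ with hu
  have hu0 : u 0 = fun x => (D 0 x)⁻¹ := rfl
  have hD0 := hD.pos 0 (Nat.zero_le _)
  have hm0 : marginal (realChainMeasure (n + 1) lam κ u D) 0 = lam 0 := by
    rw [hcc.marginal_eq 0]
    have : (fun x => ENNReal.ofReal (u ((0 : Fin (n + 1 + 1)) : ℕ) x
        * D ((0 : Fin (n + 1 + 1)) : ℕ) x)) = 1 := by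
      ext x
      simp [hu0, (hD0 x).ne']
    rw [this, withDensity_one]
    rfl
  have hprob : IsProbabilityMeasure (realChainMeasure (n + 1) lam κ u D) := by
    constructor
    have h1 : marginal (realChainMeasure (n + 1) lam κ u D) 0 univ = 1 := by
      rw [hm0]; exact measure_univ
    rwa [marginal, Measure.map_apply (measurable_pi_apply _) MeasurableSet.univ,
      preimage_univ] at h1
  let P : ProbabilityMeasure (Path (n + 1)) := ⟨realChainMeasure (n + 1) lam κ u D, hprob⟩
  have hP : (P : Measure (Path (n + 1))) = realChainMeasure (n + 1) lam κ u D := rfl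
  have hΦ := hD.cont_optPotentials hc
  have hh := hc.hpos.ne'
  have hκm := measurable_kernelToENNReal hcc.cont_kernel
  have hum := measurable_toENNReal hcc.cont_fwd
  have hDm := measurable_toENNReal hcc.cont_bwd
  have hgibbs : (P : Measure (Path (n + 1)))
      = gibbs (n + 1) h F (optPotentials (n + 1) h F D l) (refMeasure (n + 1) lam k) := by
    refine realChainMeasure_eq_withDensity_refMeasure hc.cont hc.pos hcc.pos_kernel
      (hcc.pos_fwd 0 (Nat.zero_le _)) (continuous_const.mul
        (hΦ.continuous_delta hc.convex hc.coercive)).rexp.measurable fun ω => ?_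
    rw [← exp_delta_optPotentials hh hD0 (hD.pos _ le_rfl), hu0, Finset.prod_mul_distrib]
    ring
  refine ⟨P, optPotentials (n + 1) h F D l, hΦ, ?_, hm0, ?_, hgibbs, ?_, ?_, ?_, ?_⟩
  · exact withDensity_absolutelyContinuous _ _ (mem_ae_iff.1 (ae_pi_mem_pathSpace hc.supp))
  · rw [hP, hcc.marginal_eq]
    refine withDensity_congr_ae ?_
    filter_upwards [hfit] with y hy
    rw [← hy]
    rfl
  · intro i
    filter_upwards [hcc.integral_transition hP i fun x y => y - x] with x hx
    rw [neg_inv_mul_optPotentials_drift hh i.2]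
    -- First-order optimality of the slope; as the drift is the mean displacement under the tilted
    -- kernel, it yields equality in Fenchel's inequality.
    have hb := subgradient_of_minimizer (h := h) (ν := lam (i + 1)) hc.convex hc.coercive
      (hc.compact (i + 1) i.2) (hc.supp (i + 1) i.2) (hc.ne_zero i.2)
      (hc.continuous_kernel_mul i.2 (hD.cont (i + 1) i.2))
      (fun x y => mul_pos (hc.pos i i.2 x y) (hD.pos (i + 1) i.2 y)) (x := x) (l := l i x)
      (fun l' => (hD.eq i i.2 x).symm.le.trans (hD.le i i.2 x l'))
    have hdr : drift h P i x = (∫ y, (y - x) / h * (tilt F h x (l i x) y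
        * (k i x y * D (i + 1) y)) ∂lam (i + 1))
        / tiltedMass F h (lam (i + 1)) (fun x y => k i x y * D (i + 1) y) x (l i x) := by
      rw [drift, hx, ← hD.eq i i.2 x, ← mul_div_assoc, ← integral_const_mul]
      congr 1
      refine integral_congr_ae (Eventually.of_forall fun y => ?_)
      simp only [hκ]
      ring
    rw [hdr, add_conj_eq_of_subgradient hc.convex hc.coercive hb, sub_self]
  · exact isMarkov_chainMeasure (hum 0 (Nat.zero_le _)) hκm hDm hcc.isBackward
      (fun i hi x => toENNReal_ne_zero (hcc.pos_bwd i hi.le x)) (fun i hi x => toENNReal_ne_top) hP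
  · exact transition_eq_withDensity_transitionDensity hκm hum hcc.isForward hDm hcc.isBackward
      (fun i hi x => toENNReal_ne_zero (hcc.pos_fwd i hi.le x)) (fun i hi x => toENNReal_ne_top)
      (fun i hi x => toENNReal_ne_zero (hcc.pos_bwd i hi.le x)) (fun i hi x => toENNReal_ne_top) hP
  · refine eq_withDensity_prod_transitionDensity hκm hum hcc.isForward hDm hcc.isBackward
      (fun i hi x => toENNReal_ne_zero (hcc.pos_fwd i hi.le x)) (fun i hi x => toENNReal_ne_top)
      (fun i hi x => toENNReal_ne_zero (hcc.pos_bwd i hi x)) (fun i hi x => toENNReal_ne_top)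
      (fun i hi x y => ?_) (Nat.succ_pos n) (Eventually.of_forall fun x => ?_)
    · simpa [kernelToENNReal] using hcc.pos_kernel i hi x y
    · simp only [toENNReal, hu0]
      rw [← ENNReal.ofReal_mul (inv_pos.2 (hD0 x)).le, inv_mul_cancel₀ (hD0 x).ne',
        ENNReal.ofReal_one]

end Optimizer

end EntropicSMOT

end

noncomputable section

namespace EntropicSMOT

/-! ### The upward and downward recursions for arbitrary potentials -/

section Recursions

variable {N : ℕ} {h : ℝ} {F G : ℝ → ℝ} {X : ℕ → Set ℝ} {lam : ℕ → Measure ℝ}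
  {k k' : ℕ → ℝ → ℝ → ℝ} {Φ Φ' : Potentials} {U U' D D' : ℕ → ℝ → ℝ}

/-- The solution of the upward recursion. -/
def upward (h : ℝ) (G : ℝ → ℝ) (lam : ℕ → Measure ℝ) (k : ℕ → ℝ → ℝ → ℝ) (Φ : Potentials) :
    ℕ → ℝ → ℝ
  | 0 => fun x => Real.exp (1 / h * Φ.init x)
  | i + 1 => fun y => Real.exp (G (-(1 / h) * Φ.drift (i + 1) y)) *
      ∫ x, upward h G lam k Φ i x * Real.exp (1 / h ^ 2 * (y - x) * Φ.drift i x) * k i x y ∂lam i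

lemma isUpward_upward : IsUpward N h G lam k Φ (upward h G lam k Φ) :=
  ⟨fun _ => rfl, fun _ _ _ => rfl⟩

variable (N h G lam k Φ) in
lemma exists_isDownward : ∃ D, IsDownward N h G lam k Φ D := by
  obtain ⟨D, hD, hD'⟩ := exists_downward_seq N (fun x => Real.exp (1 / h * Φ.final x))
    (fun i b a => ∀ x, b x = Real.exp (G (-(1 / h) * Φ.drift i x)) *
      ∫ y, k i x y * Real.exp (1 / h ^ 2 * (y - x) * Φ.drift i x) * a y ∂lam (i + 1))
    fun i _ a => ⟨_, fun x => rfl⟩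
  exact ⟨D, fun x => by rw [hD], fun i _ hi => hD' i hi⟩

/-- The two vectors of potentials agree on the slices. -/
structure Potentials.EqOn (N : ℕ) (X : ℕ → Set ℝ) (Φ Φ' : Potentials) : Prop where
  init : Set.EqOn Φ.init Φ'.init (X 0)
  drift : ∀ i < N, Set.EqOn (Φ.drift i) (Φ'.drift i) (X i)
  final : Set.EqOn Φ.final Φ'.final (X N)

lemma IsUpward.eqOn (hs : ∀ i ≤ N, lam i (X i)ᶜ = 0) (hΦ : Potentials.EqOn N X Φ Φ')
    (hk : ∀ i < N, ∀ x ∈ X i, ∀ y, k i x y = k' i x y)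
    (hU : IsUpward N h G lam k Φ U) (hU' : IsUpward N h G lam k' Φ' U') :
    ∀ i < N, EqOn (U i) (U' i) (X i) := by
  intro i
  induction i with
  | zero => intro _ x hx; rw [hU.1, hU'.1, hΦ.init hx]
  | succ i ih =>
    intro hi y hy
    rw [hU.2 i hi, hU'.2 i hi, hΦ.drift (i + 1) hi hy]
    congr 1
    have hae : ∀ᵐ x ∂lam i, x ∈ X i := mem_ae_iff.2 (hs i (by omega))
    refine integral_congr_ae ?_
    filter_upwards [hae] with x hx
    rw [ih (by omega) hx, hΦ.drift i (by omega) hx, hk i (by omega) x hx]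

/-- Induction on the number `j` of steps from the end. It stops at `i = 1`, since the recursion
leaves `D 0` unspecified. -/
lemma IsDownward.eqOn (hs : ∀ i ≤ N, lam i (X i)ᶜ = 0) (hΦ : Potentials.EqOn N X Φ Φ')
    (hk : ∀ i < N, ∀ x ∈ X i, ∀ y, k i x y = k' i x y)
    (hD : IsDownward N h G lam k Φ D) (hD' : IsDownward N h G lam k' Φ' D') :
    ∀ j i, i + j = N → 1 ≤ i → EqOn (D i) (D' i) (X i) := by
  intro j
  induction j with
  | zero =>
    intro i hi _ x hx
    obtain rfl : i = N := by omega
    rw [hD.1, hD'.1, hΦ.final hx]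
  | succ j ih =>
    intro i hi h1 x hx
    have hiN : i < N := by omega
    rw [hD.2 i h1 hiN, hD'.2 i h1 hiN, hΦ.drift i hiN hx]
    congr 1
    have hae : ∀ᵐ y ∂lam (i + 1), y ∈ X (i + 1) := mem_ae_iff.2 (hs (i + 1) (by omega))
    refine integral_congr_ae ?_
    filter_upwards [hae] with y hy
    rw [ih (i + 1) (by omega) (by omega) hy, hk i hiN x hx]

/-- The factor of the kernel that depends on the present position only. -/
def stepFactor (h : ℝ) (G : ℝ → ℝ) (Φ : Potentials) (i : ℕ) (x : ℝ) : ℝ :=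
  if i = 0 then 1 else Real.exp (G (-(1 / h) * Φ.drift i x))

/-- The kernel of the chain with the potentials `Φ`. -/
def stepWeight (h : ℝ) (G : ℝ → ℝ) (k : ℕ → ℝ → ℝ → ℝ) (Φ : Potentials) (i : ℕ) (x y : ℝ) : ℝ :=
  stepFactor h G Φ i x * (Real.exp (1 / h ^ 2 * (y - x) * Φ.drift i x) * k i x y)

/-- The forward densities belonging to a solution of the upward recursion. -/
def rawUpward (h : ℝ) (lam : ℕ → Measure ℝ) (k : ℕ → ℝ → ℝ → ℝ) (Φ : Potentials)
    (U : ℕ → ℝ → ℝ) : ℕ → ℝ → ℝ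
  | 0 => U 0
  | i + 1 => fun y =>
      ∫ x, U i x * Real.exp (1 / h ^ 2 * (y - x) * Φ.drift i x) * k i x y ∂lam i

/-- The backward densities belonging to a solution of the downward recursion. -/
def rawDownward (h : ℝ) (lam : ℕ → Measure ℝ) (k : ℕ → ℝ → ℝ → ℝ) (Φ : Potentials)
    (D : ℕ → ℝ → ℝ) : ℕ → ℝ → ℝ
  | 0 => fun x => ∫ y, k 0 x y * Real.exp (1 / h ^ 2 * (y - x) * Φ.drift 0 x) * D 1 y ∂lam 1
  | i + 1 => D (i + 1)

lemma stepFactor_pos (h : ℝ) (G : ℝ → ℝ) (Φ : Potentials) (i : ℕ) (x : ℝ) :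
    0 < stepFactor h G Φ i x := by
  rw [stepFactor]; split_ifs <;> positivity

/-- Both `U i` and `D i` contain the factor `exp (G ..)` at their own time, while a path density
contains it once. It is assigned to the kernel, so the forward solution of the chain is `U i` with
the factor removed. -/
lemma IsUpward.eq_stepFactor_mul (hU : IsUpward N h G lam k Φ U) {i : ℕ} (hi : i < N) (x : ℝ) :
    U i x = stepFactor h G Φ i x * rawUpward h lam k Φ U i x := by
  cases i with
  | zero => simp [stepFactor, rawUpward]
  | succ i => rw [hU.2 i hi]; simp [stepFactor, rawUpward]

lemma continuous_stepFactor (hG : Continuous G) (hΦ : Φ.Cont) (i : ℕ) :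
    Continuous (stepFactor h G Φ i) := by
  unfold stepFactor
  split_ifs
  · exact continuous_const
  · exact (hG.comp (continuous_const.mul (hΦ.drift i))).rexp

lemma continuous_exp_increment (hΦ : Φ.Cont) (i : ℕ) : Continuous (Function.uncurry fun x y : ℝ =>
    Real.exp (1 / h ^ 2 * (y - x) * Φ.drift i x)) :=
  ((continuous_const.mul (continuous_snd.sub continuous_fst)).mul
    ((hΦ.drift i).comp continuous_fst)).rexp

variable [∀ i, IsFiniteMeasure (lam i)]

lemma IsUpward.continuous_pos_rawUpward (hc : RegularChain N h F X lam k) (hG : Continuous G)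
    (hΦ : Φ.Cont) (hU : IsUpward N h G lam k Φ U) :
    ∀ i ≤ N, Continuous (rawUpward h lam k Φ U i) ∧ ∀ x, 0 < rawUpward h lam k Φ U i x := by
  intro i
  induction i with
  | zero =>
    intro _
    have : U 0 = fun x => Real.exp (1 / h * Φ.init x) := funext hU.1
    simp only [rawUpward, this]
    exact ⟨(continuous_const.mul hΦ.init).rexp, fun x => Real.exp_pos _⟩
  | succ i ih =>
    intro hi
    obtain ⟨h1, h2⟩ := ih (by omega)
    have hUi : U i = fun x => stepFactor h G Φ i x * rawUpward h lam k Φ U i x :=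
      funext (hU.eq_stepFactor_mul (by omega))
    have hUc : Continuous (U i) := by
      rw [hUi]; exact (continuous_stepFactor hG hΦ i).mul h1
    have hUp : ∀ x, 0 < U i x := fun x => by
      rw [hUi]; exact mul_pos (stepFactor_pos _ _ _ _ _) (h2 x)
    have hcont : Continuous (Function.uncurry fun y x : ℝ =>
        U i x * Real.exp (1 / h ^ 2 * (y - x) * Φ.drift i x) * k i x y) :=
      ((hUc.comp continuous_snd).mul ((continuous_exp_increment hΦ i).comp continuous_swap)).mul
        ((hc.cont i hi).comp continuous_swap)
    refine ⟨continuous_integral_of_compact (hc.compact i (by omega)) (hc.supp i (by omega)) hcont,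
      fun y => integral_pos_of_continuous (hc.compact i (by omega)) (hc.supp i (by omega))
        (hc.ne_zero (by omega)) (hcont.comp (continuous_const.prodMk continuous_id)) fun x =>
        mul_pos (mul_pos (hUp x) (Real.exp_pos _)) (hc.pos i hi x y)⟩

lemma IsDownward.continuous_pos_step (hc : RegularChain N h F X lam k) (hΦ : Φ.Cont) {i : ℕ}
    (hi : i < N) {f : ℝ → ℝ} (hf : Continuous f) (hf0 : ∀ y, 0 < f y) :
    (Continuous fun x => ∫ y, k i x y * Real.exp (1 / h ^ 2 * (y - x) * Φ.drift i x) * f y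
      ∂lam (i + 1)) ∧
    ∀ x, 0 < ∫ y, k i x y * Real.exp (1 / h ^ 2 * (y - x) * Φ.drift i x) * f y ∂lam (i + 1) := by
  have hcont : Continuous (Function.uncurry fun x y : ℝ =>
      k i x y * Real.exp (1 / h ^ 2 * (y - x) * Φ.drift i x) * f y) :=
    ((hc.cont i hi).mul (continuous_exp_increment hΦ i)).mul (hf.comp continuous_snd)
  exact ⟨continuous_integral_of_compact (hc.compact (i + 1) hi) (hc.supp (i + 1) hi) hcont,
    fun x => integral_pos_of_continuous (hc.compact (i + 1) hi) (hc.supp (i + 1) hi)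
      (hc.ne_zero hi) (hcont.comp (continuous_const.prodMk continuous_id)) fun y =>
      mul_pos (mul_pos (hc.pos i hi x y) (Real.exp_pos _)) (hf0 y)⟩

lemma IsDownward.continuous_pos (hc : RegularChain N h F X lam k) (hG : Continuous G)
    (hΦ : Φ.Cont) (hD : IsDownward N h G lam k Φ D) :
    ∀ j i, i + j = N → 1 ≤ i → Continuous (D i) ∧ ∀ x, 0 < D i x := by
  intro j
  induction j with
  | zero =>
    intro i hi _
    obtain rfl : i = N := by omega
    have : D i = fun x => Real.exp (1 / h * Φ.final x) := funext hD.1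
    rw [this]
    exact ⟨(continuous_const.mul hΦ.final).rexp, fun x => Real.exp_pos _⟩
  | succ j ih =>
    intro i hi h1
    obtain ⟨h2, h3⟩ := ih (i + 1) (by omega) (by omega)
    obtain ⟨h4, h5⟩ := continuous_pos_step hc hΦ (i := i) (by omega) h2 h3
    rw [funext (hD.2 i h1 (by omega))]
    exact ⟨(hG.comp (continuous_const.mul (hΦ.drift i))).rexp.mul h4,
      fun x => mul_pos (Real.exp_pos _) (h5 x)⟩

/-- With the factor carried by the kernel leaving time `i`, `rawUpward` and `rawDownward` solve the
plain linear recursions; at time `0` the latter supplies the value missing from the downward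
recursion. -/
lemma contChain_of_isUpward_isDownward (hN : 1 ≤ N) (hc : RegularChain N h F X lam k)
    (hG : Continuous G) (hΦ : Φ.Cont) (hU : IsUpward N h G lam k Φ U)
    (hD : IsDownward N h G lam k Φ D) :
    ContChain N X lam (stepWeight h G k Φ) (rawUpward h lam k Φ U) (rawDownward h lam k Φ D) := by
  have hDp := fun i (h1 : 1 ≤ i) (hi : i ≤ N) =>
    hD.continuous_pos hc hG hΦ (N - i) i (by omega) h1
  have hdp : ∀ i ≤ N, Continuous (rawDownward h lam k Φ D i) ∧
      ∀ x, 0 < rawDownward h lam k Φ D i x := by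
    intro i hi
    cases i with
    | zero =>
      exact IsDownward.continuous_pos_step hc hΦ (i := 0) hN (hDp 1 le_rfl hN).1
        (hDp 1 le_rfl hN).2
    | succ i => exact hDp (i + 1) (by omega) hi
  have hup := hU.continuous_pos_rawUpward hc hG hΦ
  exact
  { compact := hc.compact
    supp := hc.supp
    cont_kernel := fun i hi => ((continuous_stepFactor hG hΦ i).comp continuous_fst).mul
      ((continuous_exp_increment hΦ i).mul (hc.cont i hi))
    pos_kernel := fun i hi x y =>
      mul_pos (stepFactor_pos _ _ _ _ _) (mul_pos (Real.exp_pos _) (hc.pos i hi x y))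
    cont_fwd := fun i hi => (hup i hi).1
    pos_fwd := fun i hi => (hup i hi).2
    cont_bwd := fun i hi => (hdp i hi).1
    pos_bwd := fun i hi => (hdp i hi).2
    fwd := fun i hi y => by
      rw [rawUpward]
      refine integral_congr_ae (Eventually.of_forall fun x => ?_)
      simp only [hU.eq_stepFactor_mul hi x, stepWeight]
      ring
    bwd := fun i hi x => by
      cases i with
      | zero =>
        simp only [rawDownward, stepWeight, stepFactor, if_true]
        refine integral_congr_ae (Eventually.of_forall fun y => ?_)
        simp only
        ring
      | succ i =>
        simp only [rawDownward, stepWeight, stepFactor, Nat.succ_ne_zero, if_false]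
        rw [hD.2 (i + 1) (by omega) hi, ← integral_const_mul]
        refine integral_congr_ae (Eventually.of_forall fun y => ?_)
        simp only
        ring }

/-- The two-time marginals of a path measure that is given by an exponential of potentials. -/
lemma twoMarginal_withDensity_refMeasure (hN : 1 ≤ N) (hc : RegularChain N h F X lam k)
    (hG : Continuous G) (hΦ : Φ.Cont) (hU : IsUpward N h G lam k Φ U)
    (hD : IsDownward N h G lam k Φ D) {f : Path N → ℝ} (hf : Measurable f)
    (hfe : ∀ ω : Path N, f ω = Real.exp (1 / h * Φ.init (ω 0))
      * (∏ i : Fin N, (stepFactor h G Φ i (ω i.castSucc)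
        * Real.exp (1 / h ^ 2 * (ω i.succ - ω i.castSucc) * Φ.drift i (ω i.castSucc))))
      * Real.exp (1 / h * Φ.final (ω (Fin.last N)))) (i : Fin N) :
    twoMarginal ((refMeasure N lam k).withDensity fun ω => ENNReal.ofReal (f ω)) i
      = ((lam i).prod (lam (i + 1))).withDensity fun z => ENNReal.ofReal
          (U i z.1 * Real.exp (1 / h ^ 2 * (z.2 - z.1) * Φ.drift i z.1)
            * k i z.1 z.2 * D (i + 1) z.2) := by
  have hcc := contChain_of_isUpward_isDownward hN hc hG hΦ hU hD
  have hdN : rawDownward h lam k Φ D N = D N := by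
    obtain ⟨n, rfl⟩ : ∃ n, N = n + 1 := ⟨N - 1, by omega⟩
    rfl
  have hfk : ∀ ω : Path N, rawUpward h lam k Φ U 0 (ω 0)
        * (∏ i : Fin N, stepWeight h G k Φ i (ω i.castSucc) (ω i.succ))
        * rawDownward h lam k Φ D N (ω (Fin.last N))
      = (∏ i : Fin N, k i (ω i.castSucc) (ω i.succ)) * f ω := by
    intro ω
    rw [hdN, hD.1, rawUpward, hU.1, hfe]
    simp only [stepWeight, ← mul_assoc]
    rw [Finset.prod_mul_distrib (g := fun i : Fin N => k i (ω i.castSucc) (ω i.succ))]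
    ring
  rw [← realChainMeasure_eq_withDensity_refMeasure hc.cont hc.pos hcc.pos_kernel
    (hcc.pos_fwd 0 (Nat.zero_le _)) hf hfk, hcc.twoMarginal_eq i]
  congr 1
  ext z
  rw [hU.eq_stepFactor_mul i.2, stepWeight]
  congr 1
  simp only [rawDownward]
  ring

lemma twoMarginal_gibbs (hN : 1 ≤ N) (hc : RegularChain N h F X lam k)
    (hΦ : Φ.Cont) (hU : IsUpward N h (conj F) lam k Φ U)
    (hD : IsDownward N h (conj F) lam k Φ D) (i : Fin N) :
    twoMarginal (gibbs N h F Φ (refMeasure N lam k)) i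
      = ((lam i).prod (lam (i + 1))).withDensity fun z => ENNReal.ofReal
          (U i z.1 * Real.exp (1 / h ^ 2 * (z.2 - z.1) * Φ.drift i z.1)
            * k i z.1 z.2 * D (i + 1) z.2) := by
  refine twoMarginal_withDensity_refMeasure hN hc (continuous_conj hc.convex hc.coercive) hΦ hU hD
    (f := fun ω => Real.exp (1 / h * delta N h F Φ ω)) (continuous_const.mul (hΦ.continuous_delta hc.convex hc.coercive)).rexp.measurable
    (fun ω => ?_) i
  simp only [delta]
  rw [mul_add, mul_add, Real.exp_add, Real.exp_add, Finset.mul_sum, Real.exp_sum]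
  congr 2
  refine Finset.prod_congr rfl fun j _ => ?_
  have hh := hc.hpos.ne'
  rw [mul_add, Real.exp_add, stepFactor]
  congr 1
  · split_ifs
    · simp
    · congr 1
      field_simp
  · congr 1
    ring

/-- The case of zero potentials and `G = 0`, in which the path density relative to the reference
measure is `1`. -/
lemma twoMarginal_refMeasure (hN : 1 ≤ N) (hc : RegularChain N h F X lam k)
    (hU : IsUpward N h 0 lam k Potentials.zero U)
    (hD : IsDownward N h 0 lam k Potentials.zero D) (i : Fin N) :
    twoMarginal (refMeasure N lam k) i
      = ((lam i).prod (lam (i + 1))).withDensity fun z => ENNReal.ofReal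
          (U i z.1 * k i z.1 z.2 * D (i + 1) z.2) := by
  have hΦ : Potentials.zero.Cont := ⟨continuous_const, fun _ => continuous_const, continuous_const⟩
  have h1 := twoMarginal_withDensity_refMeasure (G := 0) hN hc continuous_zero hΦ hU hD
    (f := fun _ => 1) measurable_const (fun ω => by
      simp only [Potentials.zero, stepFactor, Pi.zero_apply, Real.exp_zero, mul_zero, ite_self,
        Finset.prod_const_one, mul_one]) i
  simpa [Potentials.zero] using h1

/-- The two-time marginals relative to those of the reference measure. -/
lemma twoMarginal_gibbs_eq_withDensity_twoMarginal (hN : 1 ≤ N) (hc : RegularChain N h F X lam k)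
    (hΦ : Φ.Cont) (hU : IsUpward N h (conj F) lam k Φ U)
    (hD : IsDownward N h (conj F) lam k Φ D)
    (hU' : IsUpward N h 0 lam k Potentials.zero U')
    (hD' : IsDownward N h 0 lam k Potentials.zero D') (i : Fin N) :
    twoMarginal (gibbs N h F Φ (refMeasure N lam k)) i
      = (twoMarginal (refMeasure N lam k) i).withDensity fun z => ENNReal.ofReal
          (U i z.1 / U' i z.1 * Real.exp (1 / h ^ 2 * (z.2 - z.1) * Φ.drift i z.1)
            * (D (i + 1) z.2 / D' (i + 1) z.2)) := by
  have hΦ0 : Potentials.zero.Cont := ⟨continuous_const, fun _ => continuous_const, continuous_const⟩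
  have hG := continuous_conj hc.convex hc.coercive
  have hUc : ∀ {G : ℝ → ℝ} {Ψ : Potentials} {V : ℕ → ℝ → ℝ}, Continuous G → Ψ.Cont →
      IsUpward N h G lam k Ψ V → Continuous (V i) ∧ ∀ x, 0 < V i x := by
    intro G Ψ V hG hΨ hV
    obtain ⟨h1, h2⟩ := hV.continuous_pos_rawUpward hc hG hΨ i i.2.le
    rw [funext (hV.eq_stepFactor_mul i.2)]
    exact ⟨(continuous_stepFactor hG hΨ i).mul h1,
      fun x => mul_pos (stepFactor_pos _ _ _ _ _) (h2 x)⟩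
  have hDc : ∀ {G : ℝ → ℝ} {Ψ : Potentials} {V : ℕ → ℝ → ℝ}, Continuous G → Ψ.Cont →
      IsDownward N h G lam k Ψ V → Continuous (V (i + 1)) ∧ ∀ x, 0 < V (i + 1) x :=
    fun hG hΨ hV => hV.continuous_pos hc hG hΨ (N - (i + 1)) (i + 1) (by omega) (by omega)
  obtain ⟨hU1, -⟩ := hUc hG hΦ hU
  obtain ⟨hU1', hU2'⟩ := hUc continuous_const hΦ0 hU'
  obtain ⟨hD1, -⟩ := hDc hG hΦ hD
  obtain ⟨hD1', hD2'⟩ := hDc continuous_const hΦ0 hD'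
  rw [twoMarginal_gibbs hN hc hΦ hU hD i, twoMarginal_refMeasure hN hc hU' hD' i,
    ← withDensity_mul]
  · congr 1
    ext z
    have h1 := (hU2' z.1).ne'
    have h2 := (hD2' z.2).ne'
    rw [Pi.mul_apply, ← ENNReal.ofReal_mul (mul_pos (mul_pos (hU2' z.1) (hc.pos i i.2 _ _))
      (hD2' z.2)).le]
    congr 1
    field_simp
  · exact (((hU1'.comp continuous_fst).mul (hc.cont i i.2)).mul
      (hD1'.comp continuous_snd)).measurable.ennreal_ofReal
  · exact ((((hU1.div hU1' fun x => (hU2' x).ne').comp continuous_fst).mul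
      (continuous_exp_increment hΦ i)).mul
      ((hD1.div hD1' fun x => (hD2' x).ne').comp continuous_snd)).measurable.ennreal_ofReal

end Recursions

/-! ### Extension of coefficients and potentials from the slices to the line -/

section Congruence

variable {N : ℕ} {h : ℝ} {F : ℝ → ℝ} {X : ℕ → Set ℝ} {lam : ℕ → Measure ℝ}
  {k k' : ℕ → ℝ → ℝ → ℝ} {Φ Φ' : Potentials} {ρ₀ ρ₁ : Measure ℝ} {R : Measure (Path N)}

lemma Potentials.EqOn.delta_eq (hΦ : Potentials.EqOn N X Φ Φ') {ω : Path N}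
    (hω : ω ∈ pathSpace N X) : delta N h F Φ ω = delta N h F Φ' ω := by
  have h1 : ∀ i : Fin N, Φ.drift i (ω i.castSucc) = Φ'.drift i (ω i.castSucc) :=
    fun i => hΦ.drift i i.2 (hω i.castSucc)
  rw [delta, delta, hΦ.init (hω 0), hΦ.final (hω (Fin.last N))]
  simp only [h1]

lemma Potentials.EqOn.gibbs_eq (hΦ : Potentials.EqOn N X Φ Φ')
    (hR : R (pathSpace N X)ᶜ = 0) : gibbs N h F Φ R = gibbs N h F Φ' R := by
  refine withDensity_congr_ae ?_
  have hae : ∀ᵐ ω ∂(R), ω ∈ pathSpace N X := mem_ae_iff.2 hR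
  filter_upwards [hae] with ω hω
  rw [hΦ.delta_eq hω]

lemma Potentials.EqOn.dualObjective_eq (hN : 1 ≤ N) (hΦ : Potentials.EqOn N X Φ Φ')
    (h0 : ρ₀ (X 0)ᶜ = 0) (h1 : ρ₁ (X N)ᶜ = 0) (hR : R (pathSpace N X)ᶜ = 0) :
    dualObjective N h F ρ₀ ρ₁ R Φ = dualObjective N h F ρ₀ ρ₁ R Φ' := by
  have hae : ∀ᵐ ω ∂(R), ω ∈ pathSpace N X := mem_ae_iff.2 hR
  have hae0 : ∀ᵐ x ∂ρ₀, x ∈ X 0 := mem_ae_iff.2 h0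
  have hae1 : ∀ᵐ x ∂ρ₁, x ∈ X N := mem_ae_iff.2 h1
  rw [dualObjective, dualObjective]
  congr 1
  · congr 2
    · refine integral_congr_ae ?_
      filter_upwards [hae0] with x hx
      rw [hΦ.init hx, hΦ.drift 0 hN hx]
    · refine integral_congr_ae ?_
      filter_upwards [hae1] with x hx
      rw [hΦ.final hx]
  · congr 1
    refine integral_congr_ae ?_
    filter_upwards [hae] with ω hω
    rw [hΦ.delta_eq hω]

lemma refMeasure_congr [∀ i, SigmaFinite (lam i)] (hs : ∀ i ≤ N, lam i (X i)ᶜ = 0)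
    (hk : ∀ i < N, ∀ x ∈ X i, ∀ y, k i x y = k' i x y) :
    refMeasure N lam k = refMeasure N lam k' := by
  refine withDensity_congr_ae ?_
  filter_upwards [ae_pi_mem_pathSpace hs] with ω hω
  congr 1
  exact Finset.prod_congr rfl fun i _ => hk i i.2 _ (hω i.castSucc) _

lemma exists_continuous_eqOn {f : ℝ → ℝ} {s : Set ℝ} (hs : IsClosed s) (hf : ContinuousOn f s) :
    ∃ g, Continuous g ∧ EqOn f g s := by
  obtain ⟨g, hg⟩ := ContinuousMap.exists_restrict_eq hs ⟨s.domRestrict f, hf.domRestrict⟩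
  exact ⟨g, g.continuous, fun x hx => (DFunLike.congr_fun hg ⟨x, hx⟩).symm⟩

/-- Tietze extension of the logarithm, followed by the exponential, preserves positivity. -/
lemma exists_continuous_pos_eqOn {f : ℝ → ℝ} {s : Set ℝ} (hs : IsClosed s)
    (hf : ContinuousOn f s) (hf0 : ∀ x ∈ s, 0 < f x) :
    ∃ g, Continuous g ∧ (∀ x, 0 < g x) ∧ EqOn f g s := by
  obtain ⟨g, hg, hfg⟩ := exists_continuous_eqOn hs (hf.log fun x hx => (hf0 x hx).ne')
  exact ⟨fun x => Real.exp (g x), hg.rexp, fun x => Real.exp_pos _, fun x hx => by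
    simp only [← hfg hx, Real.exp_log (hf0 x hx)]⟩

lemma Potentials.IsCont.exists_cont (hX : ∀ i ≤ N, IsCompact (X i)) (hΦ : Φ.IsCont N X) :
    ∃ Φ' : Potentials, Φ'.Cont ∧ Potentials.EqOn N X Φ Φ' := by
  obtain ⟨a, ha, ha'⟩ := exists_continuous_eqOn (hX 0 (Nat.zero_le _)).isClosed hΦ.1
  obtain ⟨c, hc, hc'⟩ := exists_continuous_eqOn (hX N le_rfl).isClosed hΦ.2.2
  have hb : ∀ i, ∃ g, Continuous g ∧ (i < N → Set.EqOn (Φ.drift i) g (X i)) := fun i => by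
    by_cases hi : i < N
    · obtain ⟨g, hg, hg'⟩ := exists_continuous_eqOn (hX i hi.le).isClosed (hΦ.2.1 i hi)
      exact ⟨g, hg, fun _ => hg'⟩
    · exact ⟨0, continuous_const, fun h => absurd h hi⟩
  choose b hb hb' using hb
  exact ⟨⟨a, b, c⟩, ⟨ha, hb, hc⟩, ⟨ha', hb', hc'⟩⟩

lemma Potentials.Cont.isCont (hΦ : Φ.Cont) : Φ.IsCont N X :=
  ⟨hΦ.init.continuousOn, fun i _ => (hΦ.drift i).continuousOn, hΦ.final.continuousOn⟩

end Congruence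

end EntropicSMOT

end

noncomputable section

namespace EntropicSMOT

/-! ### Consequences of the duality gap identity -/

section Optimality

variable {N : ℕ} {X : ℕ → Set ℝ} {h : ℝ} {F : ℝ → ℝ} {P Q : ProbabilityMeasure (Path N)}
  {ρ₀ ρ₁ : Measure ℝ} {R : Measure (Path N)} {Φ Ψ : Potentials}

lemma isFiniteMeasure_gibbs (hX : ∀ i ≤ N, IsCompact (X i)) (hF : ConvexOn ℝ univ F)
    (hFc : Tendsto (fun b => F b / |b|) (cocompact ℝ) atTop) (hΦ : Φ.Cont) [IsFiniteMeasure R]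
    (hR : R (pathSpace N X)ᶜ = 0) : IsFiniteMeasure (gibbs N h F Φ R) :=
  isFiniteMeasure_withDensity_ofReal (integrable_of_continuous_of_compact (isCompact_pathSpace hX)
    hR (continuous_const.mul (hΦ.continuous_delta hF hFc)).rexp).2

/-- Needed to conclude from `toReal = 0` that the divergence vanishes, as `toReal` also sends `∞` to
`0`. It holds because `ΔΦ` is bounded on path space. -/
lemma klDiv_gibbs_ne_top (hX : ∀ i ≤ N, IsCompact (X i)) (hF : ConvexOn ℝ univ F)
    (hFc : Tendsto (fun b => F b / |b|) (cocompact ℝ) atTop) (hΦ : Φ.Cont) [IsFiniteMeasure R]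
    (hQ : (Q : Measure (Path N)) (pathSpace N X)ᶜ = 0)
    (hac : (Q : Measure (Path N)) ≪ R) (hllr : Integrable (llr (Q : Measure (Path N)) R) Q) :
    InformationTheory.klDiv (Q : Measure (Path N)) (gibbs N h F Φ R) ≠ ∞ := by
  have hcd : Continuous fun ω : Path N => 1 / h * delta N h F Φ ω :=
    continuous_const.mul (hΦ.continuous_delta hF hFc)
  have hdi : Integrable (fun ω => 1 / h * delta N h F Φ ω) (Q : Measure (Path N)) :=
    integrable_of_continuous_of_compact (isCompact_pathSpace hX) hQ hcd
  have hl : llr (Q : Measure (Path N)) (gibbs N h F Φ R) =ᵐ[(Q : Measure (Path N))]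
      fun ω => llr (Q : Measure (Path N)) R ω - 1 / h * delta N h F Φ ω :=
    llr_withDensity_exp hac hcd.measurable
  exact InformationTheory.klDiv_ne_top
    (hac.trans (absolutelyContinuous_withDensity_exp hcd.measurable))
    ((integrable_congr hl).2 (hllr.sub hdi))

lemma integrable_llr_of_eq_gibbs (hX : ∀ i ≤ N, IsCompact (X i)) (hF : ConvexOn ℝ univ F)
    (hFc : Tendsto (fun b => F b / |b|) (cocompact ℝ) atTop) (hΦ : Φ.Cont) [IsFiniteMeasure R]
    (hP0 : (P : Measure (Path N)) (pathSpace N X)ᶜ = 0)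
    (hP : (P : Measure (Path N)) = gibbs N h F Φ R) :
    (P : Measure (Path N)) ≪ R ∧ Integrable (llr (P : Measure (Path N)) R) P := by
  have hcd : Continuous fun ω : Path N => 1 / h * delta N h F Φ ω :=
    continuous_const.mul (hΦ.continuous_delta hF hFc)
  have hac : (P : Measure (Path N)) ≪ R := hP ▸ withDensity_absolutelyContinuous _ _
  refine ⟨hac, (integrable_congr ?_).2
    (integrable_of_continuous_of_compact (isCompact_pathSpace hX) hP0 hcd)⟩
  have h1 : (P : Measure (Path N)).rnDeriv R =ᵐ[R]
      fun ω => ENNReal.ofReal (Real.exp (1 / h * delta N h F Φ ω)) := by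
    rw [hP]
    exact Measure.rnDeriv_withDensity R hcd.rexp.measurable.ennreal_ofReal
  filter_upwards [hac.ae_le h1] with ω hω
  rw [llr, hω, ENNReal.toReal_ofReal (Real.exp_pos _).le, Real.log_exp]

/-- The setting of the duality theorem: `P` has the prescribed marginals, is of exponential form,
and has no Fenchel gap. -/
structure IsOptimalPair (h : ℝ) (F : ℝ → ℝ) (X : ℕ → Set ℝ) (ρ₀ ρ₁ : Measure ℝ)
    (R : Measure (Path N)) (P : ProbabilityMeasure (Path N)) (Φ : Potentials) : Prop where
  cont : Φ.Cont
  supp : (P : Measure (Path N)) (pathSpace N X)ᶜ = 0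
  init : marginal (P : Measure (Path N)) 0 = ρ₀
  final : marginal (P : Measure (Path N)) (Fin.last N) = ρ₁
  eq_gibbs : (P : Measure (Path N)) = gibbs N h F Φ R
  fenchel : ∀ i : Fin N, ∀ᵐ x ∂marginal (P : Measure (Path N)) i.castSucc,
    F (drift h P i x) + conj F (-(1 / h) * Φ.drift i x)
      - -(1 / h) * Φ.drift i x * drift h P i x = 0

/-- The assumptions shared by the duality statements. -/
structure DualitySetting (N : ℕ) (h : ℝ) (F : ℝ → ℝ) (X : ℕ → Set ℝ) (R : Measure (Path N)) :
    Prop where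
  one_le : 1 ≤ N
  hpos : 0 < h
  compact : ∀ i ≤ N, IsCompact (X i)
  convex : ConvexOn ℝ univ F
  coercive : Tendsto (fun b => F b / |b|) (cocompact ℝ) atTop
  finite : IsFiniteMeasure R
  supp : R (pathSpace N X)ᶜ = 0

/-- Weak duality, with the relative entropy part of the gap. -/
lemma DualitySetting.dualObjective_add_klDiv_le (hs : DualitySetting N h F X R) (hΦ : Φ.Cont)
    (hQ : (Q : Measure (Path N)) (pathSpace N X)ᶜ = 0)
    (hQ0 : marginal (Q : Measure (Path N)) 0 = ρ₀)
    (hQ1 : marginal (Q : Measure (Path N)) (Fin.last N) = ρ₁)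
    (hac : (Q : Measure (Path N)) ≪ R) (hllr : Integrable (llr (Q : Measure (Path N)) R) Q) :
    ((dualObjective N h F ρ₀ ρ₁ R Φ
        + h * (InformationTheory.klDiv (Q : Measure (Path N)) (gibbs N h F Φ R)).toReal : ℝ) : EReal)
      ≤ primalObjective h F ρ₀ ρ₁ R Q := by
  have := hs.finite
  rw [primalObjective_eq_coe hQ0 hQ1 hac hllr, duality_gap hs.compact hs.one_le hs.hpos hs.convex
    hs.coercive hΦ hs.supp hQ hQ0 hQ1 hac hllr]
  refine EReal.coe_le_coe (le_add_of_nonneg_right (mul_nonneg hs.hpos.le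
    (Finset.sum_nonneg fun i _ => integral_nonneg fun x => ?_)))
  have := mul_sub_le_conj hs.convex hs.coercive (-(1 / h) * Φ.drift i x) (drift h Q i x)
  simp only [Pi.zero_apply]
  linarith

lemma DualitySetting.primalObjective_eq (hs : DualitySetting N h F X R)
    (hP : IsOptimalPair h F X ρ₀ ρ₁ R P Ψ) :
    primalObjective h F ρ₀ ρ₁ R P = ((dualObjective N h F ρ₀ ρ₁ R Ψ : ℝ) : EReal) := by
  have := hs.finite
  obtain ⟨hac, hllr⟩ := integrable_llr_of_eq_gibbs hs.compact hs.convex hs.coercive hP.cont hP.supp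
    hP.eq_gibbs
  have hgap : ∀ i : Fin N, ∫ x, (F (drift h P i x) + conj F (-(1 / h) * Ψ.drift i x)
      - -(1 / h) * Ψ.drift i x * drift h P i x) ∂marginal (P : Measure (Path N)) i.castSucc = 0 :=
    fun i => integral_eq_zero_of_ae (hP.fenchel i)
  rw [primalObjective_eq_coe hP.init hP.final hac hllr, duality_gap hs.compact hs.one_le hs.hpos
    hs.convex hs.coercive hP.cont hs.supp hP.supp hP.init hP.final hac hllr,
    Finset.sum_congr rfl fun i _ => hgap i, ← hP.eq_gibbs, InformationTheory.klDiv_self]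
  simp

lemma DualitySetting.isPrimalSolution (hs : DualitySetting N h F X R)
    (hP : IsOptimalPair h F X ρ₀ ρ₁ R P Ψ) : IsPrimalSolution h X F ρ₀ ρ₁ R P := by
  refine ⟨hP.supp, fun Q hQ => ?_⟩
  by_cases hne : primalObjective h F ρ₀ ρ₁ R Q = ⊤
  · rw [hne]; exact le_top
  obtain ⟨hQ0, hQ1, hac, hllr⟩ := of_primalObjective_ne_top hs.hpos hne
  refine le_trans ?_ (hs.dualObjective_add_klDiv_le hP.cont hQ hQ0 hQ1 hac hllr)
  rw [hs.primalObjective_eq hP]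
  exact EReal.coe_le_coe (le_add_of_nonneg_right (mul_nonneg hs.hpos.le ENNReal.toReal_nonneg))

/-- If the primal value does not exceed the dual value, the entropy part of the gap is zero. This
serves twice: for uniqueness of the primal solution and for the representation by an arbitrary dual
solution. -/
lemma DualitySetting.eq_gibbs_of_le (hs : DualitySetting N h F X R) (hΦ : Φ.Cont)
    (hQ : (Q : Measure (Path N)) (pathSpace N X)ᶜ = 0)
    (hQ0 : marginal (Q : Measure (Path N)) 0 = ρ₀)
    (hQ1 : marginal (Q : Measure (Path N)) (Fin.last N) = ρ₁)
    (hac : (Q : Measure (Path N)) ≪ R) (hllr : Integrable (llr (Q : Measure (Path N)) R) Q)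
    (hle : primalObjective h F ρ₀ ρ₁ R Q ≤ ((dualObjective N h F ρ₀ ρ₁ R Φ : ℝ) : EReal)) :
    (Q : Measure (Path N)) = gibbs N h F Φ R := by
  have := hs.finite
  have hfin := isFiniteMeasure_gibbs (h := h) hs.compact hs.convex hs.coercive hΦ hs.supp
  have h1 := EReal.coe_le_coe_iff.1
    ((hs.dualObjective_add_klDiv_le hΦ hQ hQ0 hQ1 hac hllr).trans hle)
  have h2 := klDiv_gibbs_ne_top (h := h) hs.compact hs.convex hs.coercive hΦ hQ hac hllr
  have h3 : (InformationTheory.klDiv (Q : Measure (Path N)) (gibbs N h F Φ R)).toReal = 0 :=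
    le_antisymm (by nlinarith [hs.hpos]) ENNReal.toReal_nonneg
  exact InformationTheory.klDiv_eq_zero_iff.1
    (((ENNReal.toReal_eq_zero_iff _).1 h3).resolve_right h2)

lemma DualitySetting.eq_of_isPrimalSolution (hs : DualitySetting N h F X R)
    (hP : IsOptimalPair h F X ρ₀ ρ₁ R P Ψ) (hQ : IsPrimalSolution h X F ρ₀ ρ₁ R Q) : Q = P := by
  have hle := hQ.2 P hP.supp
  rw [hs.primalObjective_eq hP] at hle
  obtain ⟨hQ0, hQ1, hac, hllr⟩ := of_primalObjective_ne_top hs.hpos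
    (ne_top_of_le_ne_top (EReal.coe_ne_top _) hle)
  exact Subtype.ext ((hs.eq_gibbs_of_le hP.cont hQ.1 hQ0 hQ1 hac hllr hle).trans hP.eq_gibbs.symm)

lemma DualitySetting.dualObjective_le (hs : DualitySetting N h F X R)
    (h0 : ρ₀ (X 0)ᶜ = 0) (h1 : ρ₁ (X N)ᶜ = 0)
    (hP : IsOptimalPair h F X ρ₀ ρ₁ R P Ψ) (hΦ : Φ.IsCont N X) :
    dualObjective N h F ρ₀ ρ₁ R Φ ≤ dualObjective N h F ρ₀ ρ₁ R Ψ := by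
  have := hs.finite
  obtain ⟨Φ', hΦ', hΦΦ'⟩ := hΦ.exists_cont hs.compact
  obtain ⟨hac, hllr⟩ := integrable_llr_of_eq_gibbs hs.compact hs.convex hs.coercive hP.cont hP.supp
    hP.eq_gibbs
  have hle := hs.dualObjective_add_klDiv_le hΦ' hP.supp hP.init hP.final hac hllr
  rw [hs.primalObjective_eq hP] at hle
  have hle' := EReal.coe_le_coe_iff.1 hle
  rw [hΦΦ'.dualObjective_eq hs.one_le h0 h1 hs.supp]
  have := mul_nonneg hs.hpos.le (ENNReal.toReal_nonneg (a :=
    InformationTheory.klDiv (P : Measure (Path N)) (gibbs N h F Φ' R)))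
  linarith

lemma DualitySetting.isDualSolution (hs : DualitySetting N h F X R)
    (h0 : ρ₀ (X 0)ᶜ = 0) (h1 : ρ₁ (X N)ᶜ = 0)
    (hP : IsOptimalPair h F X ρ₀ ρ₁ R P Ψ) : IsDualSolution N h X F ρ₀ ρ₁ R Ψ :=
  ⟨hP.cont.isCont, fun _ hΦ => hs.dualObjective_le h0 h1 hP hΦ⟩

/-- A dual solution has the value of the primal problem and represents the primal solution. -/
lemma DualitySetting.of_isDualSolution (hs : DualitySetting N h F X R)
    (h0 : ρ₀ (X 0)ᶜ = 0) (h1 : ρ₁ (X N)ᶜ = 0)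
    (hP : IsOptimalPair h F X ρ₀ ρ₁ R P Ψ) (hΦ : IsDualSolution N h X F ρ₀ ρ₁ R Φ) :
    primalObjective h F ρ₀ ρ₁ R P = ((dualObjective N h F ρ₀ ρ₁ R Φ : ℝ) : EReal) ∧
      (P : Measure (Path N)) = gibbs N h F Φ R := by
  have := hs.finite
  have heq : dualObjective N h F ρ₀ ρ₁ R Ψ = dualObjective N h F ρ₀ ρ₁ R Φ :=
    le_antisymm (hΦ.2 Ψ hP.cont.isCont) (hs.dualObjective_le h0 h1 hP hΦ.1)
  have hval : primalObjective h F ρ₀ ρ₁ R P = ((dualObjective N h F ρ₀ ρ₁ R Φ : ℝ) : EReal) := by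
    rw [hs.primalObjective_eq hP, heq]
  obtain ⟨Φ', hΦ', hΦΦ'⟩ := hΦ.1.exists_cont hs.compact
  obtain ⟨hac, hllr⟩ := integrable_llr_of_eq_gibbs hs.compact hs.convex hs.coercive hP.cont hP.supp
    hP.eq_gibbs
  refine ⟨hval, ?_⟩
  rw [hΦΦ'.gibbs_eq hs.supp]
  refine hs.eq_gibbs_of_le hΦ' hP.supp hP.init hP.final hac hllr ?_
  rw [hval, hΦΦ'.dualObjective_eq hs.one_le h0 h1 hs.supp]

end Optimality

/-! ### Regularity of the Gaussian transition densities -/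

section Gaussian

variable {N : ℕ} {h : ℝ} {X : ℕ → Set ℝ}

lemma continuous_refDensity (hh : 0 < h) {b w : ℕ → ℝ → ℝ} {a : ℕ → ℝ → ℝ≥0} {i : ℕ}
    (hb : Continuous (b i)) (ha : Continuous (a i)) (ha0 : ∀ x, 0 < a i x)
    (hw : Continuous (w i)) : Continuous (Function.uncurry (refDensity h b a w i)) := by
  have hv : Continuous fun z : ℝ × ℝ => ((h.toNNReal * a i z.1 : ℝ≥0) : ℝ) :=
    NNReal.continuous_coe.comp (continuous_const.mul (ha.comp continuous_fst))
  have hv0 : ∀ z : ℝ × ℝ, 0 < ((h.toNNReal * a i z.1 : ℝ≥0) : ℝ) := fun z =>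
    NNReal.coe_pos.2 (mul_pos (Real.toNNReal_pos.2 hh) (ha0 z.1))
  have hμ : Continuous fun z : ℝ × ℝ => z.1 + h * b i z.1 :=
    continuous_fst.add (continuous_const.mul (hb.comp continuous_fst))
  refine (hw.comp continuous_fst).mul (Continuous.mul (Continuous.inv₀
    (continuous_const.mul hv).sqrt fun z => ?_) ?_)
  · exact (Real.sqrt_pos.2 (mul_pos (by positivity) (hv0 z))).ne'
  · exact (((continuous_snd.sub hμ).pow 2).neg.div (continuous_const.mul hv)
      fun z => (mul_pos two_pos (hv0 z)).ne').rexp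

lemma refDensity_pos (hh : 0 < h) {b w : ℕ → ℝ → ℝ} {a : ℕ → ℝ → ℝ≥0} {i : ℕ} {x : ℝ}
    (ha0 : 0 < a i x) (hw : 0 < w i x) (y : ℝ) : 0 < refDensity h b a w i x y :=
  mul_pos hw (gaussianPDFReal_pos _ _ _ (mul_pos (Real.toNNReal_pos.2 hh) ha0).ne')

/-- The logarithm of the Gaussian density is Lipschitz continuous in the end point, uniformly on
compact sets. -/
lemma exists_refDensity_le_exp_mul (hh : 0 < h) {b w : ℕ → ℝ → ℝ} {a : ℕ → ℝ → ℝ≥0} {i : ℕ}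
    (hb : Continuous (b i)) (ha : Continuous (a i)) (ha0 : ∀ x, 0 < a i x)
    (hw : ∀ x, 0 < w i x) {Y Z : Set ℝ} (hY : IsCompact Y) (hZ : IsCompact Z) :
    ∃ C, 0 ≤ C ∧ ∀ x ∈ Y, ∀ y ∈ Z, ∀ y' ∈ Z,
      refDensity h b a w i x y ≤ Real.exp (C * |y - y'|) * refDensity h b a w i x y' := by
  have hv : Continuous fun x => ((h.toNNReal * a i x : ℝ≥0) : ℝ) :=
    NNReal.continuous_coe.comp (continuous_const.mul ha)
  have hv0 : ∀ x, 0 < ((h.toNNReal * a i x : ℝ≥0) : ℝ) := fun x =>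
    NNReal.coe_pos.2 (mul_pos (Real.toNNReal_pos.2 hh) (ha0 x))
  have hμ : Continuous fun x : ℝ => x + h * b i x := continuous_id.add (continuous_const.mul hb)
  -- The difference quotient of the Gaussian exponent in its end point, from factoring a difference
  -- of two squares; it is continuous, hence bounded on the compact set.
  set s : ℝ × ℝ × ℝ → ℝ := fun z => (z.2.1 + z.2.2 - 2 * (z.1 + h * b i z.1))
    / (2 * ((h.toNNReal * a i z.1 : ℝ≥0) : ℝ)) with hs
  have hsc : Continuous s :=
    (((continuous_fst.comp continuous_snd).add (continuous_snd.comp continuous_snd)).sub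
      (continuous_const.mul (hμ.comp continuous_fst))).div
      (continuous_const.mul (hv.comp continuous_fst)) fun z => (mul_pos two_pos (hv0 z.1)).ne'
  obtain ⟨C, hC⟩ := (hY.prod (hZ.prod hZ)).exists_bound_of_continuousOn hsc.continuousOn
  refine ⟨|C|, abs_nonneg _, fun x hx y hy y' hy' => ?_⟩
  have h1 : |s (x, y, y')| ≤ |C| := (hC (x, y, y') ⟨hx, hy, hy'⟩).trans (le_abs_self _)
  have h2 : (y' - y) * s (x, y, y') ≤ |C| * |y - y'| := by
    refine (le_abs_self _).trans ?_
    rw [abs_mul, abs_sub_comm, mul_comm]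
    exact mul_le_mul_of_nonneg_right h1 (abs_nonneg _)
  simp only [refDensity, gaussianPDFReal]
  have h3 : -(y - (x + h * b i x)) ^ 2 / (2 * ((h.toNNReal * a i x : ℝ≥0) : ℝ))
      ≤ |C| * |y - y'|
        + -(y' - (x + h * b i x)) ^ 2 / (2 * ((h.toNNReal * a i x : ℝ≥0) : ℝ)) := by
    refine le_trans (le_of_eq ?_) (add_le_add_left h2 _)
    simp only [hs]
    have := (hv0 x).ne'
    field_simp
    ring
  have h4 := Real.exp_le_exp.2 h3
  rw [Real.exp_add] at h4
  have h5 : 0 ≤ w i x * (√(2 * Real.pi * ((h.toNNReal * a i x : ℝ≥0) : ℝ)))⁻¹ :=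
    mul_nonneg (hw x).le (inv_nonneg.2 (Real.sqrt_nonneg _))
  have h6 := mul_le_mul_of_nonneg_left h4 h5
  calc _ = _ := by ring
    _ ≤ _ := h6
    _ = _ := by ring

/-- The coefficients of the reference chain extend to the whole line. -/
lemma exists_extension_refDensity (hh : 0 < h) (hX : ∀ i ≤ N, IsCompact (X i))
    {bbar : ℕ → ℝ → ℝ} (hbbar : ∀ i < N, ContinuousOn (bbar i) (X i))
    {abar : ℕ → ℝ → ℝ≥0} (habar : ∀ i < N, ContinuousOn (abar i) (X i))
    (habar_pos : ∀ i < N, ∀ x ∈ X i, 0 < abar i x)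
    {w : ℕ → ℝ → ℝ} (hw : ∀ i < N, ContinuousOn (w i) (X i))
    (hw_pos : ∀ i < N, ∀ x ∈ X i, 0 < w i x) :
    ∃ k : ℕ → ℝ → ℝ → ℝ, (∀ i < N, Continuous (Function.uncurry (k i))) ∧
      (∀ i < N, ∀ x y, 0 < k i x y) ∧
      (∀ i < N, ∀ x ∈ X i, ∀ y, refDensity h bbar abar w i x y = k i x y) ∧
      ∀ i < N, ∃ C, 0 ≤ C ∧ ∀ x ∈ X i, ∀ y ∈ X (i + 1), ∀ y' ∈ X (i + 1),
        k i x y ≤ Real.exp (C * |y - y'|) * k i x y' := by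
  have h1 : ∀ i, ∃ g, Continuous g ∧ (i < N → EqOn (bbar i) g (X i)) := fun i => by
    by_cases hi : i < N
    · obtain ⟨g, hg, hg'⟩ := exists_continuous_eqOn (hX i hi.le).isClosed (hbbar i hi)
      exact ⟨g, hg, fun _ => hg'⟩
    · exact ⟨0, continuous_const, fun h => absurd h hi⟩
  have h2 : ∀ i, ∃ g, Continuous g ∧ (∀ x, 0 < g x) ∧ (i < N → EqOn (w i) g (X i)) := fun i => by
    by_cases hi : i < N
    · obtain ⟨g, hg, hg0, hg'⟩ :=
        exists_continuous_pos_eqOn (hX i hi.le).isClosed (hw i hi) (hw_pos i hi)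
      exact ⟨g, hg, hg0, fun _ => hg'⟩
    · exact ⟨1, continuous_const, fun x => one_pos, fun h => absurd h hi⟩
  have h3 : ∀ i, ∃ g : ℝ → ℝ≥0, Continuous g ∧ (∀ x, 0 < g x) ∧
      (i < N → EqOn (abar i) g (X i)) := fun i => by
    by_cases hi : i < N
    · obtain ⟨g, hg, hg0, hg'⟩ := exists_continuous_pos_eqOn (hX i hi.le).isClosed
        (NNReal.continuous_coe.comp_continuousOn (habar i hi))
        fun x hx => NNReal.coe_pos.2 (habar_pos i hi x hx)
      refine ⟨fun x => (g x).toNNReal, continuous_real_toNNReal.comp hg,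
        fun x => Real.toNNReal_pos.2 (hg0 x), fun _ x hx => ?_⟩
      simp only [← hg' hx, Function.comp, Real.toNNReal_coe]
    · exact ⟨1, continuous_const, fun x => one_pos, fun h => absurd h hi⟩
  choose b hb hb' using h1
  choose v hv hv0 hv' using h2
  choose a ha ha0 ha' using h3
  refine ⟨refDensity h b a v, fun i _ => continuous_refDensity hh (hb i) (ha i) (ha0 i) (hv i),
    fun i _ x y => refDensity_pos hh (ha0 i x) (hv0 i x) y, fun i hi x hx y => ?_,
    fun i hi => exists_refDensity_le_exp_mul hh (hb i) (ha i) (ha0 i) (hv0 i) (hX i hi.le)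
      (hX (i + 1) hi)⟩
  rw [refDensity, refDensity, hb' i hi hx, hv' i hi hx, ha' i hi hx]

end Gaussian

end EntropicSMOT

end

/-! ### Assembly -/

theorem proposition5
    (N : ℕ) (hN : 1 ≤ N) (h : ℝ) (hh : 0 < h)
    -- the compact time slices and the measures on them
    (X : ℕ → Set ℝ) (hX : ∀ i ≤ N, IsCompact (X i))
    (m : ℕ → Measure ℝ) (hm_fin : ∀ i, IsFiniteMeasure (m i))
    (hm_supp : ∀ i, 1 ≤ i → i ≤ N → m i (X i)ᶜ = 0)
    (hm_nondeg : ∀ i, 1 ≤ i → i ≤ N → ∀ y : ℝ, m i {y}ᶜ ≠ 0)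
    -- the initial and final laws
    (ρ₀ : Measure ℝ) (hρ₀ : IsProbabilityMeasure ρ₀) (hρ₀_supp : ρ₀ (X 0)ᶜ = 0)
    (ρ₁ : Measure ℝ) (hρ₁ : IsProbabilityMeasure ρ₁)
    (r₁ : ℝ → ℝ) (hr₁_cont : ContinuousOn r₁ (X N)) (hr₁_pos : ∀ x ∈ X N, 0 < r₁ x)
    (hρ₁_dens : ρ₁ = (m N).withDensity fun x => ENNReal.ofReal (r₁ x))
    -- the cost
    (F : ℝ → ℝ) (hF : ConvexOn ℝ Set.univ F)
    (hF_coercive : Tendsto (fun b => F b / |b|) (cocompact ℝ) atTop)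
    -- the Gaussian reference chain
    (bbar : ℕ → ℝ → ℝ) (hbbar : ∀ i < N, ContinuousOn (bbar i) (X i))
    (abar : ℕ → ℝ → ℝ≥0) (habar : ∀ i < N, ContinuousOn (abar i) (X i))
    (habar_pos : ∀ i < N, ∀ x ∈ X i, 0 < abar i x)
    (w : ℕ → ℝ → ℝ) (hw : ∀ i < N, ContinuousOn (w i) (X i))
    (hw_pos : ∀ i < N, ∀ x ∈ X i, 0 < w i x)
    (lam : ℕ → Measure ℝ) (hlam : lam = EntropicSMOT.slice ρ₀ m)
    (k : ℕ → ℝ → ℝ → ℝ) (hk : k = EntropicSMOT.refDensity h bbar abar w)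
    (R : Measure (EntropicSMOT.Path N)) (hR : R = EntropicSMOT.refMeasure N lam k) :
    ∃ P : ProbabilityMeasure (EntropicSMOT.Path N),
      -- the primal problem has exactly one solution, and it is Markovian
      EntropicSMOT.IsPrimalSolution h X F ρ₀ ρ₁ R P ∧
      (∀ Q, EntropicSMOT.IsPrimalSolution h X F ρ₀ ρ₁ R Q → Q = P) ∧
      EntropicSMOT.IsMarkov P ∧
      -- it is the product of `ρ₀` and of its transition densities `P_{i,i+1} / P_i`
      (∀ i : Fin N, ∀ᵐ x ∂(EntropicSMOT.marginal (P : Measure (EntropicSMOT.Path N)) i.castSucc),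
        EntropicSMOT.transition P i x
          = (lam (i + 1)).withDensity (EntropicSMOT.transitionDensity lam P i x)) ∧
      (P : Measure (EntropicSMOT.Path N))
        = (Measure.pi fun i : Fin (N + 1) => lam i).withDensity
            (fun ω => ∏ i : Fin N,
              EntropicSMOT.transitionDensity lam P i (ω i.castSucc) (ω i.succ)) ∧
      -- the dual problem has a solution among the continuous potentials
      (∃ Φ, EntropicSMOT.IsDualSolution N h X F ρ₀ ρ₁ R Φ) ∧
      -- and every dual solution represents `P`
      ∀ Φ, EntropicSMOT.IsDualSolution N h X F ρ₀ ρ₁ R Φ →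
        EntropicSMOT.primalObjective h F ρ₀ ρ₁ R P
          = ((EntropicSMOT.dualObjective N h F ρ₀ ρ₁ R Φ : ℝ) : EReal) ∧
        (P : Measure (EntropicSMOT.Path N))
          = R.withDensity
              (fun ω => ENNReal.ofReal (Real.exp (1 / h * EntropicSMOT.delta N h F Φ ω))) ∧
        ∃ U D U' D' : ℕ → ℝ → ℝ,
          EntropicSMOT.IsUpward N h (EntropicSMOT.conj F) lam k Φ U ∧
          EntropicSMOT.IsDownward N h (EntropicSMOT.conj F) lam k Φ D ∧
          -- the same recursions for `R` itself
          EntropicSMOT.IsUpward N h 0 lam k EntropicSMOT.Potentials.zero U' ∧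
          EntropicSMOT.IsDownward N h 0 lam k EntropicSMOT.Potentials.zero D' ∧
          ∀ i : Fin N,
            -- with the reference transition density
            EntropicSMOT.twoMarginal (P : Measure (EntropicSMOT.Path N)) i
              = ((lam i).prod (lam (i + 1))).withDensity (fun z => ENNReal.ofReal
                  (U i z.1 * Real.exp (1 / h ^ 2 * (z.2 - z.1) * Φ.drift i z.1)
                    * k i z.1 z.2 * D (i + 1) z.2)) ∧
            -- with the two-time marginal of the reference measure
            EntropicSMOT.twoMarginal (P : Measure (EntropicSMOT.Path N)) i
              = (EntropicSMOT.twoMarginal R i).withDensity (fun z => ENNReal.ofReal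
                  (U i z.1 / U' i z.1 * Real.exp (1 / h ^ 2 * (z.2 - z.1) * Φ.drift i z.1)
                    * (D (i + 1) z.2 / D' (i + 1) z.2))) := by
  obtain ⟨n, rfl⟩ : ∃ n, N = n + 1 := ⟨N - 1, by omega⟩
  have hlam0 : lam 0 = ρ₀ := by rw [hlam]; rfl
  have hlamS : ∀ i, 1 ≤ i → lam i = m i := fun i hi => by
    rw [hlam, EntropicSMOT.slice, if_neg (by omega)]
  have hfin : ∀ i, IsFiniteMeasure (lam i) := fun i => by
    rcases Nat.eq_zero_or_pos i with rfl | hi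
    · rw [hlam0]; infer_instance
    · rw [hlamS i hi]; exact hm_fin i
  have hprob : IsProbabilityMeasure (lam 0) := by rw [hlam0]; exact hρ₀
  have hsupp : ∀ i ≤ n + 1, lam i (X i)ᶜ = 0 := fun i hiN => by
    rcases Nat.eq_zero_or_pos i with rfl | hi
    · rw [hlam0]; exact hρ₀_supp
    · rw [hlamS i hi]; exact hm_supp i hi hiN
  -- The coefficients are controlled only on the slices. Globally continuous positive kernels `k'`
  -- agreeing with `k` there define the same reference measure.
  obtain ⟨k', hk'c, hk'0, hkk', hk'C⟩ :=
    EntropicSMOT.exists_extension_refDensity hh hX hbbar habar habar_pos hw hw_pos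
  rw [← hk] at hkk'
  have hc : EntropicSMOT.RegularChain (n + 1) h F X lam k' :=
  { hpos := hh
    convex := hF
    coercive := hF_coercive
    compact := hX
    supp := hsupp
    init_ne_zero := IsProbabilityMeasure.ne_zero _
    nondeg := fun i hi hiN y => by rw [hlamS i hi]; exact hm_nondeg i hi hiN y
    cont := hk'c
    pos := hk'0 }
  have hRk : R = EntropicSMOT.refMeasure (n + 1) lam k' := by
    rw [hR]; exact EntropicSMOT.refMeasure_congr hsupp hkk'
  have hRsupp : R (EntropicSMOT.pathSpace (n + 1) X)ᶜ = 0 := by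
    rw [hRk]; exact EntropicSMOT.refMeasure_compl_eq_zero hsupp
  have hs : EntropicSMOT.DualitySetting (n + 1) h F X R :=
  { one_le := hN
    hpos := hh
    compact := hX
    convex := hF
    coercive := hF_coercive
    finite := by rw [hRk]; exact EntropicSMOT.isFiniteMeasure_refMeasure hX hsupp hk'c
    supp := hRsupp }
  obtain ⟨r, hr, hr0, hrr⟩ :=
    EntropicSMOT.exists_continuous_pos_eqOn (hX (n + 1) le_rfl).isClosed hr₁_cont hr₁_pos
  have haeN : ∀ᵐ y ∂lam (n + 1), y ∈ X (n + 1) := mem_ae_iff.2 (hsupp (n + 1) le_rfl)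
  have hρ₁r : (lam (n + 1)).withDensity (fun y => ENNReal.ofReal (r y)) = ρ₁ := by
    rw [hρ₁_dens, ← hlamS (n + 1) (by omega)]
    refine withDensity_congr_ae ?_
    filter_upwards [haeN] with y hy
    rw [hrr hy]
  have hρ₁_supp : ρ₁ (X (n + 1))ᶜ = 0 := by
    rw [← hρ₁r]
    exact withDensity_absolutelyContinuous _ _ (hsupp (n + 1) le_rfl)
  have hr1 : ∫ y, r y ∂lam (n + 1) = 1 := by
    have h1 : ∫⁻ y, ENNReal.ofReal (r y) ∂lam (n + 1) = 1 := by
      rw [← setLIntegral_univ, ← withDensity_apply _ MeasurableSet.univ, hρ₁r]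
      exact measure_univ
    rw [integral_eq_lintegral_of_nonneg_ae (Eventually.of_forall fun y => (hr0 y).le)
      hr.aestronglyMeasurable, h1, ENNReal.toReal_one]
  -- Only the last kernel needs the log-Lipschitz bound, since only the terminal function is varied.
  obtain ⟨C, hC0, hC⟩ := hk'C n (Nat.lt_succ_self n)
  obtain ⟨D, l, hD, hfit⟩ := hc.exists_fit hr hr0 hr1 hC0 hC
  obtain ⟨P, Ψ, hΨ, hPX, hP0, hP1, hPg, hPF, hPM, hPt, hPp⟩ := hD.exists_path_measure hc hfit
  rw [← hRk] at hPg
  rw [hρ₁r] at hP1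
  rw [hlam0] at hP0
  have hopt : EntropicSMOT.IsOptimalPair h F X ρ₀ ρ₁ R P Ψ := ⟨hΨ, hPX, hP0, hP1, hPg, hPF⟩
  refine ⟨P, hs.isPrimalSolution hopt, fun Q hQ => hs.eq_of_isPrimalSolution hopt hQ, hPM, hPt, hPp,
    ⟨Ψ, hs.isDualSolution hρ₀_supp hρ₁_supp hopt⟩, fun Φ hΦ => ?_⟩
  obtain ⟨hval, hgibbs⟩ := hs.of_isDualSolution hρ₀_supp hρ₁_supp hopt hΦ
  refine ⟨hval, hgibbs, ?_⟩
  -- The recursions in the conclusion use `k` and `Φ`, the marginal formulas are available for `k'`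
  -- and the extension `Φ'`. The two sets of solutions agree on the slices, which carry all the
  -- measures.
  obtain ⟨Φ', hΦ', hΦΦ'⟩ := hΦ.1.exists_cont hX
  have hz : EntropicSMOT.Potentials.EqOn (n + 1) X EntropicSMOT.Potentials.zero
      EntropicSMOT.Potentials.zero := ⟨fun _ _ => rfl, fun _ _ _ _ => rfl, fun _ _ => rfl⟩
  obtain ⟨E, hE⟩ := EntropicSMOT.exists_isDownward (n + 1) h (EntropicSMOT.conj F) lam k Φ
  obtain ⟨E', hE'⟩ := EntropicSMOT.exists_isDownward (n + 1) h 0 lam k EntropicSMOT.Potentials.zero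
  obtain ⟨B, hB⟩ := EntropicSMOT.exists_isDownward (n + 1) h (EntropicSMOT.conj F) lam k' Φ'
  obtain ⟨B', hB'⟩ := EntropicSMOT.exists_isDownward (n + 1) h 0 lam k' EntropicSMOT.Potentials.zero
  refine ⟨_, E, _, E', EntropicSMOT.isUpward_upward, hE, EntropicSMOT.isUpward_upward, hE',
    fun i => ?_⟩
  have hi : (i : ℕ) < n + 1 := i.2
  have hU := EntropicSMOT.IsUpward.eqOn hsupp hΦΦ' hkk' EntropicSMOT.isUpward_upward
    (EntropicSMOT.isUpward_upward (N := n + 1) (h := h) (G := EntropicSMOT.conj F)) i hi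
  have hU' := EntropicSMOT.IsUpward.eqOn hsupp hz hkk' EntropicSMOT.isUpward_upward
    (EntropicSMOT.isUpward_upward (N := n + 1) (h := h) (G := 0)) i hi
  have hDe := EntropicSMOT.IsDownward.eqOn hsupp hΦΦ' hkk' hE hB (n + 1 - (i + 1)) (i + 1)
    (by omega) (by omega)
  have hDe' := EntropicSMOT.IsDownward.eqOn hsupp hz hkk' hE' hB' (n + 1 - (i + 1)) (i + 1)
    (by omega) (by omega)
  have hPg' : (P : Measure (EntropicSMOT.Path (n + 1)))
      = EntropicSMOT.gibbs (n + 1) h F Φ' (EntropicSMOT.refMeasure (n + 1) lam k') := by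
    rw [hgibbs, ← hRk]; exact hΦΦ'.gibbs_eq hRsupp
  have haep : ∀ᵐ z ∂(lam i).prod (lam (i + 1)), z.1 ∈ X i ∧ z.2 ∈ X (i + 1) := by
    have h1 : ∀ᵐ x ∂lam i, x ∈ X i := mem_ae_iff.2 (hsupp i hi.le)
    have h2 : ∀ᵐ y ∂lam (i + 1), y ∈ X (i + 1) := mem_ae_iff.2 (hsupp (i + 1) hi)
    filter_upwards [Measure.quasiMeasurePreserving_fst.ae h1,
      Measure.quasiMeasurePreserving_snd.ae h2] with z hz1 hz2
    exact ⟨hz1, hz2⟩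
  constructor
  · rw [hPg', EntropicSMOT.twoMarginal_gibbs hN hc hΦ' EntropicSMOT.isUpward_upward hB i]
    refine withDensity_congr_ae ?_
    filter_upwards [haep] with z hz
    rw [hU hz.1, hDe hz.2, hΦΦ'.drift i hi hz.1, hkk' i hi z.1 hz.1]
  · rw [hPg', EntropicSMOT.twoMarginal_gibbs_eq_withDensity_twoMarginal hN hc hΦ'
      EntropicSMOT.isUpward_upward hB EntropicSMOT.isUpward_upward hB' i, ← hRk]
    refine withDensity_congr_ae ?_
    have hac : EntropicSMOT.twoMarginal R i ≪ (lam i).prod (lam (i + 1)) := by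
      rw [hRk, EntropicSMOT.twoMarginal_refMeasure hN hc EntropicSMOT.isUpward_upward hB' i]
      exact withDensity_absolutelyContinuous _ _
    filter_upwards [hac.ae_le haep] with z hz
    rw [hU hz.1, hU' hz.1, hDe hz.2, hDe' hz.2, hΦΦ'.drift i hi hz.1]
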